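/- Let $k$ be an imaginary quadratic field of discriminant $-d_k$ with a fixed embedding $k\hookrightarrow\mathbb C$, let $E=\mathbb C/\mathcal O_k$, and let $(M,h)$ be a positive definite Hermitian $\mathcal O_k$-lattice of rank $n$ with $\mathcal O_k$-valued Hermitian form $h$ ($\mathbb C$-linear in the first and conjugate-linear in the second variable on $M_{\mathbb R}$). Put $E_M=E\otimes_{\mathcal O_k}M=M_{\mathbb R}/M$. For $\lambda,\mu\in M_{\mathbb R}$ let $u_\lambda(x)=h(x,\lambda)$ on $M_{\mathbb R}$, and let $f(\lambda,\mu)=\frac{i}{\sqrt{d_k}}\,u_\mu^*dz\wedge u_\lambda^*d\bar z$, $f(\lambda)=f(\lambda,\lambda)$, which are harmonic $(1,1)$-forms on $E_M$. For $\lambda_1,\dots,\lambda_g\in M_{\mathbb R}$ let $[Z(\lambda_1,\dots,\lambda_g)]\in H^{g,g}(E_M,\mathbb C)$ be the class of $f(\lambda_1)\wedge\dots\wedge f(\lambda_g)$. Let $D=\frac{2}{\sqrt{d_k}}\operatorname{Im}h$ be the polarisation of $E_M$ (with $D(v,w)=\frac{2}{\sqrt{d_k}}\operatorname{Im}h(w,v)$),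 $L=D\cup\cdot$ the Lefschetz operator and $\delta:H^{g+1,g+1}\to H^{g,g}$ its adjoint for the Kähler metric with Kähler form $D$. Let $H_{g,g}$ be the space of linear functionals $\alpha$ on $H^{g,g}(E_M,\mathbb C)$ (complex homology classes of type $(g,g)$), and let $L^*:H_{g+1,g+1}\to H_{g,g}$ and $\delta^*:H_{g,g}\to H_{g+1,g+1}$ be the transposed maps. For $g\ge 0$ let $\mathcal F_{n,g}$ be the space of functions $P$ on $n\times g$ complex matrices $U=(\lambda_1,\dots,\lambda_g)$, polynomial in the entries and their conjugates, such that $P(UA)=|\det A|^2P(U)$ for all $A\in M_g(\mathbb C)$; it vanishes for $g>n$. On $\mathcal F_{n,\bullet}=\bigoplus_{g=0}^n\mathcal F_{n,g}$ let $\Delta:\mathcal F_{n,g}\to\mathcal F_{n,g-1}$ be the Laplacian $\sum_{s}\partial^2/\partial\lambda_g^{(s)}\partial\bar\lambda_g^{(s)}$ in the last column ($0$ if $g=0$), let $\Lambda P(U)=\operatorname{Tr}({}^tU\,\overline U\,(m_{ij}))$ for $P\in\mathcal F_{n,g-1}$, $U=(\lambda_1,\dots,\lambda_g)$, where $m_{ii}=P(\lambda_1,\dots,\widehat{\lambda_i},\dots,\lambda_g)$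 and $m_{ij}=-\lambda_i\cdot\partial m_{ii}/\partial\lambda_j$ for $i\ne j$, and let $H=-n+\sum_i\lambda_i\cdot\partial/\partial\lambda_i+\sum_i\bar\lambda_i\cdot\partial/\partial\bar\lambda_i$. Identify $(M_{\mathbb R},h)$ with $\mathbb C^n$ with its standard Hermitian form by a unitary basis. Then: (1) $(\delta^*,L^*,2g-n)$ on $\bigoplus_{g=0}^nH_{g,g}$ and $(\Lambda,\Delta,H)$ on $\mathcal F_{n,\bullet}$ define representations of $\mathfrak{sl}_2(\mathbb C)$ (with the standard generators $E,F,H$ acting by the three operators in this order). For $\alpha\in H_{g,g}$ the function $u(\alpha):(\lambda_1,\dots,\lambda_g)\mapsto Z(\lambda_1,\dots,\lambda_g)\cdot\alpha=\alpha\big(f(\lambda_1)\wedge\dots\wedge f(\lambda_g)\big)$ lies in $\mathcal F_{n,g}$, and the linear map $u:\bigoplus_gH_{g,g}\to\mathcal F_{n,\bullet}$ is a morphism of $\mathfrak{sl}_2(\mathbb C)$-representations. (2) For all $g\ge0$ and $\lambda_1,\dots,\lambda_{g+1}\in M_{\mathbb R}$, $\ \delta([Z(\lambda_1,\dots,\lambda_{g+1})])=\sum_{i,j}h(\lambda_j,\lambda_i)\,v_{ij}$,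 where $v_{ii}=\prod_{m\ne i}f(\lambda_m)$ and, for $i\neq j$, $v_{ij}=-f(\lambda_i,\lambda_j)\prod_{m\ne i,j}f(\lambda_m)$. (3) For all $g\ge0$ the function $\lambda\mapsto[Z(\lambda)]$ on $(M_{\mathbb R})^g$ is an element of the (direct) sum $$\bigoplus_{\ell=0}^{g}L^{g-\ell}H^{\ell,\ell}_{\mathrm{prim}}(E_M,\mathbb Q)\otimes\Lambda^{g-\ell}\mathcal F_{n,\ell}^{\mathrm{prim}},$$ where $H^{\ell,\ell}_{\mathrm{prim}}(E_M,\mathbb Q)$ is the kernel of $\delta$ on the rational classes in $H^{\ell,\ell}(E_M,\mathbb C)$, $\mathcal F_{n,\ell}^{\mathrm{prim}}=\ker(\Delta|\mathcal F_{n,\ell})$, and $W\otimes P$ is viewed as the function $\lambda\mapsto P(\lambda)W$. -/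

import Mathlib

open scoped ComplexConjugate ContDiff

noncomputable section

namespace HermitianCycles

/-! ### Differential forms on the torus `V / M` -/

/-- Complex valued alternating `p`-forms on the real vector space underlying `V`. -/
abbrev Alt (V : Type*) [NormedAddCommGroup V] [InnerProductSpace ℂ V] (p : ℕ) : Type _ :=
  V [⋀^Fin p]→L[ℝ] ℂ

/-- `M` is an `𝓞 k`-lattice in the Hermitian space `V = M_ℝ` (so that the complex torus
`E_M = E ⊗ M`, `E = ℂ / 𝓞 k`, is `V / M`) on which the Hermitian form is `𝓞 k`-valued. -/
structure IsHermitianLattice {k : Type*} [Field k] (τ : k →+* ℂ)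
    {V : Type*} [NormedAddCommGroup V] [InnerProductSpace ℂ V] (M : Submodule ℤ V) : Prop where
  discrete : DiscreteTopology M
  span_top : Submodule.span ℝ (M : Set V) = ⊤
  smul_mem : ∀ a : NumberField.RingOfIntegers k, ∀ m ∈ M, τ (a : k) • m ∈ M
  inner_mem : ∀ m ∈ M, ∀ m' ∈ M, ∃ a : NumberField.RingOfIntegers k, inner ℂ m m' = τ (a : k)

/-- The Hermitian form `h(x, y)`, `ℂ`-linear in `x` and conjugate-linear in `y`. -/
def herm {V : Type*} [NormedAddCommGroup V] [InnerProductSpace ℂ V] (x y : V) : ℂ := inner ℂ y x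

/-- The number `√d_k`, where `-d_k` is the discriminant of the imaginary quadratic field `k`. -/
def sqrtD (k : Type*) [Field k] [NumberField k] : ℝ := Real.sqrt |(NumberField.discr k : ℝ)|

section wedge

variable {V : Type*} [NormedAddCommGroup V] [InnerProductSpace ℂ V]

/-- Exterior product `η ↦ θ ∧ η` with a `1`-form `θ`, that is
`(θ ∧ η)(v_0, …, v_p) = ∑ i, (-1) ^ i * θ (v_i) * η (v_0, …, v_{i-1}, v_{i+1}, …, v_p)`. -/
def wedgeOne (θ : V →L[ℝ] ℂ) (p : ℕ) : Alt V p →L[ℂ] Alt V (p + 1) :=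
  LinearMap.mkContinuous
    { toFun := fun η => ContinuousAlternatingMap.alternatizeUncurryFin (θ.smulRight η)
      map_add' := fun η η' => by
        ext v
        simp [ContinuousAlternatingMap.alternatizeUncurryFin_apply, Finset.sum_add_distrib]
      map_smul' := fun c η => by
        ext v
        simp [ContinuousAlternatingMap.alternatizeUncurryFin_apply, Finset.mul_sum]
        refine Finset.sum_congr rfl fun i _ => ?_
        ring }
    ((p + 1) * ‖θ‖) fun η => by
      refine (ContinuousAlternatingMap.norm_alternatizeUncurryFin_le _).trans ?_
      rw [mul_assoc]
      refine mul_le_mul_of_nonneg_left ?_ (by positivity)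
      refine ContinuousLinearMap.opNorm_le_bound _ (by positivity) fun x => ?_
      rw [ContinuousLinearMap.smulRight_apply, norm_smul]
      calc ‖θ x‖ * ‖η‖ ≤ (‖θ‖ * ‖x‖) * ‖η‖ := by gcongr; exact θ.le_opNorm x
        _ = ‖θ‖ * ‖η‖ * ‖x‖ := by ring

theorem wedgeOne_apply (θ : V →L[ℝ] ℂ) (p : ℕ) (η : Alt V p) (v : Fin (p + 1) → V) :
    wedgeOne θ p η v = ∑ i : Fin (p + 1), (-1) ^ (i : ℕ) * (θ (v i) * η (i.removeNth v)) := by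
  simp [wedgeOne, ContinuousAlternatingMap.alternatizeUncurryFin_apply]

/-- The pull-back `u_l^* dz` of the invariant `1`-form `dz` of `E` under (the differential of) the
morphism `u_l : E_M → E`, `x ⊗ m ↦ h(m, l) x`, for `l ∈ M_ℝ`. -/
def pullDz (l : V) : V →L[ℝ] ℂ := (innerSL ℂ l).restrictScalars ℝ

/-- The pull-back `u_l^* dz̄`. -/
def pullDzBar (l : V) : V →L[ℝ] ℂ := Complex.conjCLE.toContinuousLinearMap ∘L pullDz l

/-- Double contraction `η ↦ η(x, y, …)`. -/
def contractTwo (x y : V) (p : ℕ) : Alt V (p + 2) →L[ℂ] Alt V p :=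
  LinearMap.mkContinuous
    { toFun := fun η => (η.curryLeft x).curryLeft y
      map_add' := fun η η' => by ext v; simp
      map_smul' := fun c η => by ext v; simp }
    (‖x‖ * ‖y‖) fun η => by
      have h1 := (η.curryLeft x).curryLeft.le_opNorm y
      have h2 := η.curryLeft.le_opNorm x
      rw [ContinuousAlternatingMap.norm_curryLeft] at h1 h2
      calc ‖(η.curryLeft x).curryLeft y‖ ≤ ‖η.curryLeft x‖ * ‖y‖ := h1
        _ ≤ (‖η‖ * ‖x‖) * ‖y‖ := by gcongr
        _ = ‖x‖ * ‖y‖ * ‖η‖ := by ring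

theorem contractTwo_apply (x y : V) (p : ℕ) (η : Alt V (p + 2)) (v : Fin p → V) :
    contractTwo x y p η v = η (Matrix.vecCons x (Matrix.vecCons y v)) := by
  simp [contractTwo]

/-- Exterior product `η ↦ f(l, l') ∧ η` with the `(1,1)`-form
`f(l, l') = (i / q) u_{l'}^* dz ∧ u_l^* dz̄` (where `q = √d_k`). It is `ℂ`-linear in `l` and
conjugate-linear in `l'`, and `f(l, l) = f(l) = u_l^* ω_E`, where `ω_E = (i / √d_k) dz ∧ dz̄` is the
invariant volume form of total mass `1` on `E = ℂ / 𝓞 k`. -/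
def wedgeF (q : ℝ) (l l' : V) (p : ℕ) : Alt V p →L[ℂ] Alt V (p + 2) :=
  (Complex.I / (q : ℂ)) • (wedgeOne (pullDz l') (p + 1) ∘L wedgeOne (pullDzBar l) p)

/-- The product `f(l_0, l'_0) ∧ … ∧ f(l_{g-1}, l'_{g-1})`. -/
def prodF (q : ℝ) : (g : ℕ) → (Fin g → V) → (Fin g → V) → Alt V (2 * g)
  | 0, _, _ => ContinuousAlternatingMap.constOfIsEmpty ℝ V (Fin 0) (1 : ℂ)
  | g + 1, l, l' => wedgeF q (l 0) (l' 0) (2 * g) (prodF q g (Fin.tail l) (Fin.tail l'))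

variable {n : ℕ}

/-- The Lefschetz operator `η ↦ D ∧ η`, where `D = (i / q) ∑ s, dz_s ∧ dz̄_s` (with `q = √d_k`) is the
polarisation of `E_M` given by `h`, written in unitary coordinates; see
`lefschetzForm_one_apply`. -/
def lefschetzForm (q : ℝ) (b : OrthonormalBasis (Fin n) ℂ V) (p : ℕ) :
    Alt V p →L[ℂ] Alt V (p + 2) :=
  (Complex.I / (q : ℂ)) •
    ∑ s : Fin n, wedgeOne (pullDz (b s)) (p + 1) ∘L wedgeOne (pullDzBar (b s)) p

/-- The adjoint `δ` of the Lefschetz operator with respect to the Kähler metric with Kähler form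
`D`: the contraction with the bivector dual to `D`. The vectors `b_s, i b_s` form an orthogonal
real basis with `D(b_s, i b_s) = 2 / q`. -/
def adjointForm (q : ℝ) (b : OrthonormalBasis (Fin n) ℂ V) (p : ℕ) :
    Alt V (p + 2) →L[ℂ] Alt V p :=
  ((q / 2 : ℝ) : ℂ) • ∑ s : Fin n, contractTwo (b s) (Complex.I • b s) p

/-- The form `D` is the alternating form `(v, w) ↦ (2 / √d_k) Im h(w, v)`, which is
`ℤ`-valued on a lattice on which `h` is `𝓞 k`-valued. -/
theorem lefschetzForm_one_apply (q : ℝ) (b : OrthonormalBasis (Fin n) ℂ V) (v : Fin 2 → V) :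
    lefschetzForm q b 0 (ContinuousAlternatingMap.constOfIsEmpty ℝ V (Fin 0) (1 : ℂ)) v =
      ((2 / q * (herm (v 1) (v 0)).im : ℝ) : ℂ) := by
  have h1 : (herm (v 1) (v 0) : ℂ) = ∑ s, conj (inner ℂ (b s) (v 0)) * inner ℂ (b s) (v 1) := by
    rw [herm, ← b.sum_inner_mul_inner]
    simp [inner_conj_symm]
  have h2 : ((herm (v 1) (v 0)).im : ℂ) = (herm (v 1) (v 0) - conj (herm (v 1) (v 0))) /
      (2 * Complex.I) := by
    rw [Complex.im_eq_sub_conj]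
  push_cast
  rw [h2, h1]
  simp only [lefschetzForm, smul_apply, sum_apply,
    ContinuousAlternatingMap.smul_apply, ContinuousAlternatingMap.sum_apply,
    ContinuousLinearMap.comp_apply, wedgeOne_apply, pullDz, pullDzBar]
  simp only [Nat.reduceAdd, Fin.sum_univ_two]
  simp [Fin.removeNth, map_sum, Finset.mul_sum, Finset.sum_div, ← Finset.sum_sub_distrib]
  refine Finset.sum_congr rfl fun s _ => ?_
  rw [div_eq_mul_inv _ (2 * Complex.I), mul_inv, Complex.inv_I]
  ring

/-- `η(c v_1, …, c v_p) = a * η(v_1, …, v_p)`. -/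
def Scales {p : ℕ} (c a : ℂ) (η : Alt V p) : Prop :=
  ∀ v : Fin p → V, η (fun i => c • v i) = a * η v

theorem Scales.wedgeOne {p : ℕ} {c a e : ℂ} {η : Alt V p} (h : Scales c a η) {θ : V →L[ℝ] ℂ}
    (hθ : ∀ x, θ (c • x) = e * θ x) : Scales c (e * a) (wedgeOne θ p η) := by
  intro v
  rw [wedgeOne_apply, wedgeOne_apply, Finset.mul_sum]
  refine Finset.sum_congr rfl fun i _ => ?_
  have : η (i.removeNth fun j => c • v j) = a * η (i.removeNth v) := h (i.removeNth v)
  rw [this, hθ]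
  ring

theorem pullDz_smul (l : V) (c : ℂ) (x : V) : pullDz l (c • x) = c * pullDz l x := by
  simp [pullDz]

theorem pullDzBar_smul (l : V) (c : ℂ) (x : V) :
    pullDzBar l (c • x) = conj c * pullDzBar l x := by
  simp [pullDzBar, pullDz_smul]

/-- Alternating `2g`-forms of type `(g, g)`: those on which `ℂˣ` acts through `|c|^{2g}`. -/
def IsTypeGG (g : ℕ) (η : Alt V (2 * g)) : Prop :=
  ∀ c : ℂ, Scales c (((‖c‖ ^ 2) ^ g : ℝ) : ℂ) η

theorem normSq_cast (c : ℂ) (g : ℕ) :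
    (((‖c‖ ^ 2) ^ (g + 1) : ℝ) : ℂ) = c * (conj c * (((‖c‖ ^ 2) ^ g : ℝ) : ℂ)) := by
  rw [← mul_assoc, Complex.mul_conj, Complex.normSq_eq_norm_sq, ← Complex.ofReal_mul, pow_succ']

theorem IsTypeGG.wedge {g : ℕ} {η : Alt V (2 * g)} (h : IsTypeGG g η) (l l' : V) :
    IsTypeGG (g + 1) (wedgeOne (pullDz l') (2 * g + 1) (wedgeOne (pullDzBar l) (2 * g) η)) := by
  intro c
  rw [normSq_cast]
  exact ((h c).wedgeOne (pullDzBar_smul l c)).wedgeOne (pullDz_smul l' c)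

theorem IsTypeGG.add {g : ℕ} {η η' : Alt V (2 * g)} (h : IsTypeGG g η) (h' : IsTypeGG g η') :
    IsTypeGG g (η + η') := fun c v => by
  rw [ContinuousAlternatingMap.add_apply, h c v, h' c v, ContinuousAlternatingMap.add_apply, mul_add]

theorem IsTypeGG.smul {g : ℕ} {η : Alt V (2 * g)} (h : IsTypeGG g η) (a : ℂ) :
    IsTypeGG g (a • η) := fun c v => by
  rw [ContinuousAlternatingMap.smul_apply, h c v, ContinuousAlternatingMap.smul_apply, smul_eq_mul,
    smul_eq_mul]
  ring

theorem IsTypeGG.zero {g : ℕ} : IsTypeGG g (0 : Alt V (2 * g)) := fun c v => by simp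

theorem IsTypeGG.sum {ι : Type*} (S : Finset ι) {g : ℕ} {η : ι → Alt V (2 * g)}
    (h : ∀ i ∈ S, IsTypeGG g (η i)) : IsTypeGG g (∑ i ∈ S, η i) :=
  Finset.sum_induction _ _ (fun _ _ => IsTypeGG.add) IsTypeGG.zero h

theorem IsTypeGG.lefschetzForm {g : ℕ} {η : Alt V (2 * g)} (h : IsTypeGG g η) (q : ℝ)
    (b : OrthonormalBasis (Fin n) ℂ V) : IsTypeGG (g + 1) (lefschetzForm q b (2 * g) η) := by
  have : HermitianCycles.lefschetzForm q b (2 * g) η = (Complex.I / (q : ℂ)) •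
      ∑ s : Fin n, HermitianCycles.wedgeOne (pullDz (b s)) (2 * g + 1)
        (HermitianCycles.wedgeOne (pullDzBar (b s)) (2 * g) η) := by
    simp [HermitianCycles.lefschetzForm]
  rw [this]
  exact (IsTypeGG.sum _ fun s _ => h.wedge (b s) (b s)).smul _

theorem contractTwo_rotate (c : ℂ) (x : V) (p : ℕ) (η : Alt V (p + 2)) :
    contractTwo (c • x) (Complex.I • c • x) p η =
      ((‖c‖ ^ 2 : ℝ) : ℂ) • contractTwo x (Complex.I • x) p η := by
  have h1 : c • x = c.re • x + c.im • (Complex.I • x) := by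
    conv_lhs => rw [← Complex.re_add_im c]
    rw [add_smul, mul_smul, Complex.coe_smul, Complex.coe_smul]
  have h2 : Complex.I • c • x = c.re • (Complex.I • x) - c.im • x := by
    conv_lhs => rw [← Complex.re_add_im c]
    rw [add_smul, mul_smul, Complex.coe_smul, Complex.coe_smul, smul_add, smul_comm Complex.I c.re,
      smul_comm Complex.I c.im, smul_smul Complex.I Complex.I, Complex.I_mul_I, neg_one_smul, smul_neg,
      sub_eq_add_neg]
  have key : ∀ y z : V, contractTwo y z p η = (η.curryLeft y).curryLeft z := fun _ _ => rfl
  have h0 : ∀ y z : V, (η.curryLeft y).curryLeft z = -(η.curryLeft z).curryLeft y := by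
    intro y z
    have := η.curryLeft_same (y + z)
    simp only [map_add, ContinuousAlternatingMap.curryLeft_add, add_apply,
      ContinuousAlternatingMap.curryLeft_same, zero_add, add_zero] at this
    exact eq_neg_of_add_eq_zero_right this
  rw [h2, h1, key, key]
  simp only [map_add, map_sub, map_smul, ContinuousAlternatingMap.curryLeft_add,
    ContinuousAlternatingMap.curryLeft_smul, add_apply, smul_apply,
    ContinuousAlternatingMap.curryLeft_same]
  rw [h0 (Complex.I • x) x, ← Complex.normSq_eq_norm_sq, Complex.normSq_apply]
  have h3 : ∀ (r : ℝ) (ξ : Alt V p), ((r : ℝ) : ℂ) • ξ = r • ξ := fun r ξ => by ext v; simp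
  rw [h3]
  module

theorem IsTypeGG.adjointForm {g : ℕ} {η : Alt V (2 * (g + 1))} (h : IsTypeGG (g + 1) η) (q : ℝ)
    (b : OrthonormalBasis (Fin n) ℂ V) : IsTypeGG g (adjointForm q b (2 * g) η) := by
  have : HermitianCycles.adjointForm q b (2 * g) η = ((q / 2 : ℝ) : ℂ) •
      ∑ s : Fin n, contractTwo (b s) (Complex.I • b s) (2 * g) η := by
    simp [HermitianCycles.adjointForm]
  rw [this]
  refine (IsTypeGG.sum _ fun s _ => ?_).smul _
  intro c v
  rcases eq_or_ne c 0 with rfl | hc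
  · rcases Nat.eq_zero_or_pos g with rfl | hg
    · simp
      congr 1
      exact Subsingleton.elim _ _
    · have : Nonempty (Fin (2 * g)) := ⟨⟨0, by omega⟩⟩
      simp only [zero_smul, norm_zero]
      rw [show (fun _ : Fin (2 * g) => (0 : V)) = 0 from rfl, ContinuousAlternatingMap.map_zero]
      simp [hg.ne']
  · have hc' : (((‖c⁻¹‖ ^ 2 : ℝ) : ℂ)) ≠ 0 := by
      simp [hc]
    have h1 := h c (Matrix.vecCons (c⁻¹ • b s) (Matrix.vecCons (Complex.I • c⁻¹ • b s) v))
    have h2 : (fun i => c • (Matrix.vecCons (c⁻¹ • b s)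
        (Matrix.vecCons (Complex.I • c⁻¹ • b s) v) : Fin (2 * g + 2) → V) i) =
        Matrix.vecCons (b s) (Matrix.vecCons (Complex.I • b s) fun i => c • v i) := by
      funext i
      refine Fin.cases ?_ (fun i => Fin.cases ?_ (fun i => ?_) i) i
      · simp [smul_smul, hc]
      · simp [smul_smul, mul_left_comm c, hc]
      · simp
    have h3 := congrArg (fun ξ : Alt V (2 * g) => ξ v) (contractTwo_rotate c⁻¹ (b s) (2 * g) η)
    simp only [contractTwo_apply, ContinuousAlternatingMap.smul_apply, smul_eq_mul] at h3
    rw [contractTwo_apply, contractTwo_apply]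
    refine (congrArg η h2.symm).trans (h1.trans ?_)
    refine (congrArg (fun z => (((‖c‖ ^ 2) ^ (g + 1) : ℝ) : ℂ) * z) h3).trans ?_
    rw [← mul_assoc, ← Complex.ofReal_mul]
    congr 2
    have : ‖c‖ ≠ 0 := by simpa using hc
    rw [norm_inv]
    field_simp
    ring

theorem isTypeGG_prodF (q : ℝ) : ∀ (g : ℕ) (l l' : Fin g → V), IsTypeGG g (prodF q g l l')
  | 0, _, _ => fun c v => by simp [prodF]
  | g + 1, l, l' => ((isTypeGG_prodF q g (Fin.tail l) (Fin.tail l')).wedge (l 0) (l' 0)).smul _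

end wedge

/-! ### Harmonic forms, Hodge classes and the Lefschetz operators -/

section harmonic

variable {V : Type*} [NormedAddCommGroup V] [InnerProductSpace ℂ V] [FiniteDimensional ℂ V]

attribute [local instance] InnerProductSpace.complexToReal

/-- The space `H^{g,g}(E_M, ℂ)` of harmonic forms of type `(g, g)` on `E_M = V / M`, as `M`-periodic
forms on `V`: for the flat metric the Hodge Laplacian acts (up to sign) on the coefficients as the
Laplacian of `V`. -/
def harmonicForms (M : Submodule ℤ V) (g : ℕ) : Submodule ℂ (V → Alt V (2 * g)) where
  carrier := {φ | ContDiff ℝ ∞ φ ∧ (∀ m ∈ M, ∀ x, φ (x + m) = φ x) ∧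
    InnerProductSpace.HarmonicOnNhd φ Set.univ ∧ ∀ x, IsTypeGG g (φ x)}
  add_mem' := fun {φ φ'} h h' =>
    ⟨h.1.add h'.1, fun m hm x => by simp [h.2.1 m hm x, h'.2.1 m hm x],
      h.2.2.1.add h'.2.2.1, fun x => (h.2.2.2 x).add (h'.2.2.2 x)⟩
  zero_mem' := ⟨contDiff_const, fun _ _ _ => rfl, InnerProductSpace.harmonicOnNhd_const 0,
    fun _ => IsTypeGG.zero⟩
  smul_mem' := fun c φ h =>
    ⟨contDiff_const.smul h.1, fun m hm x => by simp [h.2.1 m hm x],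
      h.2.2.1.comp_CLM ((c • ContinuousLinearMap.id ℂ (Alt V (2 * g))).restrictScalars ℝ),
      fun x => (h.2.2.2 x).smul c⟩

/-- A constant coefficient operator acting on harmonic forms. -/
def mapForms (M : Submodule ℤ V) {g g' : ℕ} (T : Alt V (2 * g) →L[ℂ] Alt V (2 * g'))
    (hT : ∀ η, IsTypeGG g η → IsTypeGG g' (T η)) : harmonicForms M g →ₗ[ℂ] harmonicForms M g' where
  toFun := fun φ => ⟨fun x => T (φ.1 x),
    ⟨(T.restrictScalars ℝ).contDiff.comp φ.2.1,
      fun m hm x => congrArg T (φ.2.2.1 m hm x),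
      φ.2.2.2.1.comp_CLM (T.restrictScalars ℝ), fun x => hT _ (φ.2.2.2.2 x)⟩⟩
  map_add' := fun φ φ' => by ext1; funext x; exact map_add T _ _
  map_smul' := fun c φ => by ext1; funext x; exact map_smul T c _

/-- The translation invariant (hence harmonic) form with value `η`. -/
def constForm (M : Submodule ℤ V) {g : ℕ} (η : Alt V (2 * g)) (h : IsTypeGG g η) :
    harmonicForms M g :=
  ⟨fun _ => η,
    ⟨contDiff_const, fun _ _ _ => rfl, InnerProductSpace.harmonicOnNhd_const η, fun _ => h⟩⟩

end harmonic

section lefschetz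

variable {V : Type*} [NormedAddCommGroup V] [InnerProductSpace ℂ V] [FiniteDimensional ℂ V]

/-- The Lefschetz operator `L = D ∪ · : H^{g,g}(E_M) → H^{g+1,g+1}(E_M)`. -/
def lef (M : Submodule ℤ V) (q : ℝ) {n : ℕ} (b : OrthonormalBasis (Fin n) ℂ V) (g : ℕ) :
    harmonicForms M g →ₗ[ℂ] harmonicForms M (g + 1) :=
  mapForms M (g := g) (g' := g + 1) (lefschetzForm q b (2 * g)) fun _ h => h.lefschetzForm q b

/-- The adjoint `δ : H^{g+1,g+1}(E_M) → H^{g,g}(E_M)` of the Lefschetz operator. -/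
def adj (M : Submodule ℤ V) (q : ℝ) {n : ℕ} (b : OrthonormalBasis (Fin n) ℂ V) (g : ℕ) :
    harmonicForms M (g + 1) →ₗ[ℂ] harmonicForms M g :=
  mapForms M (g := g + 1) (g' := g) (adjointForm q b (2 * g)) fun _ h => h.adjointForm q b

/-- The class `[Z(l_1, …, l_g)]`, that is the harmonic form `f(l_1) ∧ … ∧ f(l_g)`, which makes sense
for all `l_i ∈ M_ℝ`. -/
def zClass (M : Submodule ℤ V) (q : ℝ) {g : ℕ} (l : Fin g → V) : harmonicForms M g :=
  constForm M (prodF q g l l) (isTypeGG_prodF q g l l)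

/-- The classes `v_{ij}`: `v_{ii}` is the product of all `f(l_m)`, `m ≠ i`, and for `i ≠ j` the
class `v_{ij}` is minus the product of the `f(l_m)`, `m ≠ i`, in which the factor
`f(l_j) = f(l_j, l_j)` is replaced by `f(l_i, l_j)`. -/
def vClass (M : Submodule ℤ V) (q : ℝ) {g : ℕ} (l : Fin (g + 1) → V) (i j : Fin (g + 1)) :
    harmonicForms M g :=
  (if i = j then (1 : ℂ) else -1) •
    constForm M
      (prodF q g (fun m => Function.update l j (l i) (i.succAbove m)) fun m => l (i.succAbove m))
      (isTypeGG_prodF q g _ _)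

/-- `⨁ H^{g,g}(E_M, ℂ)`. There is no nonzero form of type `(g, g)` for `g > n`, so that the product
over all `g` is the direct sum over `0 ≤ g ≤ n`; see `harmonicForms_eq_bot`. -/
abbrev Cohomology (M : Submodule ℤ V) : Type _ := (g : ℕ) → harmonicForms M g

/-- `⨁ H_{g,g}(E_M, ℂ)`: a homology class of type `(g, g)` is a linear functional
`β ↦ ∫_α β` on `H^{g,g}(E_M, ℂ)`. -/
abbrev Homology (M : Submodule ℤ V) : Type _ := (g : ℕ) → Module.Dual ℂ (harmonicForms M g)

theorem harmonicForms_eq_bot (M : Submodule ℤ V) {n : ℕ} (b : OrthonormalBasis (Fin n) ℂ V) {g : ℕ}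
    (hg : n < g) : harmonicForms M g = ⊥ := by
  rw [eq_bot_iff]
  intro φ _
  rw [Submodule.mem_bot]
  funext x
  ext v
  have hn : Module.finrank ℝ V = 2 * n := by
    rw [finrank_real_of_complex, Module.finrank_eq_card_basis b.toBasis, Fintype.card_fin]
  have : ¬ LinearIndependent ℝ v := fun h => by
    have := h.fintype_card_le_finrank
    rw [hn, Fintype.card_fin] at this
    omega
  exact (φ x).toAlternatingMap.map_linearDependent v this

/-- The Lefschetz operator on `⨁ H^{g,g}`. -/
def lefTot (M : Submodule ℤ V) (q : ℝ) {n : ℕ} (b : OrthonormalBasis (Fin n) ℂ V) :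
    Cohomology M →ₗ[ℂ] Cohomology M where
  toFun := fun W g => match g with
    | 0 => 0
    | g + 1 => lef M q b g (W g)
  map_add' := fun W W' => by funext g; cases g <;> simp
  map_smul' := fun c W => by funext g; cases g <;> simp

/-- The adjoint of the Lefschetz operator on `⨁ H^{g,g}`. -/
def adjTot (M : Submodule ℤ V) (q : ℝ) {n : ℕ} (b : OrthonormalBasis (Fin n) ℂ V) :
    Cohomology M →ₗ[ℂ] Cohomology M where
  toFun := fun W g => adj M q b g (W (g + 1))
  map_add' := fun W W' => by funext g; simp
  map_smul' := fun c W => by funext g; simp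

/-- The dual `L^* : H_{g+1,g+1} → H_{g,g}` of the Lefschetz operator. -/
def lefDual (M : Submodule ℤ V) (q : ℝ) {n : ℕ} (b : OrthonormalBasis (Fin n) ℂ V)
    (α : Homology M) : Homology M :=
  fun g => α (g + 1) ∘ₗ lef M q b g

/-- The dual `δ^* : H_{g,g} → H_{g+1,g+1}` of the adjoint of the Lefschetz operator. -/
def adjDual (M : Submodule ℤ V) (q : ℝ) {n : ℕ} (b : OrthonormalBasis (Fin n) ℂ V)
    (α : Homology M) : Homology M
  | 0 => 0
  | g + 1 => α g ∘ₗ adj M q b g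

/-- The weight operator, multiplication by `2g - n` on `H_{g,g}`. -/
def weightDual (M : Submodule ℤ V) (n : ℕ) (α : Homology M) : Homology M :=
  fun g => (2 * (g : ℂ) - (n : ℂ)) • α g

/-- Rational classes: all periods over the `2g`-dimensional subtori of `V / M` spanned by lattice
vectors `m_1, …, m_{2g}` (which generate the rational homology of `V / M`) are rational. -/
def IsRational {M : Submodule ℤ V} {g : ℕ} (φ : harmonicForms M g) : Prop :=
  ∀ m : Fin (2 * g) → V, (∀ i, m i ∈ M) → ∃ r : ℚ,
    ∫ t in Set.Icc (0 : Fin (2 * g) → ℝ) 1, φ.1 (∑ i, t i • m i) m = (r : ℂ)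

/-- `H^{ℓ,ℓ}_prim(E_M, ℚ)`: the primitive rational Hodge classes, placed in degree `ℓ`. -/
def primHodge (M : Submodule ℤ V) (q : ℝ) {n : ℕ} (b : OrthonormalBasis (Fin n) ℂ V) (ℓ : ℕ) :
    Set (Cohomology M) :=
  {W | (∀ j, j ≠ ℓ → W j = 0) ∧ adjTot M q b W = 0 ∧ IsRational (W ℓ)}

end lefschetz

/-! ### The spaces `F_{n,g}` and their `sl₂`-action -/

section polynomials

/-- `F_{n,g}`: the functions `P` on `n × g` complex matrices, polynomial in the entries and their
conjugates, with `P (U A) = |det A|² P U`. -/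
def polySpace (n g : ℕ) : Submodule ℂ (Matrix (Fin n) (Fin g) ℂ → ℂ) where
  carrier := {P |
    (∃ Q : MvPolynomial ((Fin n × Fin g) ⊕ (Fin n × Fin g)) ℂ, ∀ U : Matrix (Fin n) (Fin g) ℂ,
      P U = MvPolynomial.eval (Sum.elim (fun p => U p.1 p.2) fun p => conj (U p.1 p.2)) Q) ∧
    ∀ (U : Matrix (Fin n) (Fin g) ℂ) (A : Matrix (Fin g) (Fin g) ℂ),
      P (U * A) = ((‖A.det‖ ^ 2 : ℝ) : ℂ) * P U}
  add_mem' := by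
    rintro P P' ⟨⟨Q, hQ⟩, h⟩ ⟨⟨Q', hQ'⟩, h'⟩
    exact ⟨⟨Q + Q', fun U => by simp [hQ, hQ']⟩, fun U A => by simp [h, h', mul_add]⟩
  zero_mem' := ⟨⟨0, fun U => by simp⟩, fun U A => by simp⟩
  smul_mem' := by
    rintro c P ⟨⟨Q, hQ⟩, h⟩
    exact ⟨⟨MvPolynomial.C c * Q, fun U => by simp [hQ]⟩, fun U A => by
      simp only [Pi.smul_apply, h, smul_eq_mul]; ring⟩

/-- The derivative `∑ W_{si} ∂P/∂λ_i^{(s)}` at `U`. -/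
def holDeriv {n g : ℕ} (P : Matrix (Fin n) (Fin g) ℂ → ℂ) (W U : Matrix (Fin n) (Fin g) ℂ) : ℂ :=
  (lineDeriv ℝ P U W - Complex.I * lineDeriv ℝ P U (Complex.I • W)) / 2

/-- The derivative `∑ W̄_{si} ∂P/∂λ̄_i^{(s)}` at `U`. -/
def antiDeriv {n g : ℕ} (P : Matrix (Fin n) (Fin g) ℂ → ℂ) (W U : Matrix (Fin n) (Fin g) ℂ) : ℂ :=
  (lineDeriv ℝ P U W + Complex.I * lineDeriv ℝ P U (Complex.I • W)) / 2

/-- The matrix with column `j` equal to `v`, and `0` elsewhere: `holDeriv P (column j v) U` is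
`v · ∂P/∂λ_j`. -/
def column {n g : ℕ} (j : Fin g) (v : Fin n → ℂ) : Matrix (Fin n) (Fin g) ℂ :=
  Matrix.of fun s i => if i = j then v s else 0

/-- The Laplacian `Δ_g P (λ_1, …, λ_{g-1})`, `Δ_g = ∑ s, ∂²/∂λ_g^{(s)} ∂λ̄_g^{(s)}`. On `F_{n,g}` it
does not depend on `λ_g`, which is set to `0`. -/
def laplace {n g : ℕ} (P : Matrix (Fin n) (Fin (g + 1)) ℂ → ℂ) : Matrix (Fin n) (Fin g) ℂ → ℂ :=
  fun U => ∑ s : Fin n,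
    holDeriv (antiDeriv P (column (Fin.last g) (Pi.single s 1))) (column (Fin.last g) (Pi.single s 1))
      (Matrix.of fun r => Fin.snoc (U r) (0 : ℂ))

/-- The matrix `(m_{ij})`: `m_{ii} = P (λ_1, …, λ_{i-1}, λ_{i+1}, …)` and
`m_{ij} = - λ_i · ∂m_{ii}/∂λ_j` for `i ≠ j`. -/
def minorMatrix {n g : ℕ} (P : Matrix (Fin n) (Fin g) ℂ → ℂ) (U : Matrix (Fin n) (Fin (g + 1)) ℂ) :
    Matrix (Fin (g + 1)) (Fin (g + 1)) ℂ :=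
  Matrix.of fun i j =>
    if i = j then P (U.submatrix id i.succAbove)
    else -holDeriv (fun U' : Matrix (Fin n) (Fin (g + 1)) ℂ => P (U'.submatrix id i.succAbove))
      (column j fun s => U s i) U

/-- The raising operator `Λ P (U) = Tr (ᵗU Ū m)`. -/
def raise {n g : ℕ} (P : Matrix (Fin n) (Fin g) ℂ → ℂ) : Matrix (Fin n) (Fin (g + 1)) ℂ → ℂ :=
  fun U => (U.transpose * U.map conj * minorMatrix P U).trace

/-- The operator `H = -n + ∑ i, λ_i · ∂/∂λ_i + ∑ i, λ̄_i · ∂/∂λ̄_i`. -/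
def degree {n g : ℕ} (P : Matrix (Fin n) (Fin g) ℂ → ℂ) : Matrix (Fin n) (Fin g) ℂ → ℂ :=
  fun U => -(n : ℂ) * P U + ∑ i : Fin g, holDeriv P (column i fun s => U s i) U +
    ∑ i : Fin g, antiDeriv P (column i fun s => U s i) U

/-- Families of functions on `n × g` matrices, for all `g`. -/
abbrev Family (n : ℕ) : Type := (g : ℕ) → Matrix (Fin n) (Fin g) ℂ → ℂ

/-- `F_{n,•} = ⨁ F_{n,g}`. Since `F_{n,g} = 0` for `g > n` (see `polySpace_eq_bot`), the product over
all `g` is the direct sum over `0 ≤ g ≤ n`. -/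
def polyTot (n : ℕ) : Submodule ℂ (Family n) where
  carrier := {P | ∀ g, P g ∈ polySpace n g}
  add_mem' := fun h h' g => (polySpace n g).add_mem (h g) (h' g)
  zero_mem' := fun g => (polySpace n g).zero_mem
  smul_mem' := fun c _ h g => (polySpace n g).smul_mem c (h g)

theorem polySpace_eq_bot {n g : ℕ} (hg : n < g) : polySpace n g = ⊥ := by
  rw [eq_bot_iff]
  intro P hP
  rw [Submodule.mem_bot]
  funext U
  have h := hP.2 (Matrix.of fun s i => if (i : ℕ) = s then 1 else 0)
    (Matrix.of fun i j => if h : (i : ℕ) < n then U ⟨i, h⟩ j else 0)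
  rw [Matrix.det_eq_zero_of_row_eq_zero ⟨n, hg⟩ (by simp)] at h
  have hU : (Matrix.of fun (s : Fin n) (i : Fin g) => if (i : ℕ) = s then (1 : ℂ) else 0) *
      (Matrix.of fun (i : Fin g) (j : Fin g) => if h : (i : ℕ) < n then U ⟨i, h⟩ j else 0) = U := by
    ext s j
    rw [Matrix.mul_apply, Finset.sum_eq_single ⟨s, s.2.trans hg⟩]
    · simp
    · intro i _ hi
      have : (i : ℕ) ≠ s := fun h => hi (Fin.ext h)
      simp [this]
    · simp
  rw [hU] at h
  simpa using h

/-- `Λ` on families. -/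
def raiseTot {n : ℕ} (P : Family n) : Family n
  | 0 => 0
  | g + 1 => raise (P g)

/-- `Δ` on families (it is `0` on `F_{n,0}`). -/
def laplaceTot {n : ℕ} (P : Family n) : Family n := fun g => laplace (P (g + 1))

/-- `H` on families. -/
def degreeTot {n : ℕ} (P : Family n) : Family n := fun g => degree (P g)

/-- `F_{n,ℓ}^prim = ker Δ_ℓ`, placed in degree `ℓ`. -/
def primPoly (n ℓ : ℕ) : Set (Family n) :=
  {P | P ∈ polyTot n ∧ (∀ j, j ≠ ℓ → P j = 0) ∧ laplaceTot P = 0}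

end polynomials

/-! ### The statement -/

/-- The element `E` of the standard basis `E, F, H` of `sl₂(ℂ)`. -/
def slE : LieAlgebra.SpecialLinear.sl (Fin 2) ℂ :=
  ⟨!![0, 1; 0, 0], by simp [LieAlgebra.SpecialLinear.sl, Matrix.trace_fin_two]⟩

/-- The element `F` of the standard basis of `sl₂(ℂ)`. -/
def slF : LieAlgebra.SpecialLinear.sl (Fin 2) ℂ :=
  ⟨!![0, 0; 1, 0], by simp [LieAlgebra.SpecialLinear.sl, Matrix.trace_fin_two]⟩

/-- The element `H` of the standard basis of `sl₂(ℂ)`. -/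
def slH : LieAlgebra.SpecialLinear.sl (Fin 2) ℂ :=
  ⟨!![1, 0; 0, -1], by simp [LieAlgebra.SpecialLinear.sl, Matrix.trace_fin_two]⟩

/-- The vectors `λ_1, …, λ_g ∈ M_ℝ` whose coordinates in the unitary basis `b` are the columns of
`U`. -/
def vectors {V : Type*} [NormedAddCommGroup V] [InnerProductSpace ℂ V] {n g : ℕ}
    (b : OrthonormalBasis (Fin n) ℂ V) (U : Matrix (Fin n) (Fin g) ℂ) : Fin g → V :=
  fun i => ∑ s, U s i • b s

/-- The summand `L^{g-ℓ} H^{ℓ,ℓ}_prim(E_M, ℚ) ⊗ Λ^{g-ℓ} F_{n,ℓ}^prim`, as a space of functions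
`U ↦ ∑ P(U) W`. -/
def lefSummand {V : Type*} [NormedAddCommGroup V] [InnerProductSpace ℂ V] [FiniteDimensional ℂ V]
    (M : Submodule ℤ V) (q : ℝ) {n : ℕ} (b : OrthonormalBasis (Fin n) ℂ V) (g ℓ : ℕ) :
    Submodule ℂ (Matrix (Fin n) (Fin g) ℂ → harmonicForms M g) :=
  Submodule.span ℂ {G | ∃ P ∈ primPoly n ℓ, ∃ W ∈ primHodge M q b ℓ,
    G = fun U => (raiseTot^[g - ℓ] P) g U • ((lefTot M q b)^[g - ℓ] W) g}

end HermitianCycles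

attribute [local instance] LieRing.ofAssociativeRing

/-! Everything reduces to the linear algebra of alternating forms. A function P in F_{n,g}
polarises: since a polynomial identity in z and z̄ persists when z̄ is replaced by an independent
variable, P(U) = Q(U, Ū) with Q alternating in the columns of each argument (`exists_biAlt`, with
converse `BiAlt.diag_mem`). In terms of Q, Δ is contraction with ∑ e_s ⊗ e_s, Λ is exterior
multiplication by the dot product, and H is the scalar 2g - n. The relation ΛΔ - ΔΛ = H then amounts
to counting pairings of columns (`BiAlt.lower_lift_apply`).

On the torus all operators act pointwise on the coefficients of forms, hence on the Fock space of
alternating forms, with the creation operators dz_s, dz̄_s and the contractions dual to them. The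
anticommutation relations give δL - Lδ = n - degree (`adjOp_mul_lefOp`) and, by a Wick expansion,
the value of δ on a product of forms f(l_i, l'_i) (`adjointForm_prodBi`), which is (2). Such a
product is alternating in the coordinates of the l_i and in the conjugate coordinates of the l'_i,
so u(α) lies in F_{n,g}. The expansion of δ is that of Λ, and ∑ f(b_s) = D corresponds to Δ, so u is
equivariant.

In (3) the sum is direct because Lδ is a scalar on each summand, with different scalars for
different ℓ ≤ n/2, while the summands with ℓ > n/2 vanish. For membership, let W be the span of M
over the image K of k in ℂ. Constant forms with rational values on W are stable under L and δ, since
D and its dual bivector can be written with an orthogonal basis taken from W, and their complex span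
contains every Z(λ). A formal sl₂ argument using rational scalars only (`LefschetzData.mem_closure`)
decomposes rational classes into raised primitive rational ones, and primitive classes meet the
image of L only in 0 (`LefschetzData.prim_raise_eq_zero`). So there are primitive rational w_{ℓ,i},
and functionals φ_{ℓ,i} dual to them and zero on the image of L, with Z(λ) = ∑ c_ℓ φ_{ℓ,i}(δ^{g-ℓ}
Z(λ)) L^{g-ℓ} w_{ℓ,i}. By equivariance φ_{ℓ,i}(δ^{g-ℓ} Z) = Λ^{g-ℓ} u(φ_{ℓ,i}), and Δ u(φ_{ℓ,i}) =
u(φ_{ℓ,i} ∘ L) = 0. -/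

namespace HermitianCycles

/-! ### Polarisation: F_{n,g} as the space of bi-alternating forms. -/

section polarization

/-- A polynomial in `z` and `w` that vanishes for `w = z̄` is zero. -/
theorem eval_eq_zero_of_eval_conj {σ : Type*} [Finite σ] {p : MvPolynomial (σ ⊕ σ) ℂ}
    (h : ∀ z : σ → ℂ, MvPolynomial.eval (Sum.elim z fun i => conj (z i)) p = 0) (z w : σ → ℂ) :
    MvPolynomial.eval (Sum.elim z w) p = 0 := by
  classical
  -- The substitution z = x + iy, w = x - iy turns the hypothesis into vanishing at all real x, y,
  -- hence identically. It is invertible over ℂ, so every pair (z, w) is reached by complex x, y.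
  set s : σ ⊕ σ → MvPolynomial (σ ⊕ σ) ℂ := Sum.elim
    (fun i => MvPolynomial.X (Sum.inl i) + MvPolynomial.C Complex.I * MvPolynomial.X (Sum.inr i))
    (fun i => MvPolynomial.X (Sum.inl i) - MvPolynomial.C Complex.I * MvPolynomial.X (Sum.inr i))
    with hs
  have key : ∀ x : σ ⊕ σ → ℂ, MvPolynomial.eval x (MvPolynomial.bind₁ s p) =
      MvPolynomial.eval (Sum.elim (fun i => x (Sum.inl i) + Complex.I * x (Sum.inr i))
        (fun i => x (Sum.inl i) - Complex.I * x (Sum.inr i))) p := by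
    intro x
    rw [← MvPolynomial.coe_aeval_eq_eval, RingHom.coe_coe, MvPolynomial.aeval_bind₁,
      ← MvPolynomial.coe_aeval_eq_eval, RingHom.coe_coe]
    congr 2
    funext i
    rcases i with i | i <;> simp [hs]
  have hzero : MvPolynomial.bind₁ s p = 0 := by
    refine MvPolynomial.funext_set (fun _ => Set.range ((↑) : ℝ → ℂ))
      (fun _ => Set.infinite_range_of_injective Complex.ofReal_injective) fun x hx => ?_
    rw [key, map_zero]
    rw [← h fun i => x (Sum.inl i) + Complex.I * x (Sum.inr i)]
    congr 2
    funext i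
    rcases i with i | i
    · rfl
    · obtain ⟨a, ha⟩ := hx (Sum.inl i) trivial
      obtain ⟨c, hc⟩ := hx (Sum.inr i) trivial
      simp [← ha, ← hc, sub_eq_add_neg]
  have := key (Sum.elim (fun i => (z i + w i) / 2) fun i => (z i - w i) / (2 * Complex.I))
  rw [hzero, map_zero] at this
  rw [this]
  congr 2
  funext i
  rcases i with i | i <;> simp <;> field_simp <;> ring

theorem differentiable_eval {E σ : Type*} [NormedAddCommGroup E] [NormedSpace ℂ E]
    (p : MvPolynomial σ ℂ) {v : E → σ → ℂ} (hv : ∀ i, Differentiable ℂ fun x => v x i) :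
    Differentiable ℂ fun x => MvPolynomial.eval (v x) p := by
  induction p using MvPolynomial.induction_on with
  | C a => simp
  | add p q hp hq => simp only [map_add]; exact hp.add hq
  | mul_X p i hp => simp only [map_mul, MvPolynomial.eval_X]; exact hp.mul (hv i)

/-- Differentiate f(tx) = t f(x) at t = 0. Linearity in a column is thereby deduced from scaling
behaviour alone. -/
theorem eq_fderiv_of_homogeneous {E : Type*} [NormedAddCommGroup E] [NormedSpace ℂ E] {f : E → ℂ}
    (hf : Differentiable ℂ f) (h : ∀ (t : ℂ) x, f (t • x) = t * f x) (x : E) :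
    f x = fderiv ℂ f 0 x := by
  have h1 : HasDerivAt (fun t : ℂ => f (t • x)) (fderiv ℂ f 0 x) 0 := by
    have hl : HasDerivAt (fun t : ℂ => t • x) x 0 := by
      simpa using (hasDerivAt_id (0 : ℂ)).smul_const x
    have hf0 : HasFDerivAt f (fderiv ℂ f 0) ((0 : ℂ) • x) := by
      rw [zero_smul]; exact (hf 0).hasFDerivAt
    exact hf0.comp_hasDerivAt 0 hl
  have h2 : HasDerivAt (fun t : ℂ => f (t • x)) (f x) 0 := by
    simp_rw [h]
    simpa using (hasDerivAt_id (0 : ℂ)).mul_const (f x)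
  exact h2.unique h1

variable {n g : ℕ}

/-- A differentiable function `f` of the columns with `f (X A) = det A * f X` is an alternating
multilinear map. -/
def alternatingOfDet (f : (Fin g → Fin n → ℂ) → ℂ) (hf : Differentiable ℂ f)
    (h : ∀ (X : Fin g → Fin n → ℂ) (A : Matrix (Fin g) (Fin g) ℂ),
      f (fun j => ∑ i, A i j • X i) = A.det * f X) : (Fin n → ℂ) [⋀^Fin g]→ₗ[ℂ] ℂ :=
  -- Scaling column j by t is right multiplication by a diagonal matrix of determinant t, so f is
  -- homogeneous of degree one in that column and hence linear in it.
  have key : ∀ (X : Fin g → Fin n → ℂ) (j : Fin g), ∃ T : (Fin n → ℂ) →L[ℂ] ℂ,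
      ∀ u, f (Function.update X j u) = T u := by
    intro X j
    refine ⟨fderiv ℂ (fun u => f (Function.update X j u)) 0, fun u =>
      eq_fderiv_of_homogeneous (f := fun u => f (Function.update X j u)) (hf.comp ?_) ?_ u⟩
    · rw [differentiable_pi]
      intro i
      by_cases hij : i = j
      · subst hij; simp
      · simp [hij]
    · intro t u
      have := h (Function.update X j u) (Matrix.diagonal (Function.update 1 j t))
      rw [Matrix.det_diagonal, Finset.prod_update_of_mem (Finset.mem_univ j)] at this
      simp only [Pi.one_apply, Finset.prod_const_one, mul_one] at this
      rw [← this]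
      congr 1
      funext i
      rw [Finset.sum_eq_single i]
      · by_cases hij : i = j
        · subst hij; simp
        · simp [hij]
      · intro k _ hk
        simp [Matrix.diagonal_apply_ne _ hk]
      · simp
  { toFun := f
    map_update_add' := by
      intro hd X j u v
      obtain rfl : hd = instDecidableEqFin g := Subsingleton.elim _ _
      obtain ⟨T, hT⟩ := key X j
      simp [hT]
    map_update_smul' := by
      intro hd X j c u
      obtain rfl : hd = instDecidableEqFin g := Subsingleton.elim _ _
      obtain ⟨T, hT⟩ := key X j
      simp [hT]
    map_eq_zero_of_eq' := by
      intro X i j hX hij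
      -- The permutation matrix of the transposition has determinant -1 and fixes X, because the
      -- columns i and j agree. Hence f X = -f X.
      have := h X ((Equiv.swap i j).toPEquiv.toMatrix)
      rw [Matrix.det_permutation, Equiv.Perm.sign_swap hij] at this
      have hX' : (fun k => ∑ l, ((Equiv.swap i j).toPEquiv.toMatrix : Matrix _ _ ℂ) l k • X l) = X := by
        funext k
        rw [Finset.sum_eq_single (Equiv.swap i j k)]
        · simp only [PEquiv.toMatrix_apply, Equiv.toPEquiv_apply, Equiv.swap_apply_self,
            Option.mem_def, if_true, one_smul]
          by_cases hi : k = i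
          · subst hi; simp [hX]
          · by_cases hj : k = j
            · subst hj; simp [hX]
            · rw [Equiv.swap_apply_of_ne_of_ne hi hj]
        · intro l _ hl
          have : Equiv.swap i j l ≠ k := fun h' => hl (by rw [← h', Equiv.swap_apply_self])
          simp [PEquiv.toMatrix_apply, this]
        · simp
      rw [hX'] at this
      simp only [Units.val_neg, Units.val_one, Int.cast_neg, Int.cast_one] at this
      linear_combination (1 / 2) * this }

/-- Bilinear maps, alternating in the columns of each of two matrices. -/
abbrev BiAlt (n g : ℕ) : Type :=
  (Fin n → ℂ) [⋀^Fin g]→ₗ[ℂ] ((Fin n → ℂ) [⋀^Fin g]→ₗ[ℂ] ℂ)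

/-- The function `U ↦ Q (U, Ū)`. -/
def BiAlt.diag (Q : BiAlt n g) (U : Matrix (Fin n) (Fin g) ℂ) : ℂ :=
  Q (fun i s => U s i) (fun i s => conj (U s i))

/-- The hypothesis is a polynomial identity in the entries of U, A and their conjugates. By
`eval_eq_zero_of_eval_conj`, applied to the difference `R` of both sides, the conjugate variables
may be replaced by an independent pair Y, B. -/
theorem eval_mul_eq_det_mul {p : MvPolynomial ((Fin n × Fin g) ⊕ (Fin n × Fin g)) ℂ}
    (h : ∀ (U : Matrix (Fin n) (Fin g) ℂ) (A : Matrix (Fin g) (Fin g) ℂ),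
      MvPolynomial.eval (Sum.elim (fun a => (U * A) a.1 a.2) fun a => conj ((U * A) a.1 a.2)) p =
        ((‖A.det‖ ^ 2 : ℝ) : ℂ) *
          MvPolynomial.eval (Sum.elim (fun a => U a.1 a.2) fun a => conj (U a.1 a.2)) p)
    (X Y : Matrix (Fin n) (Fin g) ℂ) (A B : Matrix (Fin g) (Fin g) ℂ) :
    MvPolynomial.eval (Sum.elim (fun a => (X * A) a.1 a.2) fun a => (Y * B) a.1 a.2) p =
      A.det * B.det * MvPolynomial.eval (Sum.elim (fun a => X a.1 a.2) fun a => Y a.1 a.2) p := by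
  let τ := (Fin n × Fin g) ⊕ (Fin g × Fin g)
  let sub : (τ → τ ⊕ τ) → (Fin n × Fin g) → MvPolynomial (τ ⊕ τ) ℂ := fun ι a =>
    ∑ i, MvPolynomial.X (ι (Sum.inl (a.1, i))) * MvPolynomial.X (ι (Sum.inr (i, a.2)))
  let R : MvPolynomial (τ ⊕ τ) ℂ := MvPolynomial.bind₁ (Sum.elim (sub Sum.inl) (sub Sum.inr)) p -
    (Matrix.of fun i j => MvPolynomial.X (Sum.inl (Sum.inr (i, j)))).det *
      (Matrix.of fun i j => MvPolynomial.X (Sum.inr (Sum.inr (i, j)))).det *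
        MvPolynomial.rename (Sum.map Sum.inl Sum.inl) p
  have key : ∀ z w : τ → ℂ, MvPolynomial.eval (Sum.elim z w) R =
      MvPolynomial.eval (Sum.elim
        (fun a => ((Matrix.of fun s i => z (Sum.inl (s, i))) *
          (Matrix.of fun i j => z (Sum.inr (i, j)))) a.1 a.2)
        fun a => ((Matrix.of fun s i => w (Sum.inl (s, i))) *
          (Matrix.of fun i j => w (Sum.inr (i, j)))) a.1 a.2) p -
      (Matrix.of fun i j => z (Sum.inr (i, j))).det * (Matrix.of fun i j => w (Sum.inr (i, j))).det *
        MvPolynomial.eval (Sum.elim (fun a => z (Sum.inl a)) fun a => w (Sum.inl a)) p := by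
    intro z w
    simp only [R, map_sub, map_mul, RingHom.map_det, MvPolynomial.eval_rename]
    congr 1
    · rw [← MvPolynomial.coe_aeval_eq_eval, RingHom.coe_coe, MvPolynomial.aeval_bind₁,
        ← MvPolynomial.coe_aeval_eq_eval, RingHom.coe_coe]
      congr 2
      funext i
      rcases i with i | i <;> simp [sub, Matrix.mul_apply]
    · congr 1
      · congr 2 <;> (ext i j; simp)
      · congr 2
        funext i
        rcases i with i | i <;> simp
  have hR := eval_eq_zero_of_eval_conj (p := R) (fun z => by
    rw [key, sub_eq_zero]
    have := h (Matrix.of fun s i => z (Sum.inl (s, i))) (Matrix.of fun i j => z (Sum.inr (i, j)))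
    convert this using 3
    · congr 2
      funext a
      simp [Matrix.mul_apply]
    · rw [← Complex.normSq_eq_norm_sq, ← Complex.mul_conj, RingHom.map_det]
      congr 2
    · rfl)
    (Sum.elim (fun a => X a.1 a.2) fun a => A a.1 a.2)
    (Sum.elim (fun a => Y a.1 a.2) fun a => B a.1 a.2)
  rw [key, sub_eq_zero] at hR
  exact hR

/-- After U and Ū are decoupled, taking one of the two matrices A, B to be the identity leaves a
transformation law by det in each argument separately, and such a function is alternating
multilinear by `alternatingOfDet`. -/
theorem exists_biAlt {P : Matrix (Fin n) (Fin g) ℂ → ℂ} (hP : P ∈ polySpace n g) :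
    ∃ Q : BiAlt n g, P = Q.diag := by
  obtain ⟨⟨p, hp⟩, hP⟩ := hP
  have hdet := eval_mul_eq_det_mul (p := p) fun U A => by rw [← hp, ← hp, hP]
  set q : (Fin g → Fin n → ℂ) → (Fin g → Fin n → ℂ) → ℂ := fun X Y =>
    MvPolynomial.eval (Sum.elim (fun a => X a.2 a.1) fun a => Y a.2 a.1) p with hq
  have h1 : ∀ (X Y : Fin g → Fin n → ℂ) (A : Matrix (Fin g) (Fin g) ℂ),
      q (fun j => ∑ i, A i j • X i) Y = A.det * q X Y := by
    intro X Y A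
    have := hdet (Matrix.of fun s i => X i s) (Matrix.of fun s i => Y i s) A 1
    rw [Matrix.mul_one, Matrix.det_one, mul_one] at this
    refine (congrArg (fun v => MvPolynomial.eval v p) ?_).trans this
    funext a
    rcases a with a | a <;> simp [Matrix.mul_apply, mul_comm]
  have h2 : ∀ (X Y : Fin g → Fin n → ℂ) (A : Matrix (Fin g) (Fin g) ℂ),
      q X (fun j => ∑ i, A i j • Y i) = A.det * q X Y := by
    intro X Y A
    have := hdet (Matrix.of fun s i => X i s) (Matrix.of fun s i => Y i s) 1 A
    rw [Matrix.mul_one, Matrix.det_one, one_mul] at this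
    refine (congrArg (fun v => MvPolynomial.eval v p) ?_).trans this
    funext a
    rcases a with a | a <;> simp [Matrix.mul_apply, mul_comm]
  have d1 : ∀ Y, Differentiable ℂ fun X => q X Y := fun Y =>
    differentiable_eval p fun i => by rcases i with i | i <;> simp <;> fun_prop
  have d2 : ∀ X, Differentiable ℂ fun Y => q X Y := fun X =>
    differentiable_eval p fun i => by rcases i with i | i <;> simp <;> fun_prop
  let T : (Fin g → Fin n → ℂ) → (Fin n → ℂ) [⋀^Fin g]→ₗ[ℂ] ℂ := fun Y =>
    alternatingOfDet (fun X => q X Y) (d1 Y) fun X A => h1 X Y A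
  refine ⟨{ toFun := fun X => alternatingOfDet (q X) (d2 X) (h2 X)
            map_update_add' := ?_
            map_update_smul' := ?_
            map_eq_zero_of_eq' := ?_ }, ?_⟩
  · intro hd X j u v
    obtain rfl : hd = instDecidableEqFin g := Subsingleton.elim _ _
    ext Y
    exact (T Y).map_update_add X j u v
  · intro hd X j c u
    obtain rfl : hd = instDecidableEqFin g := Subsingleton.elim _ _
    ext Y
    exact (T Y).map_update_smul X j c u
  · intro X i j hX hij
    ext Y
    exact (T Y).map_eq_zero_of_eq X hX hij
  · funext U
    rw [hp]
    rfl

/-- Pulling f back along e_i ↦ X_i gives an alternating form of top degree on ℂ^g, which is a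
multiple of the determinant. -/
theorem alternating_sum_smul {N : Type*} [AddCommGroup N] [Module ℂ N]
    (f : (Fin n → ℂ) [⋀^Fin g]→ₗ[ℂ] N) (X : Fin g → Fin n → ℂ) (A : Matrix (Fin g) (Fin g) ℂ) :
    f (fun j => ∑ i, A i j • X i) = A.det • f X := by
  have key : f.compLinearMap (Fintype.linearCombination ℂ X) =
      (LinearMap.toSpanSingleton ℂ N (f X)).compAlternatingMap (Matrix.detRowAlternating (n := Fin g) (R := ℂ)) := by
    refine Module.Basis.ext_alternating (Pi.basisFun ℂ (Fin g)) fun v hv => ?_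
    let σ : Equiv.Perm (Fin g) := Equiv.ofBijective v (Finite.injective_iff_bijective.1 hv)
    change (f.compLinearMap (Fintype.linearCombination ℂ X)) (Pi.basisFun ℂ (Fin g) ∘ σ) =
      ((LinearMap.toSpanSingleton ℂ N (f X)).compAlternatingMap Matrix.detRowAlternating)
        (Pi.basisFun ℂ (Fin g) ∘ σ)
    rw [AlternatingMap.map_perm, AlternatingMap.map_perm]
    congr 1
    have h1 : Matrix.detRowAlternating (Pi.basisFun ℂ (Fin g)) = (1 : ℂ) := by
      have : (fun i => Pi.basisFun ℂ (Fin g) i) = (1 : Matrix (Fin g) (Fin g) ℂ) := by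
        ext i j; simp [Matrix.one_apply, Pi.single_apply, eq_comm]
      exact (congrArg Matrix.det this).trans Matrix.det_one
    rw [LinearMap.compAlternatingMap_apply, h1, AlternatingMap.compLinearMap_apply]
    simp
  have := DFunLike.congr_fun key (fun j i => A i j)
  rw [AlternatingMap.compLinearMap_apply, LinearMap.compAlternatingMap_apply, show Matrix.detRowAlternating (fun j i => A i j) = A.det from Matrix.det_transpose A] at this
  simpa [Fintype.linearCombination_apply] using this

theorem alternating_eq_sum {N : Type*} [AddCommGroup N] [Module ℂ N]
    (f : (Fin n → ℂ) [⋀^Fin g]→ₗ[ℂ] N) (X : Fin g → Fin n → ℂ) :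
    f X = ∑ r : Fin g → Fin n, (∏ i, X i (r i)) • f (fun i => Pi.single (r i) 1) := by
  conv_lhs => rw [show X = fun i => ∑ s, X i s • (Pi.single s 1 : Fin n → ℂ) from by
    funext i; exact pi_eq_sum_univ' _]
  exact (f.toMultilinearMap.map_sum (fun i s => X i s • (Pi.single s 1 : Fin n → ℂ))).trans
    (Finset.sum_congr rfl fun r _ => f.toMultilinearMap.map_smul_univ _ _)

theorem alternating_sum_apply {M N ι κ : Type*} [AddCommGroup M] [Module ℂ M] [AddCommGroup N]
    [Module ℂ N] (S : Finset κ) (f : κ → M [⋀^ι]→ₗ[ℂ] N) (v : ι → M) :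
    (∑ k ∈ S, f k) v = ∑ k ∈ S, f k v :=
  map_sum (⟨⟨fun f => f v, rfl⟩, fun _ _ => rfl⟩ : (M [⋀^ι]→ₗ[ℂ] N) →+ N) f S

theorem BiAlt.diag_mem (Q : BiAlt n g) : Q.diag ∈ polySpace n g := by
  constructor
  · refine ⟨∑ r : Fin g → Fin n, (∏ i, MvPolynomial.X (Sum.inl (r i, i))) *
      ∑ t : Fin g → Fin n, (∏ i, MvPolynomial.X (Sum.inr (t i, i))) *
        MvPolynomial.C (Q (fun i => Pi.single (r i) 1) fun i => Pi.single (t i) 1), fun U => ?_⟩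
    rw [BiAlt.diag, alternating_eq_sum Q, alternating_sum_apply]
    simp only [map_sum, map_mul, map_prod, MvPolynomial.eval_X, MvPolynomial.eval_C, Sum.elim_inl,
      Sum.elim_inr, AlternatingMap.smul_apply, smul_eq_mul]
    refine Finset.sum_congr rfl fun r _ => ?_
    rw [alternating_eq_sum (Q _)]
    simp
  · intro U A
    have h1 : (fun (i : Fin g) (s : Fin n) => (U * A) s i) = fun j => ∑ i, A i j • fun s => U s i := by
      funext j s; simp [Matrix.mul_apply, mul_comm]
    have h2 : (fun (i : Fin g) (s : Fin n) => conj ((U * A) s i)) =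
        fun j => ∑ i, (A.map conj) i j • fun s => conj (U s i) := by
      funext j s; simp [Matrix.mul_apply, mul_comm]
    rw [BiAlt.diag, h1, h2, alternating_sum_smul Q, AlternatingMap.smul_apply, alternating_sum_smul (Q _),
      BiAlt.diag, smul_eq_mul, smul_eq_mul, ← mul_assoc, ← Complex.normSq_eq_norm_sq,
      ← Complex.mul_conj, RingHom.map_det]
    rfl

end polarization

/-! ### The operators Δ, Λ, H on bi-alternating forms and their sl₂ relations. -/

section sl2polynomials

variable {n g : ℕ}

theorem matrix_add_smul_column (U : Matrix (Fin n) (Fin g) ℂ) (j : Fin g) (v : Fin n → ℂ) (t : ℝ) :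
    (fun i s => (U + t • column j v) s i) =
      Function.update (fun i s => U s i) j ((fun s => U s j) + (t : ℂ) • v) := by
  funext i s
  by_cases h : i = j
  · subst h; simp [column]
  · simp [column, h]

theorem conj_matrix_add_smul_column (U : Matrix (Fin n) (Fin g) ℂ) (j : Fin g) (v : Fin n → ℂ)
    (t : ℝ) : (fun i s => conj ((U + t • column j v) s i)) =
      Function.update (fun i s => conj (U s i)) j
        ((fun s => conj (U s j)) + (t : ℂ) • fun s => conj (v s)) := by
  funext i s
  by_cases h : i = j
  · subst h; simp [column]
  · simp [column, h]

theorem I_smul_column (j : Fin g) (v : Fin n → ℂ) :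
    Complex.I • column j v = column j (Complex.I • v) := by
  ext s i
  simp [column]

/-- Moving one column along a real line changes Q(U, Ū) by a quadratic polynomial in the parameter,
as each argument contributes an affine factor. Only the linear coefficient matters at 0. -/
theorem hasDerivAt_quadratic (a b c : ℂ) :
    HasDerivAt (fun t : ℝ => a + (t : ℂ) * b + (t : ℂ) ^ 2 * c) b 0 := by
  have h := (((hasDerivAt_id (0 : ℂ)).mul_const b).const_add a).add
    ((((hasDerivAt_id (0 : ℂ)).pow 2)).mul_const c)
  have h2 := h.comp_ofReal (z := 0)
  simpa using h2

namespace BiAlt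

variable (Q : BiAlt n g)

theorem lineDeriv_diag (U : Matrix (Fin n) (Fin g) ℂ) (j : Fin g) (v : Fin n → ℂ) :
    lineDeriv ℝ Q.diag U (column j v) =
      Q (Function.update (fun i s => U s i) j v) (fun i s => conj (U s i)) +
      Q (fun i s => U s i) (Function.update (fun i s => conj (U s i)) j fun s => conj (v s)) := by
  refine HasDerivAt.deriv ?_
  refine (hasDerivAt_quadratic (Q.diag U) _ (Q (Function.update (fun i s => U s i) j v)
    (Function.update (fun i s => conj (U s i)) j fun s => conj (v s)))).congr_of_eventuallyEq ?_
  refine Filter.Eventually.of_forall fun t => ?_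
  change Q.diag _ = _
  rw [diag, matrix_add_smul_column, conj_matrix_add_smul_column]
  simp only [AlternatingMap.map_update_add, AlternatingMap.map_update_smul, AlternatingMap.add_apply,
    AlternatingMap.smul_apply, smul_eq_mul]
  rw [Function.update_eq_self_iff.mpr (rfl : (fun s => U s j) = (fun i s => U s i) j),
    Function.update_eq_self_iff.mpr (rfl : (fun s => conj (U s j)) = (fun i s => conj (U s i)) j), diag]
  ring

/-- The real derivative in direction v is a ℂ-linear term in v, from the first argument, plus a
conjugate-linear one from the second. The Wirtinger combination keeps the former. -/
theorem holDeriv_diag (U : Matrix (Fin n) (Fin g) ℂ) (j : Fin g) (v : Fin n → ℂ) :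
    holDeriv Q.diag (column j v) U =
      Q (Function.update (fun i s => U s i) j v) (fun i s => conj (U s i)) := by
  have h : (fun s => conj ((Complex.I • v) s)) = (-Complex.I) • fun s => conj (v s) := by
    funext s; simp
  rw [holDeriv, I_smul_column, lineDeriv_diag, lineDeriv_diag, h, AlternatingMap.map_update_smul,
    AlternatingMap.map_update_smul, AlternatingMap.smul_apply, smul_eq_mul, smul_eq_mul]
  linear_combination (-(1 / 2) * Q (Function.update (fun i s => U s i) j v) (fun i s => conj (U s i)) +
    1 / 2 * Q (fun i s => U s i)
      (Function.update (fun i s => conj (U s i)) j fun s => conj (v s))) * Complex.I_mul_I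

theorem antiDeriv_diag (U : Matrix (Fin n) (Fin g) ℂ) (j : Fin g) (v : Fin n → ℂ) :
    antiDeriv Q.diag (column j v) U =
      Q (fun i s => U s i) (Function.update (fun i s => conj (U s i)) j fun s => conj (v s)) := by
  have h : (fun s => conj ((Complex.I • v) s)) = (-Complex.I) • fun s => conj (v s) := by
    funext s; simp
  rw [antiDeriv, I_smul_column, lineDeriv_diag, lineDeriv_diag, h, AlternatingMap.map_update_smul,
    AlternatingMap.map_update_smul, AlternatingMap.smul_apply, smul_eq_mul, smul_eq_mul]
  linear_combination ((1 / 2) * Q (Function.update (fun i s => U s i) j v) (fun i s => conj (U s i)) -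
    1 / 2 * Q (fun i s => U s i)
      (Function.update (fun i s => conj (U s i)) j fun s => conj (v s))) * Complex.I_mul_I

theorem degree_diag : degree Q.diag = (2 * (g : ℂ) - n) • Q.diag := by
  funext U
  have h1 : ∀ i, holDeriv Q.diag (column i fun s => U s i) U = Q.diag U := fun i => by
    rw [holDeriv_diag, Function.update_eq_self_iff.mpr rfl, diag]
  have h2 : ∀ i, antiDeriv Q.diag (column i fun s => U s i) U = Q.diag U := fun i => by
    rw [antiDeriv_diag, Function.update_eq_self_iff.mpr rfl, diag]
  simp [degree, h1, h2]
  ring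

theorem lineDeriv_diag_update (U : Matrix (Fin n) (Fin g) ℂ) (j : Fin g) (v w : Fin n → ℂ) :
    lineDeriv ℝ (fun U : Matrix (Fin n) (Fin g) ℂ =>
        Q (fun i s => U s i) (Function.update (fun i s => conj (U s i)) j w)) U (column j v) =
      Q (Function.update (fun i s => U s i) j v) (Function.update (fun i s => conj (U s i)) j w) := by
  refine HasDerivAt.deriv ?_
  refine (hasDerivAt_quadratic
    (Q (fun i s => U s i) (Function.update (fun i s => conj (U s i)) j w)) _ 0).congr_of_eventuallyEq ?_
  refine Filter.Eventually.of_forall fun t => ?_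
  change Q _ _ = _
  rw [matrix_add_smul_column, conj_matrix_add_smul_column, Function.update_idem]
  simp only [AlternatingMap.map_update_add, AlternatingMap.map_update_smul, AlternatingMap.add_apply,
    AlternatingMap.smul_apply, smul_eq_mul]
  rw [Function.update_eq_self_iff.mpr (rfl : (fun s => U s j) = (fun i s => U s i) j)]
  ring

theorem holDeriv_antiDeriv_diag (U : Matrix (Fin n) (Fin g) ℂ) (j : Fin g) (v w : Fin n → ℂ) :
    holDeriv (antiDeriv Q.diag (column j w)) (column j v) U =
      Q (Function.update (fun i s => U s i) j v)
        (Function.update (fun i s => conj (U s i)) j fun s => conj (w s)) := by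
  have h : antiDeriv Q.diag (column j w) = fun U : Matrix (Fin n) (Fin g) ℂ =>
      Q (fun i s => U s i) (Function.update (fun i s => conj (U s i)) j fun s => conj (w s)) := by
    funext U
    rw [antiDeriv_diag]
  rw [h, holDeriv, I_smul_column, lineDeriv_diag_update, lineDeriv_diag_update,
    AlternatingMap.map_update_smul, AlternatingMap.smul_apply, smul_eq_mul]
  linear_combination (-(1 / 2) * Q (Function.update (fun i s => U s i) j v)
    (Function.update (fun i s => conj (U s i)) j fun s => conj (w s))) * Complex.I_mul_I

/-- Contraction of the first arguments. -/
def lower (Q : BiAlt n (g + 1)) : BiAlt n g :=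
  ∑ s : Fin n, (AlternatingMap.curryLeftLinearMap.flip (Pi.single s 1)).compAlternatingMap
    (Q.curryLeft (Pi.single s 1))

theorem lower_apply (Q : BiAlt n (g + 1)) (X Y : Fin g → Fin n → ℂ) :
    lower Q X Y = ∑ s, Q (Matrix.vecCons (Pi.single s 1) X) (Matrix.vecCons (Pi.single s 1) Y) := by
  rw [lower, alternating_sum_apply, alternating_sum_apply]
  rfl

/-- Moving the last column to the front costs the same sign in both arguments, so the signs cancel.
This reconciles Δ, which differentiates in the last column, with contraction in the first. -/
theorem map_snoc_snoc (Q : BiAlt n (g + 1)) (X Y : Fin g → Fin n → ℂ) (x y : Fin n → ℂ) :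
    Q (Fin.snoc X x) (Fin.snoc Y y) = Q (Matrix.vecCons x X) (Matrix.vecCons y Y) := by
  rw [← Fin.insertNth_last', ← Fin.insertNth_last', AlternatingMap.map_insertNth,
    AlternatingMap.map_insertNth, AlternatingMap.smul_apply, smul_smul, ← pow_add,
    Even.neg_one_pow ⟨_, rfl⟩, one_smul]

theorem laplace_diag (Q : BiAlt n (g + 1)) : laplace Q.diag = (lower Q).diag := by
  funext U
  rw [laplace, diag, lower_apply]
  refine Finset.sum_congr rfl fun s _ => ?_
  -- Both last columns get replaced by the basis vector e_s, so the value 0 chosen there in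
  -- `laplace` plays no role.
  rw [holDeriv_antiDeriv_diag, ← map_snoc_snoc]
  congr 1
  · congr 1
    funext i
    refine Fin.lastCases ?_ (fun i => ?_) i
    · simp
    · funext r; simp [(Fin.castSucc_lt_last i).ne]
  · funext i
    refine Fin.lastCases ?_ (fun i => ?_) i
    · funext r; simp [Pi.single_apply, apply_ite]
    · funext r; simp [(Fin.castSucc_lt_last i).ne]

/-- The exterior product of a linear form with an alternating map. -/
def wedge : ((Fin n → ℂ) →ₗ[ℂ] ℂ) →ₗ[ℂ] ((Fin n → ℂ) [⋀^Fin g]→ₗ[ℂ] ℂ) →ₗ[ℂ]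
    ((Fin n → ℂ) [⋀^Fin (g + 1)]→ₗ[ℂ] ℂ) :=
  LinearMap.mk₂ ℂ (fun θ ψ => AlternatingMap.alternatizeUncurryFin (θ.smulRight ψ))
    (fun θ θ' ψ => by
      ext v
      simp [AlternatingMap.alternatizeUncurryFin_apply, Finset.sum_add_distrib, add_mul])
    (fun c θ ψ => by
      ext v
      simp [AlternatingMap.alternatizeUncurryFin_apply, Finset.mul_sum]
      exact Finset.sum_congr rfl fun _ _ => by ring)
    (fun θ ψ ψ' => by
      ext v
      simp [AlternatingMap.alternatizeUncurryFin_apply, Finset.sum_add_distrib])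
    (fun c θ ψ => by
      ext v
      simp [AlternatingMap.alternatizeUncurryFin_apply, Finset.mul_sum]
      exact Finset.sum_congr rfl fun _ _ => by ring)

theorem wedge_apply (θ : (Fin n → ℂ) →ₗ[ℂ] ℂ) (ψ : (Fin n → ℂ) [⋀^Fin g]→ₗ[ℂ] ℂ)
    (v : Fin (g + 1) → Fin n → ℂ) :
    wedge θ ψ v = ∑ i : Fin (g + 1), (-1) ^ (i : ℕ) * (θ (v i) * ψ (i.removeNth v)) := by
  simp [wedge, AlternatingMap.alternatizeUncurryFin_apply]

/-- Exterior multiplication by the bilinear form `∑ s, x_s y_s`. -/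
def lift (Q : BiAlt n g) : BiAlt n (g + 1) :=
  AlternatingMap.alternatizeUncurryFin
    { toFun := fun x => (wedge (dotProductBilin ℂ ℂ x)).compAlternatingMap Q
      map_add' := fun x y => by ext; simp
      map_smul' := fun c x => by ext; simp }

theorem lift_apply (X Y : Fin (g + 1) → Fin n → ℂ) :
    lift Q X Y = ∑ i : Fin (g + 1), ∑ j : Fin (g + 1),
      (-1) ^ (i + j : ℕ) * (X i ⬝ᵥ Y j * Q (i.removeNth X) (j.removeNth Y)) := by
  rw [lift, AlternatingMap.alternatizeUncurryFin_apply, alternating_sum_apply]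
  refine Finset.sum_congr rfl fun i _ => ?_
  simp [wedge_apply, Finset.mul_sum, pow_add, mul_assoc]

theorem sum_dotProduct_mul_map_vecCons (f : (Fin n → ℂ) [⋀^Fin (g + 1)]→ₗ[ℂ] ℂ) (y : Fin n → ℂ)
    (Y : Fin g → Fin n → ℂ) :
    ∑ s, (Pi.single s 1 ⬝ᵥ y) * f (Matrix.vecCons (Pi.single s 1) Y) = f (Matrix.vecCons y Y) := by
  have h : ∀ z, f (Matrix.vecCons z Y) = f.curryLeft z Y := fun _ => rfl
  conv_rhs => rw [h, pi_eq_sum_univ' y, map_sum, alternating_sum_apply]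
  refine Finset.sum_congr rfl fun s _ => ?_
  rw [map_smul, AlternatingMap.smul_apply, ← h]
  simp

theorem neg_one_pow_mul_map_vecCons_removeNth (f : (Fin n → ℂ) [⋀^Fin (g + 1)]→ₗ[ℂ] ℂ)
    (Y : Fin (g + 1) → Fin n → ℂ) (j : Fin (g + 1)) :
    (-1) ^ (j : ℕ) * f (Matrix.vecCons (Y j) (j.removeNth Y)) = f Y := by
  have := f.map_insertNth j (Y j) (j.removeNth Y)
  rw [Fin.insertNth_self_removeNth] at this
  rw [this, zsmul_eq_mul]
  push_cast
  rfl

theorem removeNth_succ_vecCons {α : Type*} (a : α) (Y : Fin (g + 1) → α) (j : Fin (g + 1)) :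
    j.succ.removeNth (Matrix.vecCons a Y : Fin (g + 2) → α) = Matrix.vecCons a (j.removeNth Y) := by
  funext i
  refine Fin.cases ?_ (fun i => ?_) i
  · simp [Fin.removeNth]
  · simp [Fin.removeNth]

theorem removeNth_zero_vecCons {α : Type*} (a : α) (Y : Fin g → α) :
    (0 : Fin (g + 1)).removeNth (Matrix.vecCons a Y : Fin (g + 1) → α) = Y := by
  funext i
  simp [Fin.removeNth]

/-- Summing over s replaces e_s in front by Y_j. Returning Y_j to its place costs (-1)^j against the
sign (-1)^{j+1}, so each of the g columns contributes -f(Y). -/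
theorem sum_map_removeNth_succ (f : (Fin n → ℂ) [⋀^Fin g]→ₗ[ℂ] ℂ) (Y : Fin g → Fin n → ℂ) :
    ∑ s : Fin n, ∑ j : Fin g, (-1) ^ ((j : ℕ) + 1) * ((Pi.single s 1 ⬝ᵥ Y j) *
      f (j.succ.removeNth (Matrix.vecCons (Pi.single s 1) Y : Fin (g + 1) → Fin n → ℂ))) =
      -(g : ℂ) * f Y := by
  rw [Finset.sum_comm]
  obtain _ | g := g
  · simp
  · simp_rw [removeNth_succ_vecCons, ← Finset.mul_sum, sum_dotProduct_mul_map_vecCons, pow_succ,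
      mul_neg_one, neg_mul, neg_one_pow_mul_map_vecCons_removeNth]
    simp

/-- Sort the terms by which columns of (e_s, X) and (e_s, Y) are paired by the dot product: both
front columns give n, exactly one front column gives -g in each of two ways, and the remaining terms
form the double sum, which for g > 0 is `lift (lower Q)`. -/
theorem lower_lift_apply (X Y : Fin g → Fin n → ℂ) :
    lower (lift Q) X Y = ((n : ℂ) - 2 * g) * Q X Y + ∑ s : Fin n, ∑ i : Fin g, ∑ j : Fin g,
      (-1) ^ (i + j : ℕ) * (X i ⬝ᵥ Y j *
        Q (i.succ.removeNth (Matrix.vecCons (Pi.single s 1) X : Fin (g + 1) → Fin n → ℂ))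
          (j.succ.removeNth (Matrix.vecCons (Pi.single s 1) Y : Fin (g + 1) → Fin n → ℂ))) := by
  -- Evaluation at Y makes Q a scalar-valued alternating map of its first argument, so the same
  -- count applies on that side.
  let ev : ((Fin n → ℂ) [⋀^Fin g]→ₗ[ℂ] ℂ) →ₗ[ℂ] ℂ := ⟨⟨fun f => f Y, fun _ _ => rfl⟩, fun _ _ => rfl⟩
  have h1 := sum_map_removeNth_succ (Q X) Y
  have h2 := sum_map_removeNth_succ (ev.compAlternatingMap Q) X
  have h3 : ∀ Z, ev.compAlternatingMap Q Z = Q Z Y := fun _ => rfl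
  simp only [h3] at h2
  have h4 : ∀ i : Fin g, ∀ s : Fin n, Pi.single s (1 : ℂ) ⬝ᵥ X i = X i ⬝ᵥ Pi.single s 1 :=
    fun i s => dotProduct_comm _ _
  simp only [h4] at h2
  rw [lower_apply]
  simp only [lift_apply, Fin.sum_univ_succ, Matrix.cons_val_zero, Matrix.cons_val_succ,
    removeNth_zero_vecCons, Finset.sum_add_distrib]
  simp only [Fin.val_zero, Fin.val_succ, add_zero, zero_add, pow_zero, one_mul] at *
  rw [h1, h2]
  have h5 : ∑ s : Fin n, (Pi.single s (1 : ℂ) ⬝ᵥ Pi.single s 1) * Q X Y = n * Q X Y := by simp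
  rw [h5, ← add_assoc]
  congr 1
  · ring
  · refine Finset.sum_congr rfl fun s _ => Finset.sum_congr rfl fun i _ =>
      Finset.sum_congr rfl fun j _ => ?_
    rw [show (i : ℕ) + 1 + (j + 1) = i + j + 2 by ring, pow_add, neg_one_sq, mul_one]

theorem lift_lower_sub (Q : BiAlt n (g + 1)) :
    lift (lower Q) - lower (lift Q) = (2 * ((g + 1 : ℕ) : ℂ) - n) • Q := by
  ext X Y
  have h : lift (lower Q) X Y = ∑ s : Fin n, ∑ i : Fin (g + 1), ∑ j : Fin (g + 1),
      (-1) ^ (i + j : ℕ) * (X i ⬝ᵥ Y j *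
        Q (i.succ.removeNth (Matrix.vecCons (Pi.single s 1) X : Fin (g + 2) → Fin n → ℂ))
          (j.succ.removeNth (Matrix.vecCons (Pi.single s 1) Y : Fin (g + 2) → Fin n → ℂ))) := by
    simp only [lift_apply, lower_apply, removeNth_succ_vecCons, Finset.mul_sum]
    rw [Finset.sum_comm (s := (Finset.univ : Finset (Fin n)))]
    exact Finset.sum_congr rfl fun i _ => Finset.sum_comm
  rw [AlternatingMap.sub_apply, AlternatingMap.sub_apply, lower_lift_apply, h]
  simp only [AlternatingMap.smul_apply, smul_eq_mul]
  ring

theorem lower_lift_zero (Q : BiAlt n 0) : lower (lift Q) = (n : ℂ) • Q := by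
  ext X Y
  rw [lower_lift_apply]
  simp

/-- After l_j is replaced by l_i, the entries i and j coincide, so deleting one or the other changes
the value of an alternating map by a sign only. This turns the off-diagonal m_{ij} and v_{ij} into
signed minors. -/
theorem neg_map_removeNth_update {N : Type*} [AddCommGroup N] [Module ℂ N] {M : Type*}
    [AddCommGroup M] [Module ℂ M] (f : M [⋀^Fin g]→ₗ[ℂ] N) (l : Fin (g + 1) → M)
    {i j : Fin (g + 1)} (hij : i ≠ j) :
    -f (i.removeNth (Function.update l j (l i))) = (-1 : ℂ) ^ (i + j : ℕ) • f (j.removeNth l) := by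
  have h := f.neg_one_pow_smul_map_removeNth_add_eq_zero_of_eq (v := Function.update l j (l i))
    (i := i) (j := j) (by simp [hij]) hij
  have h1 : j.removeNth (Function.update l j (l i)) = j.removeNth l := by
    funext m
    simp [Fin.removeNth]
  rw [h1, ← Int.cast_smul_eq_zsmul ℂ, ← Int.cast_smul_eq_zsmul ℂ] at h
  push_cast at h
  have h2 := congrArg (fun x => (-1 : ℂ) ^ (i : ℕ) • x) h
  simp only [smul_add, smul_smul, ← pow_add, smul_zero, Even.neg_one_pow ⟨(i : ℕ), rfl⟩, one_smul] at h2
  exact (eq_neg_of_add_eq_zero_right h2).symm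

theorem holDeriv_comp_removeCol (i : Fin (g + 1)) (j : Fin g) (v : Fin n → ℂ)
    (U : Matrix (Fin n) (Fin (g + 1)) ℂ) (P : Matrix (Fin n) (Fin g) ℂ → ℂ) :
    holDeriv (fun U : Matrix (Fin n) (Fin (g + 1)) ℂ => P (U.submatrix id i.succAbove))
      (column (i.succAbove j) v) U = holDeriv P (column j v) (U.submatrix id i.succAbove) := by
  have h : ∀ w : Fin n → ℂ, lineDeriv ℝ (fun U : Matrix (Fin n) (Fin (g + 1)) ℂ =>
      P (U.submatrix id i.succAbove)) U (column (i.succAbove j) w) =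
      lineDeriv ℝ P (U.submatrix id i.succAbove) (column j w) := by
    intro w
    rw [lineDeriv, lineDeriv]
    congr 1
    funext t
    congr 1
    ext s k
    simp [column]
  rw [holDeriv, holDeriv, I_smul_column, I_smul_column, h, h]

/-- For i ≠ j the derivative λ_i · ∂/∂λ_j puts λ_i in place of column j in the holomorphic argument
only. With the sign rule above, m_{ij} becomes the minor that omits column j of U and column i of Ū.
-/
theorem minorMatrix_diag (U : Matrix (Fin n) (Fin (g + 1)) ℂ) (i j : Fin (g + 1)) :
    minorMatrix Q.diag U i j = (-1) ^ (i + j : ℕ) *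
      Q (j.removeNth fun i s => U s i) (i.removeNth fun i s => conj (U s i)) := by
  rw [minorMatrix, Matrix.of_apply]
  split_ifs with h
  · subst h
    rw [Even.neg_one_pow ⟨(i : ℕ), rfl⟩, one_mul]
    rfl
  · obtain ⟨k, rfl⟩ := Fin.exists_succAbove_eq (Ne.symm h)
    rw [holDeriv_comp_removeCol, holDeriv_diag]
    have := congrArg (fun f => f (i.removeNth fun i s => conj (U s i)))
      (neg_map_removeNth_update Q (fun i s => U s i) h)
    simp only [AlternatingMap.neg_apply, AlternatingMap.smul_apply, smul_eq_mul] at this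
    rw [← this]
    congr 3
    funext m
    simp only [Fin.removeNth, Matrix.submatrix_apply, id_eq]
    by_cases hm : m = k
    · subst hm; simp
    · simp [hm]

theorem raise_diag : raise Q.diag = (lift Q).diag := by
  funext U
  rw [raise, diag, lift_apply, Matrix.trace]
  simp only [Matrix.diag_apply, Matrix.mul_apply (N := minorMatrix _ _), minorMatrix_diag]
  refine Finset.sum_congr rfl fun i _ => Finset.sum_congr rfl fun j _ => ?_
  rw [add_comm (j : ℕ), Matrix.mul_apply]
  simp only [dotProduct, Matrix.transpose_apply, Matrix.map_apply]
  ring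

theorem diag_add (Q Q' : BiAlt n g) : (Q + Q').diag = Q.diag + Q'.diag := rfl

theorem diag_sub (Q Q' : BiAlt n g) : (Q - Q').diag = Q.diag - Q'.diag := rfl

theorem diag_smul (c : ℂ) (Q : BiAlt n g) : (c • Q).diag = c • Q.diag := rfl

theorem lift_add (Q Q' : BiAlt n g) : lift (Q + Q') = lift Q + lift Q' := by
  ext X Y
  simp only [AlternatingMap.add_apply, lift_apply, mul_add, Finset.sum_add_distrib]

theorem lift_smul (c : ℂ) (Q : BiAlt n g) : lift (c • Q) = c • lift Q := by
  ext X Y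
  simp only [AlternatingMap.smul_apply, lift_apply, smul_eq_mul, Finset.mul_sum]
  exact Finset.sum_congr rfl fun i _ => Finset.sum_congr rfl fun j _ => by ring

theorem lower_add (Q Q' : BiAlt n (g + 1)) : lower (Q + Q') = lower Q + lower Q' := by
  ext X Y
  simp only [AlternatingMap.add_apply, lower_apply, Finset.sum_add_distrib]

theorem lower_smul (c : ℂ) (Q : BiAlt n (g + 1)) : lower (c • Q) = c • lower Q := by
  ext X Y
  simp only [AlternatingMap.smul_apply, lower_apply, smul_eq_mul, Finset.mul_sum]

end BiAlt

theorem polyTot_exists_biAlt (P : polyTot n) :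
    ∃ Q : (g : ℕ) → BiAlt n g, (P : Family n) = fun g => (Q g).diag := by
  choose Q hQ using fun g => exists_biAlt (P.2 g)
  exact ⟨Q, funext hQ⟩

/-- `Λ` as an endomorphism of `F_{n,•}`. -/
def raiseEnd (n : ℕ) : Module.End ℂ (polyTot n) where
  toFun P := ⟨raiseTot P, by
    obtain ⟨Q, hQ⟩ := polyTot_exists_biAlt P
    rw [hQ]
    rintro (_ | g)
    · exact (polySpace n 0).zero_mem
    · simpa only [raiseTot, BiAlt.raise_diag] using BiAlt.diag_mem _⟩
  map_add' P P' := by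
    obtain ⟨Q, hQ⟩ := polyTot_exists_biAlt P
    obtain ⟨Q', hQ'⟩ := polyTot_exists_biAlt P'
    ext1
    simp only [Submodule.coe_add, hQ, hQ']
    funext g
    obtain _ | g := g
    · simp [raiseTot]
    · simp only [raiseTot, Pi.add_apply, ← BiAlt.diag_add, BiAlt.raise_diag, BiAlt.lift_add]
  map_smul' c P := by
    obtain ⟨Q, hQ⟩ := polyTot_exists_biAlt P
    ext1
    simp only [Submodule.coe_smul, hQ]
    funext g
    obtain _ | g := g
    · simp [raiseTot]
    · simp only [raiseTot, Pi.smul_apply, ← BiAlt.diag_smul, BiAlt.raise_diag, BiAlt.lift_smul,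
        RingHom.id_apply]

/-- `Δ` as an endomorphism of `F_{n,•}`. -/
def laplaceEnd (n : ℕ) : Module.End ℂ (polyTot n) where
  toFun P := ⟨laplaceTot P, by
    obtain ⟨Q, hQ⟩ := polyTot_exists_biAlt P
    rw [hQ]
    intro g
    simpa only [laplaceTot, BiAlt.laplace_diag] using BiAlt.diag_mem _⟩
  map_add' P P' := by
    obtain ⟨Q, hQ⟩ := polyTot_exists_biAlt P
    obtain ⟨Q', hQ'⟩ := polyTot_exists_biAlt P'
    ext1
    simp only [Submodule.coe_add, hQ, hQ']
    funext g
    simp only [laplaceTot, Pi.add_apply, ← BiAlt.diag_add, BiAlt.laplace_diag, BiAlt.lower_add]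
  map_smul' c P := by
    obtain ⟨Q, hQ⟩ := polyTot_exists_biAlt P
    ext1
    simp only [Submodule.coe_smul, hQ]
    funext g
    simp only [laplaceTot, Pi.smul_apply, ← BiAlt.diag_smul, BiAlt.laplace_diag, BiAlt.lower_smul,
      RingHom.id_apply]

theorem degreeTot_apply (P : polyTot n) :
    degreeTot (P : Family n) = fun g : ℕ => (2 * (g : ℂ) - n) • (P : Family n) g := by
  obtain ⟨Q, hQ⟩ := polyTot_exists_biAlt P
  rw [hQ]
  funext g
  rw [degreeTot, BiAlt.degree_diag]

/-- `H` as an endomorphism of `F_{n,•}`. -/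
def degreeEnd (n : ℕ) : Module.End ℂ (polyTot n) where
  toFun P := ⟨degreeTot P, by
    rw [degreeTot_apply]
    exact fun g => (polySpace n g).smul_mem _ (P.2 g)⟩
  map_add' P P' := by
    ext1
    change degreeTot ((P + P' : polyTot n) : Family n) = degreeTot (P : Family n) + degreeTot (P' : Family n)
    rw [degreeTot_apply, degreeTot_apply, degreeTot_apply]
    funext g
    exact smul_add _ _ _
  map_smul' c P := by
    ext1
    change degreeTot ((c • P : polyTot n) : Family n) = c • degreeTot (P : Family n)
    rw [degreeTot_apply, degreeTot_apply]
    funext g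
    exact smul_comm (2 * (g : ℂ) - n) c ((P : Family n) g)

theorem raiseEnd_mul_laplaceEnd_sub :
    raiseEnd n * laplaceEnd n - laplaceEnd n * raiseEnd n = degreeEnd n := by
  ext P : 2
  obtain ⟨Q, hQ⟩ := polyTot_exists_biAlt P
  change raiseTot (laplaceTot (P : Family n)) - laplaceTot (raiseTot (P : Family n)) =
    degreeTot (P : Family n)
  rw [degreeTot_apply, hQ]
  funext g
  obtain _ | g := g
  · simp only [Pi.sub_apply, raiseTot, laplaceTot, BiAlt.raise_diag, BiAlt.laplace_diag,
      BiAlt.lower_lift_zero, BiAlt.diag_smul]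
    simp
  · simp only [Pi.sub_apply, raiseTot, laplaceTot, BiAlt.raise_diag, BiAlt.laplace_diag]
    rw [← BiAlt.diag_sub, BiAlt.lift_lower_sub, BiAlt.diag_smul]

theorem degreeEnd_mul_raiseEnd_sub :
    degreeEnd n * raiseEnd n - raiseEnd n * degreeEnd n = (2 : ℂ) • raiseEnd n := by
  have h : ∀ P : polyTot n, ((degreeEnd n P : polyTot n) : Family n) =
    fun g : ℕ => (2 * (g : ℂ) - n) • (P : Family n) g := fun P => degreeTot_apply P
  ext P : 2
  obtain ⟨Q, hQ⟩ := polyTot_exists_biAlt P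
  change ((degreeEnd n (raiseEnd n P) : polyTot n) : Family n) -
    raiseTot ((degreeEnd n P : polyTot n) : Family n) = (2 : ℂ) • raiseTot (P : Family n)
  rw [h, h]
  change (fun g => _ • raiseTot (P : Family n) g) - _ = _
  rw [hQ]
  funext g
  obtain _ | g := g
  · simp [raiseTot]
  · simp only [Pi.sub_apply, Pi.smul_apply, raiseTot, ← BiAlt.diag_smul, BiAlt.raise_diag, BiAlt.lift_smul]
    rw [← BiAlt.diag_sub]
    congr 1
    push_cast
    module

theorem degreeEnd_mul_laplaceEnd_sub :
    degreeEnd n * laplaceEnd n - laplaceEnd n * degreeEnd n = (-2 : ℂ) • laplaceEnd n := by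
  have h : ∀ P : polyTot n, ((degreeEnd n P : polyTot n) : Family n) =
    fun g : ℕ => (2 * (g : ℂ) - n) • (P : Family n) g := fun P => degreeTot_apply P
  ext P : 2
  obtain ⟨Q, hQ⟩ := polyTot_exists_biAlt P
  change ((degreeEnd n (laplaceEnd n P) : polyTot n) : Family n) -
    laplaceTot ((degreeEnd n P : polyTot n) : Family n) = (-2 : ℂ) • laplaceTot (P : Family n)
  rw [h, h]
  change (fun g => _ • laplaceTot (P : Family n) g) - _ = _
  rw [hQ]
  funext g
  simp only [Pi.sub_apply, Pi.smul_apply, laplaceTot, ← BiAlt.diag_smul, BiAlt.laplace_diag,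
    BiAlt.lower_smul]
  rw [← BiAlt.diag_sub]
  congr 1
  push_cast
  module

end sl2polynomials

/-! ### From three operators to a representation of sl₂(ℂ). -/

/-- The representation of `sl₂(ℂ)` defined by three operators. -/
def sl2Rep {A : Type*} [AddCommGroup A] [Module ℂ A] (e f h : Module.End ℂ A)
    (hef : e * f - f * e = h) (hhe : h * e - e * h = (2 : ℂ) • e) (hhf : h * f - f * h = (-2 : ℂ) • f) :
    LieAlgebra.SpecialLinear.sl (Fin 2) ℂ →ₗ⁅ℂ⁆ Module.End ℂ A where
  toFun X := X.1 0 1 • e + X.1 1 0 • f + X.1 0 0 • h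
  map_add' X Y := by
    have h : ∀ i j, (X + Y).1 i j = X.1 i j + Y.1 i j := fun _ _ => rfl
    rw [h, h, h]
    module
  map_smul' c X := by
    have h : ∀ i j, (c • X).1 i j = c * X.1 i j := fun _ _ => rfl
    rw [h, h, h, RingHom.id_apply]
    module
  map_lie' := by
    intro X Y
    have hX : X.1 1 1 = -X.1 0 0 := by
      have : Matrix.trace X.1 = 0 := X.2
      rw [Matrix.trace_fin_two] at this
      linear_combination this
    have hY : Y.1 1 1 = -Y.1 0 0 := by
      have : Matrix.trace Y.1 = 0 := Y.2
      rw [Matrix.trace_fin_two] at this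
      linear_combination this
    have hb : ∀ i j, (⁅X, Y⁆ : LieAlgebra.SpecialLinear.sl (Fin 2) ℂ).1 i j =
        (X.1 * Y.1 - Y.1 * X.1) i j := fun i j => rfl
    simp only [hb, Matrix.sub_apply, Matrix.mul_apply, Fin.sum_univ_two, hX, hY, Ring.lie_def]
    -- These relations bring every quadratic monomial to one of the orders f e, e h, f h, after
    -- which coefficients can be compared.
    have h1 : e * f = f * e + h := by rw [← hef]; abel
    have h2 : h * e = e * h + (2 : ℂ) • e := by rw [← hhe]; abel
    have h3 : h * f = f * h + (-2 : ℂ) • f := by rw [← hhf]; abel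
    simp only [add_mul, mul_add, smul_mul_assoc, mul_smul_comm, h1, h2, h3, smul_add, smul_smul]
    module

@[simp] theorem sl2Rep_apply {A : Type*} [AddCommGroup A] [Module ℂ A] (e f h : Module.End ℂ A)
    (hef hhe hhf) (X : LieAlgebra.SpecialLinear.sl (Fin 2) ℂ) :
    sl2Rep e f h hef hhe hhf X = X.1 0 1 • e + X.1 1 0 • f + X.1 0 0 • h := rfl

/-! ### Products of anticommuting elements. -/

section anticommuting

variable {A W : Type*} [Ring A] [Algebra ℂ A] [AddCommGroup W] [Module ℂ W] {f : W →ₗ[ℂ] A}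
  (hf : ∀ x, f x * f x = 0)

/-- The product `f x_0 * … * f x_{g-1}` of anticommuting elements. -/
def multi (g : ℕ) : W [⋀^Fin g]→ₗ[ℂ] A :=
  (ExteriorAlgebra.lift ℂ ⟨f, hf⟩).toLinearMap.compAlternatingMap (ExteriorAlgebra.ιMulti ℂ g)

theorem multi_zero (x : Fin 0 → W) : multi hf 0 x = 1 := by
  simp [multi]

theorem multi_succ (g : ℕ) (x : Fin (g + 1) → W) :
    multi hf (g + 1) x = f (x 0) * multi hf g (Fin.tail x) := by
  simp [multi, ExteriorAlgebra.ιMulti_succ_apply, Matrix.vecTail, Function.comp_def]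
  rfl

theorem mul_multi_of_anticommute {d : A} (hd : ∀ x, d * f x = -(f x * d)) (g : ℕ) (x : Fin g → W) :
    d * multi hf g x = (-1 : ℂ) ^ g • (multi hf g x * d) := by
  induction g with
  | zero => simp [multi_zero]
  | succ g ih =>
    rw [multi_succ, ← mul_assoc, hd, neg_mul, mul_assoc, ih, pow_succ, mul_smul_comm, mul_assoc]
    module

/-- Wick expansion: d is moved to the right through the product, and passing the factor i leaves the
scalar φ(x_i) with the sign of the i factors already passed. -/
theorem mul_multi_succ {d : A} {φ : W → ℂ} (hd : ∀ x, d * f x + f x * d = φ x • 1) (g : ℕ)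
    (x : Fin (g + 1) → W) :
    d * multi hf (g + 1) x = ∑ i : Fin (g + 1), (-1 : ℂ) ^ (i : ℕ) • φ (x i) •
      multi hf g (i.removeNth x) + (-1 : ℂ) ^ (g + 1) • (multi hf (g + 1) x * d) := by
  have hd' : ∀ x, d * f x = φ x • 1 - f x * d := fun x => by rw [← hd]; abel
  induction g with
  | zero =>
    simp only [multi_succ, multi_zero, mul_one, hd']
    simp [sub_eq_add_neg]
  | succ g ih =>
    have h1 : ∀ i : Fin (g + 1), multi hf (g + 1) (i.succ.removeNth x) =
        f (x 0) * multi hf g (i.removeNth (Fin.tail x)) := by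
      intro i
      have : Fin.tail (i.succ.removeNth x) = i.removeNth (Fin.tail x) := by
        funext m; simp [Fin.tail, Fin.removeNth]
      rw [multi_succ, this]
      rfl
    have h3 : ∀ i, φ (Fin.tail x i) = φ (x i.succ) := fun _ => rfl
    have h2 : (0 : Fin (g + 2)).removeNth x = Fin.tail x := rfl
    rw [Fin.sum_univ_succ]
    simp only [h1, h2]
    rw [multi_succ, ← mul_assoc, hd', sub_mul, mul_assoc, ih]
    simp only [Fin.val_zero, Fin.val_succ, mul_add, Finset.mul_sum, mul_smul_comm, pow_succ,
      smul_mul_assoc, one_mul, mul_assoc, h3]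
    simp only [mul_neg, mul_one, neg_smul, Finset.sum_neg_distrib, pow_zero, one_smul, neg_neg]
    abel

end anticommuting

/-! ### Creation and annihilation operators -/

section fock

variable {V : Type*} [NormedAddCommGroup V] [InnerProductSpace ℂ V]

/-- Families of constant forms of all degrees. -/
def Fock (V : Type*) [NormedAddCommGroup V] [InnerProductSpace ℂ V] : Type _ :=
  (p : ℕ) → Alt V p

instance : AddCommGroup (Fock V) := inferInstanceAs (AddCommGroup ((p : ℕ) → Alt V p))

instance : Module ℂ (Fock V) := inferInstanceAs (Module ℂ ((p : ℕ) → Alt V p))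

/-- The component of degree `p`. -/
def component (p : ℕ) : Fock V →ₗ[ℂ] Alt V p := LinearMap.proj (R := ℂ) (φ := fun p => Alt V p) p

@[ext] theorem Fock.ext {η η' : Fock V} (h : ∀ p, component p η = component p η') : η = η' := funext h

/-- Exterior multiplication by a `1`-form. -/
def extOp : (V →L[ℝ] ℂ) →ₗ[ℂ] Module.End ℂ (Fock V) where
  toFun θ :=
    { toFun := fun η p => match p with
        | 0 => 0
        | p + 1 => wedgeOne θ p (η p)
      map_add' := fun η η' => by
        funext p
        obtain _ | p := p
        · exact (add_zero 0).symm
        · exact map_add (wedgeOne θ p) (η p) (η' p)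
      map_smul' := fun c η => by
        funext p
        obtain _ | p := p
        · exact (smul_zero (A := Alt V 0) c).symm
        · exact map_smul (wedgeOne θ p) c (η p) }
  map_add' θ θ' := by
    ext η p v
    obtain _ | p := p
    · exact (add_zero (0 : ℂ)).symm
    · change wedgeOne (θ + θ') p (η p) v = wedgeOne θ p (η p) v + wedgeOne θ' p (η p) v
      simp only [wedgeOne_apply, ← Finset.sum_add_distrib]
      refine Finset.sum_congr rfl fun i _ => ?_
      rw [add_apply]
      ring
  map_smul' c θ := by
    ext η p v
    obtain _ | p := p
    · exact (mul_zero c).symm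
    · change wedgeOne (c • θ) p (η p) v = c * wedgeOne θ p (η p) v
      simp only [wedgeOne_apply, Finset.mul_sum]
      refine Finset.sum_congr rfl fun i _ => ?_
      rw [smul_apply, smul_eq_mul]
      ring

/-- Contraction with a vector. -/
def intOp : V →ₗ[ℝ] Module.End ℂ (Fock V) where
  toFun x :=
    { toFun := fun η p => (η (p + 1)).curryLeft x
      map_add' := fun _ _ => rfl
      map_smul' := fun _ _ => rfl }
  map_add' x y := by
    ext η p v
    exact congrArg (fun f => f v) ((component (p + 1) η).curryLeft.map_add x y)
  map_smul' c x := by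
    ext η p v
    exact congrArg (fun f => f v) ((component (p + 1) η).curryLeft.map_smul c x)

theorem intOp_apply (x : V) (η : Fock V) (p : ℕ) (v : Fin p → V) :
    component p (intOp x η) v = component (p + 1) η (Matrix.vecCons x v) := rfl

theorem extOp_succ (θ : V →L[ℝ] ℂ) (η : Fock V) (p : ℕ) :
    component (p + 1) (extOp θ η) = wedgeOne θ p (component p η) := rfl

theorem extOp_zero (θ : V →L[ℝ] ℂ) (η : Fock V) : component 0 (extOp θ η) = 0 := rfl

theorem component_succ_apply (p : ℕ) (η : Fock V) (v : Fin (p + 1) → V) :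
    component (p + 1) η v = component p (intOp (v 0) η) (Fin.tail v) := by
  rw [intOp_apply]
  congr 1
  exact (Fin.cons_self_tail v).symm

theorem intOp_mul_self (x : V) : intOp x * intOp x = 0 := by
  ext η p v
  change component (p + 2) η (Matrix.vecCons x (Matrix.vecCons x v)) = 0
  exact (component (p + 2) η).map_eq_zero_of_eq _ (i := 0) (j := 1) (by simp) (by simp)

theorem intOp_anticommute (x y : V) : intOp x * intOp y = -(intOp y * intOp x) := by
  have := intOp_mul_self (x + y)
  simp only [map_add, add_mul, mul_add, intOp_mul_self, zero_add, add_zero] at this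
  exact eq_neg_of_add_eq_zero_right this

/-- Contraction is an antiderivation of the exterior product. All later commutators are computed
from this relation. -/
theorem intOp_mul_extOp (x : V) (θ : V →L[ℝ] ℂ) :
    intOp x * extOp θ + extOp θ * intOp x = θ x • 1 := by
  ext η p v
  obtain _ | p := p
  · change wedgeOne θ 0 (component 0 η) (Matrix.vecCons x v) + (0 : Alt V 0) v = θ x * component 0 η v
    rw [wedgeOne_apply]
    simp
  · change wedgeOne θ (p + 1) (component (p + 1) η) (Matrix.vecCons x v) +
      wedgeOne θ p ((component (p + 1) η).curryLeft x) v = θ x * component (p + 1) η v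
    rw [wedgeOne_apply, wedgeOne_apply, Fin.sum_univ_succ, BiAlt.removeNth_zero_vecCons]
    simp only [BiAlt.removeNth_succ_vecCons, Matrix.cons_val_zero, Matrix.cons_val_succ, Fin.val_zero,
      Fin.val_succ, pow_zero, one_mul, ContinuousAlternatingMap.curryLeft_apply_apply, pow_succ,
      mul_neg, mul_one, neg_mul, Finset.sum_neg_distrib]
    ring

/-- The anticommutator commutes with every contraction and has no component in degree 0. A form of
positive degree is determined by its contractions, so induction on the degree shows that it
vanishes. -/
theorem extOp_anticommute (θ θ' : V →L[ℝ] ℂ) : extOp θ * extOp θ' = -(extOp θ' * extOp θ) := by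
  rw [eq_neg_iff_add_eq_zero]
  set T := extOp θ * extOp θ' + extOp θ' * extOp θ with hT
  have h : ∀ x : V, intOp x * T = T * intOp x := by
    intro x
    have h1 : intOp x * extOp θ = θ x • 1 - extOp θ * intOp x := by rw [← intOp_mul_extOp]; abel
    have h2 : intOp x * extOp θ' = θ' x • 1 - extOp θ' * intOp x := by rw [← intOp_mul_extOp]; abel
    rw [hT, mul_add, ← mul_assoc, ← mul_assoc, h1, h2, sub_mul, sub_mul, mul_assoc, mul_assoc, h1, h2,
      mul_sub, mul_sub]
    simp only [smul_mul_assoc, mul_smul_comm, one_mul, mul_one, add_mul, mul_assoc]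
    abel
  have key : ∀ (p : ℕ) (η : Fock V), component p (T η) = 0 := by
    intro p
    induction p with
    | zero => exact fun η => add_zero 0
    | succ p ih =>
      intro η
      ext v
      rw [component_succ_apply, ← Module.End.mul_apply, h, Module.End.mul_apply, ih]
      rfl
  ext η p v
  rw [key]
  rfl

theorem extOp_mul_self (θ : V →L[ℝ] ℂ) : extOp θ * extOp θ = 0 := by
  have h : (2 : ℂ) • (extOp θ * extOp θ) = 0 := by
    rw [two_smul]
    nth_rewrite 1 [extOp_anticommute θ θ]
    exact neg_add_cancel _
  exact (smul_eq_zero.mp h).resolve_left two_ne_zero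

/-- The contraction with the `(1,0)`-part of a vector. -/
def holInt (x : V) : Module.End ℂ (Fock V) :=
  (1 / 2 : ℂ) • (intOp x - Complex.I • intOp (Complex.I • x))

/-- The contraction with the `(0,1)`-part of a vector. -/
def antiInt (x : V) : Module.End ℂ (Fock V) :=
  (1 / 2 : ℂ) • (intOp x + Complex.I • intOp (Complex.I • x))

theorem holInt_mul_extOp (x : V) (θ : V →L[ℝ] ℂ) : holInt x * extOp θ + extOp θ * holInt x =
    ((θ x - Complex.I * θ (Complex.I • x)) / 2) • 1 := by
  have h1 := intOp_mul_extOp x θ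
  have h2 := intOp_mul_extOp (Complex.I • x) θ
  rw [holInt, smul_mul_assoc, mul_smul_comm, sub_mul, mul_sub, smul_mul_assoc, mul_smul_comm, ← smul_add,
    sub_add_sub_comm, h1, ← smul_add, h2]
  module

theorem antiInt_mul_extOp (x : V) (θ : V →L[ℝ] ℂ) : antiInt x * extOp θ + extOp θ * antiInt x =
    ((θ x + Complex.I * θ (Complex.I • x)) / 2) • 1 := by
  have h1 := intOp_mul_extOp x θ
  have h2 := intOp_mul_extOp (Complex.I • x) θ
  rw [antiInt, smul_mul_assoc, mul_smul_comm, add_mul, mul_add, smul_mul_assoc, mul_smul_comm, ← smul_add,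
    add_add_add_comm, h1, ← smul_add, h2]
  module

/-- Rewrites the real bivector b_s ∧ i b_s from the definition of δ through the complex
contractions, each of which pairs with only one of dz and dz̄. -/
theorem holInt_mul_antiInt_self (x : V) :
    intOp (Complex.I • x) * intOp x = (2 * Complex.I) • (holInt x * antiInt x) := by
  have h := intOp_anticommute x (Complex.I • x)
  rw [holInt, antiInt, smul_mul_assoc, mul_smul_comm, sub_mul, mul_add, mul_add, smul_mul_assoc,
    mul_smul_comm, smul_mul_assoc, mul_smul_comm, intOp_mul_self, intOp_mul_self, h]
  simp only [smul_neg, smul_zero, zero_add, add_zero, smul_sub, smul_smul]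
  match_scalars
  linear_combination Complex.I_mul_I

end fock

/-! ### The Lefschetz operators in unitary coordinates. -/

section operators

variable {V : Type*} [NormedAddCommGroup V] [InnerProductSpace ℂ V] {n : ℕ}
  (b : OrthonormalBasis (Fin n) ℂ V)

/-- Exterior multiplication by `∑ s, y_s dz_s`. -/
def dzOp : (Fin n → ℂ) →ₗ[ℂ] Module.End ℂ (Fock V) :=
  Fintype.linearCombination ℂ fun s => extOp (pullDz (b s))

/-- Exterior multiplication by `∑ s, x_s dz̄_s`. -/
def dzBarOp : (Fin n → ℂ) →ₗ[ℂ] Module.End ℂ (Fock V) :=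
  Fintype.linearCombination ℂ fun s => extOp (pullDzBar (b s))

/-- `pullDz` is conjugate-linear in its vector, whence the conjugates: the operator is linear in y.
-/
theorem extOp_pullDz (y : Fin n → ℂ) : extOp (pullDz (∑ s, conj (y s) • b s)) = dzOp b y := by
  rw [dzOp, Fintype.linearCombination_apply]
  simp only [← map_smul, ← map_sum]
  congr 1
  ext v
  simp [pullDz]

theorem extOp_pullDzBar (x : Fin n → ℂ) : extOp (pullDzBar (∑ s, x s • b s)) = dzBarOp b x := by
  rw [dzBarOp, Fintype.linearCombination_apply]
  simp only [← map_smul, ← map_sum]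
  congr 1
  ext v
  simp [pullDzBar, pullDz]

theorem dzOp_mul_self (y : Fin n → ℂ) : dzOp b y * dzOp b y = 0 := by
  rw [← extOp_pullDz, extOp_mul_self]

theorem dzBarOp_mul_self (x : Fin n → ℂ) : dzBarOp b x * dzBarOp b x = 0 := by
  rw [← extOp_pullDzBar, extOp_mul_self]

theorem dzBarOp_anticommute_dzOp (x y : Fin n → ℂ) : dzBarOp b x * dzOp b y = -(dzOp b y * dzBarOp b x) := by
  rw [← extOp_pullDzBar, ← extOp_pullDz, extOp_anticommute]

theorem holInt_mul_dzOp (s : Fin n) (y : Fin n → ℂ) :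
    holInt (b s) * dzOp b y + dzOp b y * holInt (b s) = y s • 1 := by
  rw [← extOp_pullDz, holInt_mul_extOp]
  congr 1
  have : inner ℂ (∑ s, conj (y s) • b s) (b s) = y s := by
    simp [b.inner_eq_ite]
  simp only [pullDz, ContinuousLinearMap.coe_restrictScalars', innerSL_apply_apply, inner_smul_right, this]
  linear_combination (-y s / 2) * Complex.I_mul_I

theorem holInt_mul_dzBarOp (s : Fin n) (x : Fin n → ℂ) :
    holInt (b s) * dzBarOp b x = -(dzBarOp b x * holInt (b s)) := by
  rw [eq_neg_iff_add_eq_zero, ← extOp_pullDzBar, holInt_mul_extOp, pullDzBar_smul]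
  convert zero_smul ℂ (1 : Module.End ℂ (Fock V))
  rw [Complex.conj_I]
  linear_combination (pullDzBar (∑ s, x s • b s) (b s) / 2) * Complex.I_mul_I

theorem antiInt_mul_dzOp (s : Fin n) (y : Fin n → ℂ) :
    antiInt (b s) * dzOp b y = -(dzOp b y * antiInt (b s)) := by
  rw [eq_neg_iff_add_eq_zero, ← extOp_pullDz, antiInt_mul_extOp, pullDz_smul]
  convert zero_smul ℂ (1 : Module.End ℂ (Fock V))
  linear_combination (pullDz (∑ s, conj (y s) • b s) (b s) / 2) * Complex.I_mul_I

theorem antiInt_mul_dzBarOp (s : Fin n) (x : Fin n → ℂ) :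
    antiInt (b s) * dzBarOp b x + dzBarOp b x * antiInt (b s) = x s • 1 := by
  rw [← extOp_pullDzBar, antiInt_mul_extOp, pullDzBar_smul]
  congr 1
  have : pullDzBar (∑ s, x s • b s) (b s) = x s := by
    simp [pullDzBar, pullDz, b.inner_eq_ite]
  rw [this, Complex.conj_I]
  linear_combination (-x s / 2) * Complex.I_mul_I

variable (q : ℝ)

/-- The Lefschetz operator in all degrees. -/
def lefOp : Module.End ℂ (Fock V) :=
  (Complex.I / (q : ℂ)) • ∑ s, extOp (pullDz (b s)) * extOp (pullDzBar (b s))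

/-- The adjoint of the Lefschetz operator in all degrees. -/
def adjOp : Module.End ℂ (Fock V) :=
  (Complex.I * (q : ℂ)) • ∑ s, holInt (b s) * antiInt (b s)

theorem end_sum_apply {ι A : Type*} [AddCommGroup A] [Module ℂ A] (S : Finset ι)
    (f : ι → Module.End ℂ A) (x : A) : (∑ i ∈ S, f i) x = ∑ i ∈ S, f i x :=
  LinearMap.sum_apply _ _ _

theorem component_lefOp (p : ℕ) (η : Fock V) :
    component (p + 2) (lefOp b q η) = lefschetzForm q b p (component p η) := by
  rw [lefOp, lefschetzForm, LinearMap.smul_apply, end_sum_apply, map_smul, map_sum, smul_apply,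
    sum_apply]
  rfl

theorem component_adjOp (p : ℕ) (η : Fock V) :
    component p (adjOp b q η) = adjointForm q b p (component (p + 2) η) := by
  have h : adjOp b q = ((q / 2 : ℝ) : ℂ) • ∑ s, intOp (Complex.I • b s) * intOp (b s) := by
    simp only [holInt_mul_antiInt_self, ← Finset.smul_sum, smul_smul, adjOp]
    congr 1
    push_cast
    ring
  rw [h, adjointForm, LinearMap.smul_apply, end_sum_apply, map_smul, map_sum, smul_apply, sum_apply]
  rfl

/-- The number operator. -/
def numOp : Module.End ℂ (Fock V) :=
  ∑ s, (extOp (pullDz (b s)) * holInt (b s) + extOp (pullDzBar (b s)) * antiInt (b s))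

theorem extOp_pullDz_basis (s : Fin n) : extOp (pullDz (b s)) = dzOp b (Pi.single s 1) := by
  simp [dzOp]

theorem extOp_pullDzBar_basis (s : Fin n) : extOp (pullDzBar (b s)) = dzBarOp b (Pi.single s 1) := by
  simp [dzBarOp]

theorem intOp_eq_sum (x : V) : intOp x = ∑ s, (inner ℂ (b s) x • holInt (b s) +
    conj (inner ℂ (b s) x) • antiInt (b s)) := by
  conv_lhs => rw [← b.sum_repr' x, map_sum]
  refine Finset.sum_congr rfl fun s _ => ?_
  set c := inner ℂ (b s) x
  have h1 : c • b s = c.re • b s + c.im • (Complex.I • b s) := by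
    conv_lhs => rw [← Complex.re_add_im c]
    rw [add_smul, mul_smul, Complex.coe_smul, Complex.coe_smul]
  rw [h1, map_add, map_smul, map_smul, holInt, antiInt]
  have h2 : ∀ (r : ℝ) (T : Module.End ℂ (Fock V)), r • T = (r : ℂ) • T := fun r T => by
    ext η p v; rfl
  rw [h2, h2]
  conv_rhs => rw [← Complex.re_add_im c]
  simp only [map_add, map_mul, Complex.conj_ofReal, Complex.conj_I]
  match_scalars
  · ring
  · linear_combination (c.im : ℂ) * Complex.I_mul_I

/-- Each contraction lowers the eigenvalue of the number operator by one. As forms are determined by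
their contractions, it follows by induction that this operator multiplies a form by its degree. -/
theorem intOp_mul_numOp (x : V) : intOp x * numOp b = numOp b * intOp x + intOp x := by
  have h : ∀ s, intOp x * (extOp (pullDz (b s)) * holInt (b s) + extOp (pullDzBar (b s)) * antiInt (b s)) =
      (extOp (pullDz (b s)) * holInt (b s) + extOp (pullDzBar (b s)) * antiInt (b s)) * intOp x +
      (inner ℂ (b s) x • holInt (b s) + conj (inner ℂ (b s) x) • antiInt (b s)) := by
    intro s
    have h1 : ∀ θ, intOp x * extOp θ = θ x • 1 - extOp θ * intOp x := fun θ => by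
      rw [← intOp_mul_extOp]; abel
    have h2 : intOp x * holInt (b s) = -(holInt (b s) * intOp x) := by
      have e1 := intOp_anticommute x (b s)
      have e2 := intOp_anticommute x (Complex.I • b s)
      simp only [holInt, mul_smul_comm, smul_mul_assoc, mul_sub, sub_mul, e1, e2]
      module
    have h3 : intOp x * antiInt (b s) = -(antiInt (b s) * intOp x) := by
      have e1 := intOp_anticommute x (b s)
      have e2 := intOp_anticommute x (Complex.I • b s)
      simp only [antiInt, mul_smul_comm, smul_mul_assoc, mul_add, add_mul, e1, e2]
      module
    have h4 : pullDzBar (b s) x = conj (inner ℂ (b s) x) := by simp [pullDzBar, pullDz]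
    have h5 : pullDz (b s) x = inner ℂ (b s) x := by simp [pullDz]
    rw [mul_add, ← mul_assoc, ← mul_assoc, h1, h1, sub_mul, sub_mul, mul_assoc, mul_assoc, h2, h3, h4, h5]
    simp only [smul_mul_assoc, one_mul, mul_neg, add_mul, mul_assoc]
    abel
  rw [numOp, Finset.mul_sum, Finset.sum_mul]
  simp only [h, Finset.sum_add_distrib (g := fun s => inner ℂ (b s) x • holInt (b s) +
    conj (inner ℂ (b s) x) • antiInt (b s)), ← intOp_eq_sum]

theorem component_numOp (p : ℕ) (η : Fock V) : component p (numOp b η) = (p : ℂ) • component p η := by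
  induction p generalizing η with
  | zero =>
    rw [numOp, end_sum_apply, map_sum]
    simp [extOp_zero]
    exact (zero_smul ℂ _).symm
  | succ p ih =>
    ext v
    rw [component_succ_apply, ← Module.End.mul_apply, intOp_mul_numOp, LinearMap.add_apply,
      Module.End.mul_apply, map_add, ih]
    rw [ContinuousAlternatingMap.add_apply, ContinuousAlternatingMap.smul_apply,
      ContinuousAlternatingMap.smul_apply, component_succ_apply, smul_eq_mul, smul_eq_mul]
    push_cast
    ring

/-- Only equal indices fail to commute, and each of them contributes its number operators minus 1.
The prefactor (iq)(i/q) = -1 then reverses the sign. -/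
theorem adjOp_mul_lefOp (hq : q ≠ 0) :
    adjOp b q * lefOp b q - lefOp b q * adjOp b q = (n : ℂ) • 1 - numOp b := by
  have hqc : (q : ℂ) ≠ 0 := by exact_mod_cast hq
  have h : ∀ s t, holInt (b s) * antiInt (b s) * (dzOp b (Pi.single t 1) * dzBarOp b (Pi.single t 1)) -
      (dzOp b (Pi.single t 1) * dzBarOp b (Pi.single t 1)) * (holInt (b s) * antiInt (b s)) =
      if s = t then dzOp b (Pi.single t 1) * holInt (b t) +
        dzBarOp b (Pi.single t 1) * antiInt (b t) - 1 else 0 := by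
    intro s t
    have h1 := antiInt_mul_dzOp b s (Pi.single t 1)
    have h2 : antiInt (b s) * dzBarOp b (Pi.single t 1) =
      (Pi.single t 1 : Fin n → ℂ) s • 1 - dzBarOp b (Pi.single t 1) * antiInt (b s) := by
      rw [← antiInt_mul_dzBarOp]; abel
    have h3 : holInt (b s) * dzOp b (Pi.single t 1) =
      (Pi.single t 1 : Fin n → ℂ) s • 1 - dzOp b (Pi.single t 1) * holInt (b s) := by
      rw [← holInt_mul_dzOp]; abel
    have h4 := holInt_mul_dzBarOp b s (Pi.single t 1)
    generalize hZ : dzOp b (Pi.single t 1) = Z at *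
    generalize hZB : dzBarOp b (Pi.single t 1) = ZB at *
    generalize hI : holInt (b s) = I at *
    generalize hJ : antiInt (b s) = J at *
    set c := (Pi.single t 1 : Fin n → ℂ) s with hc
    have key : I * J * (Z * ZB) - Z * ZB * (I * J) = c • (Z * I) + c • (ZB * J) - (c * c) • 1 := by
      calc I * J * (Z * ZB) - Z * ZB * (I * J) = I * (J * Z) * ZB - Z * ZB * (I * J) := by
            simp only [mul_assoc]
        _ = -(I * Z) * (J * ZB) - Z * ZB * (I * J) := by rw [h1]; simp only [mul_neg, neg_mul, mul_assoc]
        _ = -(c • 1 - Z * I) * (c • 1 - ZB * J) - Z * ZB * (I * J) := by rw [h2, h3]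
        _ = c • (Z * I) + c • (ZB * J) - (c * c) • 1 - Z * (I * ZB) * J - Z * ZB * (I * J) := by
            simp only [neg_mul, sub_mul, mul_sub, smul_mul_assoc, mul_smul_comm, one_mul, mul_one, mul_assoc]
            module
        _ = _ := by
            rw [h4]
            simp only [mul_neg, neg_mul, mul_assoc]
            abel
    rw [key]
    split_ifs with hst
    · subst hst
      rw [hc, hI, hJ]
      simp
    · rw [hc]
      simp [hst]
  have h' : ∀ s, ∑ t, (holInt (b s) * antiInt (b s) *
      (dzOp b (Pi.single t 1) * dzBarOp b (Pi.single t 1)) -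
      (dzOp b (Pi.single t 1) * dzBarOp b (Pi.single t 1)) * (holInt (b s) * antiInt (b s))) =
      dzOp b (Pi.single s 1) * holInt (b s) + dzBarOp b (Pi.single s 1) * antiInt (b s) - 1 := by
    intro s
    simp only [h]
    simp
  rw [adjOp, lefOp, numOp]
  simp only [extOp_pullDz_basis, extOp_pullDzBar_basis]
  rw [smul_mul_smul_comm, smul_mul_smul_comm, mul_comm (Complex.I / (q : ℂ)), ← smul_sub,
    Finset.sum_mul_sum, Finset.sum_mul_sum]
  conv_lhs => enter [2, 2]; rw [Finset.sum_comm]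
  rw [← Finset.sum_sub_distrib]
  simp only [← Finset.sum_sub_distrib, h']
  have hc : Complex.I * (q : ℂ) * (Complex.I / q) = -1 := by
    field_simp
    simp
  rw [hc, Finset.sum_sub_distrib]
  simp only [Finset.sum_const, Finset.card_univ, Fintype.card_fin]
  rw [← Nat.cast_smul_eq_nsmul ℂ]
  module

end operators

/-! ### Products of the forms f(l, l') and the effect of L and δ on them. -/

section products

variable {V : Type*} [NormedAddCommGroup V] [InnerProductSpace ℂ V] {n : ℕ}
  (b : OrthonormalBasis (Fin n) ℂ V) (q : ℝ)

/-- The constant function `1`, as a form of degree `0`. -/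
def vacuum : Fock V
  | 0 => ContinuousAlternatingMap.constOfIsEmpty ℝ V (Fin 0) (1 : ℂ)
  | _ + 1 => 0

theorem intOp_vacuum (x : V) : intOp x (vacuum : Fock V) = 0 := by
  ext p v
  rfl

theorem holInt_vacuum (x : V) : holInt x (vacuum : Fock V) = 0 := by
  simp [holInt, intOp_vacuum]

theorem antiInt_vacuum (x : V) : antiInt x (vacuum : Fock V) = 0 := by
  simp [antiInt, intOp_vacuum]

/-- The constant relating `∏ dz_{l'_i} ∧ dz̄_{l_i}` and `(∏ dz_{l'_i}) ∧ (∏ dz̄_{l_i})`. -/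
def prodCoeff : ℕ → ℂ
  | 0 => 1
  | g + 1 => Complex.I / (q : ℂ) * (-1) ^ g * prodCoeff g

/-- The product of all `f(l_i, l'_i)`, as a function of the coordinates of `l` and of `l'`. -/
def prodBi (g : ℕ) : (Fin n → ℂ) [⋀^Fin g]→ₗ[ℂ] ((Fin n → ℂ) [⋀^Fin g]→ₗ[ℂ] Alt V (2 * g)) :=
  LinearMap.compAlternatingMap
    { toFun := fun a => (prodCoeff q g • (component (2 * g) ∘ₗ LinearMap.applyₗ vacuum ∘ₗ
          LinearMap.mulRight ℂ a)).compAlternatingMap (multi (dzOp_mul_self b) g)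
      map_add' := fun a a' => by ext Y : 1; simp [mul_add]
      map_smul' := fun c a => by ext Y : 1; simp [smul_comm c] }
    (multi (dzBarOp_mul_self b) g)

theorem prodBi_apply (g : ℕ) (X Y : Fin g → Fin n → ℂ) : prodBi b q g X Y =
    prodCoeff q g • component (2 * g)
      ((multi (dzOp_mul_self b) g Y * multi (dzBarOp_mul_self b) g X) vacuum) := rfl

theorem wedgeF_component (l l' : V) (p : ℕ) (η : Fock V) : wedgeF q l l' p (component p η) =
    (Complex.I / (q : ℂ)) • component (p + 2) ((extOp (pullDz l') * extOp (pullDzBar l)) η) := rfl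

/-- Separating the dz from the dz̄ makes both alternating dependences visible. The leading dz̄ has
to pass g factors dz, which is the sign (-1)^g in `prodCoeff`. -/
theorem prodF_coordinates (g : ℕ) (X Y : Fin g → Fin n → ℂ) :
    prodF q g (fun i => ∑ s, X i s • b s) (fun i => ∑ s, conj (Y i s) • b s) = prodBi b q g X Y := by
  induction g with
  | zero =>
    rw [prodBi_apply, multi_zero, multi_zero, prodCoeff, one_smul]
    rfl
  | succ g ih =>
    have h := ih (Fin.tail X) (Fin.tail Y)
    rw [prodF]
    change wedgeF q _ _ _ (prodF q g (fun i => ∑ s, Fin.tail X i s • b s)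
      (fun i => ∑ s, conj (Fin.tail Y i s) • b s)) = _
    rw [h, prodBi_apply, prodBi_apply, map_smul, wedgeF_component, extOp_pullDz, extOp_pullDzBar,
      multi_succ, multi_succ, ← Module.End.mul_apply, mul_assoc, ← mul_assoc (dzBarOp b (X 0)),
      mul_multi_of_anticommute (dzOp_mul_self b) (fun y => dzBarOp_anticommute_dzOp b (X 0) y), prodCoeff,
      smul_mul_assoc, mul_smul_comm, LinearMap.smul_apply, map_smul, smul_smul, smul_smul]
    simp only [mul_assoc]
    congr 1
    ring

theorem sum_coordinates (l : V) : ∑ s, inner ℂ (b s) l • b s = l := b.sum_repr' l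

theorem herm_eq_dotProduct (l l' : V) :
    herm l l' = (fun s => inner ℂ (b s) l) ⬝ᵥ fun s => conj (inner ℂ (b s) l') := by
  rw [herm, ← b.sum_inner_mul_inner, dotProduct]
  exact Finset.sum_congr rfl fun s _ => by rw [inner_conj_symm, mul_comm]

theorem prodF_eq_prodBi (g : ℕ) (l l' : Fin g → V) : prodF q g l l' =
    prodBi b q g (fun i s => inner ℂ (b s) (l i)) (fun i s => conj (inner ℂ (b s) (l' i))) := by
  rw [← prodF_coordinates]
  simp only [Complex.conj_conj, sum_coordinates]

theorem antiInt_prod_vacuum (s : Fin n) (g : ℕ) (X : Fin (g + 1) → Fin n → ℂ) :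
    antiInt (b s) (multi (dzBarOp_mul_self b) (g + 1) X vacuum) =
      ∑ i : Fin (g + 1), (-1 : ℂ) ^ (i : ℕ) • X i s •
        multi (dzBarOp_mul_self b) g (i.removeNth X) vacuum := by
  rw [← Module.End.mul_apply, mul_multi_succ (dzBarOp_mul_self b) (φ := fun x => x s)
    (antiInt_mul_dzBarOp b s)]
  simp only [LinearMap.add_apply, end_sum_apply, LinearMap.smul_apply, Module.End.mul_apply,
    antiInt_vacuum, map_zero, smul_zero, add_zero]

theorem holInt_prod_vacuum (s : Fin n) (g h : ℕ) (Y : Fin (g + 1) → Fin n → ℂ) (X : Fin h → Fin n → ℂ) :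
    holInt (b s) (multi (dzOp_mul_self b) (g + 1) Y (multi (dzBarOp_mul_self b) h X vacuum)) =
      ∑ j : Fin (g + 1), (-1 : ℂ) ^ (j : ℕ) • Y j s •
        multi (dzOp_mul_self b) g (j.removeNth Y) (multi (dzBarOp_mul_self b) h X vacuum) := by
  rw [← Module.End.mul_apply, mul_multi_succ (dzOp_mul_self b) (φ := fun x => x s)
    (holInt_mul_dzOp b s)]
  have h0 : holInt (b s) (multi (dzBarOp_mul_self b) h X vacuum) = 0 := by
    rw [← Module.End.mul_apply, mul_multi_of_anticommute (dzBarOp_mul_self b) (holInt_mul_dzBarOp b s),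
      LinearMap.smul_apply, Module.End.mul_apply, holInt_vacuum, map_zero, smul_zero]
  simp only [LinearMap.add_apply, end_sum_apply, LinearMap.smul_apply, Module.End.mul_apply,
    h0, map_zero, smul_zero, add_zero]

/-- The function `(X, Y) ↦ β (∏ f(l_i, l'_i))`. -/
def pairing {g : ℕ} (β : Alt V (2 * g) →ₗ[ℂ] ℂ) : BiAlt n g :=
  LinearMap.compAlternatingMap
    { toFun := fun f => β.compAlternatingMap f
      map_add' := fun f f' => by ext; simp
      map_smul' := fun c f => by ext; simp } (prodBi b q g)

theorem pairing_apply {g : ℕ} (β : Alt V (2 * g) →ₗ[ℂ] ℂ) (X Y : Fin g → Fin n → ℂ) :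
    pairing b q β X Y = β (prodBi b q g X Y) := rfl

theorem prodF_vectors {g : ℕ} (U : Matrix (Fin n) (Fin g) ℂ) :
    prodF q g (vectors b U) (vectors b U) =
      prodBi b q g (fun i s => U s i) (fun i s => conj (U s i)) := by
  rw [← prodF_coordinates]
  simp only [Complex.conj_conj]
  rfl

theorem pairing_diag {g : ℕ} (β : Alt V (2 * g) →ₗ[ℂ] ℂ) :
    (pairing b q β).diag = fun U => β (prodF q g (vectors b U) (vectors b U)) := by
  funext U
  rw [prodF_vectors]
  rfl

variable {q}

/-- The (0,1)-contraction passes all g + 1 factors dz and then removes some X_i, and the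
(1,0)-contraction removes some Y_j. Summing over s yields X_i · Y_j. The signs (-1)^{g+1}, the
(-1)^g of `prodCoeff` and (iq)(i/q) = -1 multiply to 1. -/
theorem adjointForm_prodBi (hq : q ≠ 0) (g : ℕ) (X Y : Fin (g + 1) → Fin n → ℂ) :
    adjointForm q b (2 * g) (prodBi b q (g + 1) X Y) = ∑ i : Fin (g + 1), ∑ j : Fin (g + 1),
      ((-1 : ℂ) ^ (i + j : ℕ) * (X i ⬝ᵥ Y j)) • prodBi b q g (i.removeNth X) (j.removeNth Y) := by
  have hqc : (q : ℂ) ≠ 0 := by exact_mod_cast hq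
  have hs : ∀ s, (holInt (b s) * antiInt (b s)) ((multi (dzOp_mul_self b) (g + 1) Y *
      multi (dzBarOp_mul_self b) (g + 1) X) vacuum) = ∑ i : Fin (g + 1), ∑ j : Fin (g + 1),
      ((-1 : ℂ) ^ (g + 1) * (-1 : ℂ) ^ (i + j : ℕ) * (X i s * Y j s)) •
        (multi (dzOp_mul_self b) g (j.removeNth Y) *
          multi (dzBarOp_mul_self b) g (i.removeNth X)) vacuum := by
    intro s
    rw [Module.End.mul_apply, Module.End.mul_apply (multi (dzOp_mul_self b) (g + 1) Y),
      ← Module.End.mul_apply (antiInt (b s)),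
      mul_multi_of_anticommute (dzOp_mul_self b) (antiInt_mul_dzOp b s), LinearMap.smul_apply,
      Module.End.mul_apply, antiInt_prod_vacuum]
    simp only [map_smul, map_sum, holInt_prod_vacuum, Finset.smul_sum, smul_smul]
    refine Finset.sum_congr rfl fun i _ => Finset.sum_congr rfl fun j _ => ?_
    rw [Module.End.mul_apply]
    congr 1
    rw [pow_add]
    ring
  rw [prodBi_apply, map_smul]
  change _ • adjointForm q b (2 * g) (component (2 * g + 2) _) = _
  rw [← component_adjOp, adjOp, LinearMap.smul_apply, end_sum_apply]
  simp only [hs, map_smul, map_sum, prodBi_apply]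
  rw [Finset.sum_comm]
  simp only [Finset.smul_sum, smul_smul]
  refine Finset.sum_congr rfl fun i _ => ?_
  rw [Finset.sum_comm]
  refine Finset.sum_congr rfl fun j _ => ?_
  rw [← Finset.sum_smul]
  congr 1
  simp only [dotProduct, Finset.mul_sum, Finset.sum_mul, prodCoeff]
  refine Finset.sum_congr rfl fun s _ => ?_
  have h1 : ((-1 : ℂ) ^ g) * (-1) ^ (g + 1) = -1 := by rw [← pow_add, Odd.neg_one_pow ⟨g, by ring⟩]
  have h2 : Complex.I * q * (Complex.I / q) = -1 := by field_simp; simp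
  linear_combination (prodCoeff q g * (-1) ^ (i + j : ℕ) * X i s * Y j s) *
    ((Complex.I * q * (Complex.I / q)) * h1 - h2)

theorem adjointForm_prodF (hq : q ≠ 0) (g : ℕ) (l l' : Fin (g + 1) → V) :
    adjointForm q b (2 * g) (prodF q (g + 1) l l') = ∑ i : Fin (g + 1), ∑ j : Fin (g + 1),
      ((-1 : ℂ) ^ (i + j : ℕ) * herm (l i) (l' j)) • prodF q g (i.removeNth l) (j.removeNth l') := by
  simp only [prodF_eq_prodBi b q, adjointForm_prodBi b hq, herm_eq_dotProduct b]
  rfl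

theorem neg_prodF_removeNth_update (b : OrthonormalBasis (Fin n) ℂ V) (g : ℕ) (l : Fin (g + 1) → V) (l' : Fin g → V) {i j : Fin (g + 1)}
    (hij : i ≠ j) : -prodF q g (i.removeNth (Function.update l j (l i))) l' =
      (-1 : ℂ) ^ (i + j : ℕ) • prodF q g (j.removeNth l) l' := by
  have h := congrArg (fun f => f fun i s => conj (inner ℂ (b s) (l' i)))
    (BiAlt.neg_map_removeNth_update (M := Fin n → ℂ)
      (N := (Fin n → ℂ) [⋀^Fin g]→ₗ[ℂ] Alt V (2 * g)) (prodBi b q g) (fun i s => inner ℂ (b s) (l i)) hij)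
  simp only [AlternatingMap.neg_apply, AlternatingMap.smul_apply] at h
  rw [prodF_eq_prodBi b q, prodF_eq_prodBi b q]
  refine Eq.trans ?_ h
  congr 3
  funext m s
  simp only [Fin.removeNth, Function.update_apply]
  split_ifs <;> rfl

theorem sum_wedgeF_basis (p : ℕ) (η : Alt V p) :
    ∑ s, wedgeF q (b s) (b s) p η = lefschetzForm q b p η := by
  simp [wedgeF, lefschetzForm, Finset.smul_sum]

/-- The expansion of δ on a product of forms f is term by term that of exterior multiplication by
the dot product. -/
theorem raise_pairing (hq : q ≠ 0) {g : ℕ} (β : Alt V (2 * g) →ₗ[ℂ] ℂ) :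
    raise (pairing b q β).diag = fun U =>
      β (adjointForm q b (2 * g) (prodF q (g + 1) (vectors b U) (vectors b U))) := by
  rw [BiAlt.raise_diag]
  funext U
  rw [prodF_vectors, adjointForm_prodBi b hq, BiAlt.diag, BiAlt.lift_apply]
  simp only [map_sum, map_smul, pairing_apply, smul_eq_mul, mul_assoc]

/-- Inserting e_s as first column on both sides multiplies the product by f(b_s), and ∑ f(b_s) = D.
-/
theorem laplace_pairing {g : ℕ} (β : Alt V (2 * (g + 1)) →ₗ[ℂ] ℂ) :
    laplace (pairing b q β).diag = fun U =>
      β (lefschetzForm q b (2 * g) (prodF q g (vectors b U) (vectors b U))) := by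
  rw [BiAlt.laplace_diag]
  funext U
  rw [BiAlt.diag, BiAlt.lower_apply, ← sum_wedgeF_basis]
  refine (Finset.sum_congr rfl fun s _ => ?_).trans (map_sum β _ _).symm
  rw [pairing_apply, ← prodF_coordinates, prodF]
  congr 2
  · simp [Pi.single_apply]
  · congr 1
    funext i
    simp [Fin.tail, vectors]

end products

/-! ### The formula for δ on the classes of cycles, and functionals on constant forms. -/

section cohomology

variable {V : Type*} [NormedAddCommGroup V] [InnerProductSpace ℂ V] [FiniteDimensional ℂ V]
  (M : Submodule ℤ V) {q : ℝ} {n : ℕ} (b : OrthonormalBasis (Fin n) ℂ V)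

/-- Up to the sign (-1)^{i+j}, the class v_{ij} is the product that omits l_j from the dz̄ factors
and l_i from the dz factors, which is the (j, i) term in the expansion of δ. -/
theorem adj_zClass (hq : q ≠ 0) (g : ℕ) (l : Fin (g + 1) → V) :
    adj M q b g (zClass M q l) = ∑ i, ∑ j, herm (l j) (l i) • vClass M q l i j := by
  have hv : ∀ i j, ((vClass M q l i j : harmonicForms M g) : V → Alt V (2 * g)) =
      fun _ => (-1 : ℂ) ^ (i + j : ℕ) • prodF q g (j.removeNth l) (i.removeNth l) := by
    intro i j
    funext x
    change (if i = j then (1 : ℂ) else -1) •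
      prodF q g (i.removeNth (Function.update l j (l i))) (i.removeNth l) = _
    split_ifs with h
    · subst h
      rw [Even.neg_one_pow ⟨(i : ℕ), rfl⟩, Function.update_eq_self]
    · rw [← neg_prodF_removeNth_update b g l _ h]
      exact neg_one_smul ℂ (prodF q g _ _)
  ext1
  simp only [Submodule.coe_sum, Submodule.coe_smul, hv]
  funext x
  change adjointForm q b (2 * g) (prodF q (g + 1) l l) = _
  rw [adjointForm_prodF b hq, Finset.sum_comm]
  simp only [Finset.sum_apply, Pi.smul_apply, smul_smul]
  refine Finset.sum_congr rfl fun i _ => Finset.sum_congr rfl fun j _ => ?_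
  congr 1
  rw [mul_comm, add_comm (i : ℕ)]

/-- A functional on harmonic forms comes from a functional on constant forms, as far as translation
invariant forms are concerned. -/
theorem exists_functional {g : ℕ} (α : Module.Dual ℂ (harmonicForms M g)) :
    ∃ β : Alt V (2 * g) →ₗ[ℂ] ℂ, ∀ η h, α (constForm M η h) = β η := by
  let S : Submodule ℂ (Alt V (2 * g)) :=
    { carrier := {η | IsTypeGG g η}
      add_mem' := fun h h' => h.add h'
      zero_mem' := IsTypeGG.zero
      smul_mem' := fun c _ h => h.smul c }
  obtain ⟨β, hβ⟩ := LinearMap.exists_extend (p := S) (α ∘ₗ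
    { toFun := fun η => constForm M η.1 η.2
      map_add' := fun _ _ => rfl
      map_smul' := fun _ _ => rfl })
  exact ⟨β, fun η h => (LinearMap.congr_fun hβ ⟨η, h⟩).symm⟩

end cohomology

/-! ### The commutator of δ and L in a fixed degree. -/

section lefschetzRepresentation

variable {V : Type*} [NormedAddCommGroup V] [InnerProductSpace ℂ V] {q : ℝ} {n : ℕ}
  (b : OrthonormalBasis (Fin n) ℂ V)

theorem exists_component_eq (p : ℕ) (w : Alt V p) : ∃ η : Fock V, component p η = w :=
  ⟨(Pi.single p w : (p : ℕ) → Alt V p), Pi.single_eq_same p w⟩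

theorem component_adjOp_lefOp (hq : q ≠ 0) (p : ℕ) (η : Fock V) :
    component p (adjOp b q (lefOp b q η)) =
      component p (lefOp b q (adjOp b q η)) + ((n : ℂ) - p) • component p η := by
  have h := congrArg (fun T => component p (T η)) (adjOp_mul_lefOp b q hq)
  simp only [LinearMap.sub_apply, LinearMap.smul_apply, Module.End.mul_apply, Module.End.one_apply,
    map_sub, map_smul, component_numOp] at h
  rw [sub_eq_iff_eq_add'] at h
  exact h.trans (congrArg _ (sub_smul (n : ℂ) (p : ℂ) (component p η)).symm)

theorem adjointForm_lefschetzForm_zero (hq : q ≠ 0) (w : Alt V 0) :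
    adjointForm q b 0 (lefschetzForm q b 0 w) = (n : ℂ) • w := by
  obtain ⟨η, rfl⟩ := exists_component_eq 0 w
  have h0 : ∀ ξ, component 0 (lefOp b q ξ) = 0 := fun ξ => by
    rw [lefOp, LinearMap.smul_apply, end_sum_apply, map_smul, map_sum]
    simp [extOp_zero]
  rw [← component_lefOp, ← component_adjOp, component_adjOp_lefOp b hq, h0, zero_add]
  simp

theorem adjointForm_lefschetzForm (hq : q ≠ 0) (p : ℕ) (w : Alt V (p + 2)) :
    adjointForm q b (p + 2) (lefschetzForm q b (p + 2) w) =
      lefschetzForm q b p (adjointForm q b p w) + ((n : ℂ) - (p + 2 : ℕ)) • w := by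
  obtain ⟨η, rfl⟩ := exists_component_eq (p + 2) w
  rw [← component_lefOp, ← component_adjOp, component_adjOp_lefOp b hq, component_lefOp, component_adjOp]

end lefschetzRepresentation

/-! ### The two representations and the equivariance of u. -/

section representations

variable {V : Type*} [NormedAddCommGroup V] [InnerProductSpace ℂ V] [FiniteDimensional ℂ V]
  (M : Submodule ℤ V) {q : ℝ} {n : ℕ} (b : OrthonormalBasis (Fin n) ℂ V)

theorem adj_lef_zero (hq : q ≠ 0) (φ : harmonicForms M 0) :
    adj M q b 0 (lef M q b 0 φ) = (n : ℂ) • φ := by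
  ext1
  funext x
  exact adjointForm_lefschetzForm_zero b hq (φ.1 x)

theorem adj_lef_succ (hq : q ≠ 0) (g : ℕ) (φ : harmonicForms M (g + 1)) :
    adj M q b (g + 1) (lef M q b (g + 1) φ) =
      lef M q b g (adj M q b g φ) + ((n : ℂ) - 2 * ((g + 1 : ℕ) : ℂ)) • φ := by
  ext1
  funext x
  have h := adjointForm_lefschetzForm b hq (2 * g) (φ.1 x)
  have h2 : ((n : ℂ) - 2 * ((g + 1 : ℕ) : ℂ)) = (n : ℂ) - ((2 * g + 2 : ℕ) : ℂ) := by push_cast; ring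
  rw [h2]
  exact h

/-- `δ^*` as an endomorphism of `H_{•,•}`. -/
def adjDualEnd (q : ℝ) : Module.End ℂ (Homology M) where
  toFun := adjDual M q b
  map_add' α α' := by
    funext g
    obtain _ | g := g
    · exact (add_zero (0 : Module.Dual ℂ (harmonicForms M 0))).symm
    · rfl
  map_smul' c α := by
    funext g
    obtain _ | g := g
    · exact (smul_zero (A := Module.Dual ℂ (harmonicForms M 0)) c).symm
    · rfl

/-- `L^*` as an endomorphism of `H_{•,•}`. -/
def lefDualEnd (q : ℝ) : Module.End ℂ (Homology M) where
  toFun := lefDual M q b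
  map_add' _ _ := rfl
  map_smul' _ _ := rfl

/-- The weight as an endomorphism of `H_{•,•}`. -/
def weightDualEnd (n : ℕ) : Module.End ℂ (Homology M) where
  toFun := weightDual M n
  map_add' α α' := by
    funext g
    exact smul_add (2 * (g : ℂ) - (n : ℂ)) (α g) (α' g)
  map_smul' c α := by
    funext g
    exact smul_comm (2 * (g : ℂ) - (n : ℂ)) c (α g)

theorem adjDualEnd_mul_lefDualEnd_sub (hq : q ≠ 0) :
    adjDualEnd M b q * lefDualEnd M b q - lefDualEnd M b q * adjDualEnd M b q = weightDualEnd M n := by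
  refine LinearMap.ext fun α => funext fun g => LinearMap.ext fun φ => ?_
  obtain _ | g := g
  · change (0 : ℂ) - α 0 (adj M q b 0 (lef M q b 0 φ)) = (2 * ((0 : ℕ) : ℂ) - n) * α 0 φ
    rw [adj_lef_zero M b hq, map_smul, smul_eq_mul]
    push_cast
    ring
  · change α (g + 1) (lef M q b g (adj M q b g φ)) -
      α (g + 1) (adj M q b (g + 1) (lef M q b (g + 1) φ)) = (2 * ((g + 1 : ℕ) : ℂ) - n) * α (g + 1) φ
    rw [adj_lef_succ M b hq, map_add, map_smul, smul_eq_mul]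
    ring

theorem weightDualEnd_mul_adjDualEnd_sub :
    weightDualEnd M n * adjDualEnd M b q - adjDualEnd M b q * weightDualEnd M n =
      (2 : ℂ) • adjDualEnd M b q := by
  refine LinearMap.ext fun α => funext fun g => LinearMap.ext fun φ => ?_
  obtain _ | g := g
  · change (2 * ((0 : ℕ) : ℂ) - n) * (0 : ℂ) - 0 = 2 * 0
    ring
  · change (2 * ((g + 1 : ℕ) : ℂ) - n) * α g (adj M q b g φ) -
      (2 * (g : ℂ) - n) * α g (adj M q b g φ) = 2 * α g (adj M q b g φ)
    push_cast
    ring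

theorem weightDualEnd_mul_lefDualEnd_sub :
    weightDualEnd M n * lefDualEnd M b q - lefDualEnd M b q * weightDualEnd M n =
      (-2 : ℂ) • lefDualEnd M b q := by
  refine LinearMap.ext fun α => funext fun g => LinearMap.ext fun φ => ?_
  change (2 * (g : ℂ) - n) * α (g + 1) (lef M q b g φ) -
    (2 * ((g + 1 : ℕ) : ℂ) - n) * α (g + 1) (lef M q b g φ) = -2 * α (g + 1) (lef M q b g φ)
  push_cast
  ring

/-- The representation `(δ^*, L^*, 2g - n)` of `sl₂(ℂ)`. -/
def homologyRep (hq : q ≠ 0) :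
    LieAlgebra.SpecialLinear.sl (Fin 2) ℂ →ₗ⁅ℂ⁆ Module.End ℂ (Homology M) :=
  sl2Rep (adjDualEnd M b q) (lefDualEnd M b q) (weightDualEnd M n)
    (adjDualEnd_mul_lefDualEnd_sub M b hq) (weightDualEnd_mul_adjDualEnd_sub M b)
    (weightDualEnd_mul_lefDualEnd_sub M b)

/-- The representation `(Λ, Δ, H)` of `sl₂(ℂ)`. -/
def polyRep (n : ℕ) : LieAlgebra.SpecialLinear.sl (Fin 2) ℂ →ₗ⁅ℂ⁆ Module.End ℂ (polyTot n) :=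
  sl2Rep (raiseEnd n) (laplaceEnd n) (degreeEnd n) raiseEnd_mul_laplaceEnd_sub
    degreeEnd_mul_raiseEnd_sub degreeEnd_mul_laplaceEnd_sub

/-- The functions `U ↦ Z(λ_1, …, λ_g) · α`. -/
def cycleFamily (q : ℝ) (α : Homology M) : Family n := fun g U => α g (zClass M q (vectors b U))

theorem cycleFamily_eq_diag (α : Homology M) {g : ℕ} {β : Alt V (2 * g) →ₗ[ℂ] ℂ}
    (hβ : ∀ η h, α g (constForm M η h) = β η) : cycleFamily M b q α g = (pairing b q β).diag := by
  rw [pairing_diag]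
  funext U
  exact hβ _ _

/-- The map `u : H_{•,•} → F_{n,•}`. -/
def cycleMap (q : ℝ) : Homology M →ₗ[ℂ] polyTot n where
  toFun α := ⟨cycleFamily M b q α, fun g => by
    obtain ⟨β, hβ⟩ := exists_functional M (α g)
    rw [cycleFamily_eq_diag M b α hβ]
    exact BiAlt.diag_mem _⟩
  map_add' _ _ := rfl
  map_smul' _ _ := rfl

theorem cycleMap_adjDual (hq : q ≠ 0) (α : Homology M) :
    cycleMap M b q (adjDualEnd M b q α) = raiseEnd n (cycleMap M b q α) := by
  ext1
  change cycleFamily M b q (adjDual M q b α) = raiseTot (cycleFamily M b q α)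
  funext g
  obtain _ | g := g
  · rfl
  · obtain ⟨β, hβ⟩ := exists_functional M (α g)
    rw [raiseTot, cycleFamily_eq_diag M b α hβ, raise_pairing b hq]
    funext U
    exact hβ _ ((isTypeGG_prodF q (g + 1) _ _).adjointForm q b)

theorem cycleMap_lefDual (α : Homology M) :
    cycleMap M b q (lefDualEnd M b q α) = laplaceEnd n (cycleMap M b q α) := by
  ext1
  change cycleFamily M b q (lefDual M q b α) = laplaceTot (cycleFamily M b q α)
  funext g
  obtain ⟨β, hβ⟩ := exists_functional M (α (g + 1))
  rw [laplaceTot, cycleFamily_eq_diag M b α hβ, laplace_pairing b]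
  funext U
  exact hβ _ ((isTypeGG_prodF q g _ _).lefschetzForm q b)

theorem cycleMap_weightDual (α : Homology M) :
    cycleMap M b q (weightDualEnd M n α) = degreeEnd n (cycleMap M b q α) := by
  ext1
  change cycleFamily M b q (weightDual M n α) = degreeTot ((cycleMap M b q α : polyTot n) : Family n)
  rw [degreeTot_apply]
  rfl

theorem cycleMap_equivariant (hq : q ≠ 0) (X : LieAlgebra.SpecialLinear.sl (Fin 2) ℂ) (α : Homology M) :
    cycleMap M b q (homologyRep M b hq X α) = polyRep n X (cycleMap M b q α) := by
  simp only [homologyRep, polyRep, sl2Rep_apply, LinearMap.add_apply, LinearMap.smul_apply, map_add,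
    map_smul, cycleMap_adjDual M b hq, cycleMap_lefDual, cycleMap_weightDual]

end representations

/-! ### Values on the standard generators. -/

section sl2generators

variable {A : Type*} [AddCommGroup A] [Module ℂ A] (e f h : Module.End ℂ A) (hef hhe hhf)

theorem sl2Rep_slE : sl2Rep e f h hef hhe hhf slE = e := by
  simp [slE]

theorem sl2Rep_slF : sl2Rep e f h hef hhe hhf slF = f := by
  simp [slF]

theorem sl2Rep_slH : sl2Rep e f h hef hhe hhf slH = h := by
  simp [slH]

end sl2generators

/-! ### Formal Lefschetz decomposition with rational scalars. -/

section lefschetzDecomposition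

variable {A : Type*} [AddCommGroup A] [Module ℂ A]

/-- A raising operator `E` and a lowering operator `F` acting on graded pieces `D g`, with
`F E - E F = n - 2g` on `D g`. -/
structure LefschetzData (n : ℕ) (E F : Module.End ℂ A) (D : ℕ → AddSubgroup A) : Prop where
  smul_mem : ∀ {g : ℕ} (r : ℚ) {x : A}, x ∈ D g → (r : ℂ) • x ∈ D g
  raise_mem : ∀ {g : ℕ} {x : A}, x ∈ D g → E x ∈ D (g + 1)
  lower_mem : ∀ {g : ℕ} {x : A}, x ∈ D (g + 1) → F x ∈ D g
  lower_zero : ∀ {x : A}, x ∈ D 0 → F x = 0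
  lower_raise : ∀ {g : ℕ} {x : A}, x ∈ D g → F (E x) = E (F x) + ((n : ℂ) - 2 * g) • x
  eq_zero : ∀ {g : ℕ} {x : A}, n < g → x ∈ D g → x = 0

/-- The elements obtained from primitive ones by raising. -/
def raisedPrim (E F : Module.End ℂ A) (D : ℕ → AddSubgroup A) (g : ℕ) : Set A :=
  {y | ∃ ℓ k : ℕ, ℓ + k = g ∧ ∃ p ∈ D ℓ, F p = 0 ∧ y = E^[k] p}

namespace LefschetzData

variable {n : ℕ} {E F : Module.End ℂ A} {D : ℕ → AddSubgroup A} (h : LefschetzData n E F D)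

include h

theorem iterate_mem {g : ℕ} {x : A} (hx : x ∈ D g) (k : ℕ) : E^[k] x ∈ D (g + k) := by
  induction k with
  | zero => exact hx
  | succ k ih =>
    rw [Function.iterate_succ_apply']
    exact h.raise_mem ih

/-- The scalar is the sum of the weights n - 2(g + j) for j = 0, …, k, one for each commutation of F
with E. -/
theorem lower_iterate {g : ℕ} {x : A} (hx : x ∈ D g) (k : ℕ) :
    F (E^[k + 1] x) = E^[k + 1] (F x) + (((k : ℂ) + 1) * ((n : ℂ) - 2 * g - k)) • E^[k] x := by
  induction k with
  | zero => simpa using h.lower_raise hx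
  | succ k ih =>
    rw [Function.iterate_succ_apply' _ (k + 1) x, h.lower_raise (h.iterate_mem hx (k + 1)), ih, map_add,
      map_smul, Function.iterate_succ_apply' _ (k + 1), Function.iterate_succ_apply' _ k x, add_assoc,
      ← add_smul]
    congr 2
    push_cast
    ring

theorem lower_iterate_prim {g : ℕ} {x : A} (hx : x ∈ D g) (hF : F x = 0) (k : ℕ) :
    F (E^[k + 1] x) = (((k : ℂ) + 1) * ((n : ℂ) - 2 * g - k)) • E^[k] x := by
  rw [h.lower_iterate hx, hF, Function.iterate_fixed (map_zero E), zero_add]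

/-- E^{n+1} x vanishes because its degree exceeds n. Applying F removes one E at a time, as the
scalar (k+1)(n - 2g - k) is never 0 when n < 2g. -/
theorem prim_eq_zero {g : ℕ} {x : A} (hx : x ∈ D g) (hF : F x = 0) (hg : n < 2 * g) : x = 0 := by
  have key : ∀ k, E^[k] x = 0 → x = 0 := by
    intro k
    induction k with
    | zero => exact id
    | succ k ih =>
      intro hk
      refine ih ?_
      have h1 := h.lower_iterate_prim hx hF k
      rw [hk, map_zero] at h1
      refine (smul_eq_zero.mp h1.symm).resolve_left (mul_ne_zero ?_ ?_)
      · exact_mod_cast k.succ_ne_zero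
      · intro h0
        have : (n : ℂ) = ((2 * g + k : ℕ) : ℂ) := by push_cast; linear_combination h0
        have : n = 2 * g + k := by exact_mod_cast this
        omega
  exact key (n + 1) (h.eq_zero (by omega) (h.iterate_mem hx (n + 1)))

/-- Induction on the order k with E^k x = 0. If E^{k+1} x = 0, then applying F gives E^{k+1} F x + c
E^k x = 0, so x + c⁻¹ E F x is killed by E^k and differs from x by an element of the image of E. The
scalar c is rational and nonzero above the middle degree. -/
theorem exists_raise_eq {g : ℕ} {x : A} (hx : x ∈ D (g + 1)) (hg : n < 2 * (g + 1)) :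
    ∃ z ∈ D g, x = E z := by
  have key : ∀ k, ∀ x ∈ D (g + 1), E^[k] x = 0 → ∃ z ∈ D g, x = E z := by
    intro k
    induction k with
    | zero => exact fun x _ hk => ⟨0, (D g).zero_mem, by rw [map_zero]; exact hk⟩
    | succ k ih =>
      intro x hx hk
      have h1 := h.lower_iterate hx k
      rw [hk, map_zero] at h1
      set c : ℚ := ((k : ℚ) + 1) * ((n : ℚ) - 2 * ((g + 1 : ℕ) : ℚ) - k) with hc
      have hc0 : c ≠ 0 := by
        refine mul_ne_zero (by positivity) fun h0 => ?_
        have : (n : ℚ) = ((2 * (g + 1) + k : ℕ) : ℚ) := by push_cast at h0 ⊢; linear_combination h0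
        have : n = 2 * (g + 1) + k := by exact_mod_cast this
        omega
      have hcc : ((k : ℂ) + 1) * ((n : ℂ) - 2 * ((g + 1 : ℕ) : ℂ) - k) = (c : ℂ) := by
        rw [hc]; push_cast; ring
      have hc0' : (c : ℂ) ≠ 0 := by exact_mod_cast hc0
      rw [hcc] at h1
      obtain ⟨z, hz, hxz⟩ := ih (x + ((c⁻¹ : ℚ) : ℂ) • E (F x))
        ((D (g + 1)).add_mem hx (h.smul_mem _ (h.raise_mem (h.lower_mem hx)))) (by
          rw [iterate_map_add, ← Module.End.pow_apply, ← Module.End.pow_apply, map_smul,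
            Module.End.pow_apply, Module.End.pow_apply, ← Function.iterate_succ_apply,
            ← eq_neg_of_add_eq_zero_left h1.symm |>.symm, smul_neg, smul_smul]
          push_cast
          rw [inv_mul_cancel₀ hc0', one_smul, add_neg_cancel])
      refine ⟨z - ((c⁻¹ : ℚ) : ℂ) • F x, (D g).sub_mem hz (h.smul_mem _ (h.lower_mem hx)), ?_⟩
      rw [map_sub, map_smul, ← hxz, add_sub_cancel_right]
  exact key (n + 1) x hx (h.eq_zero (by omega) (h.iterate_mem hx (n + 1)))

/-- Above the middle every element is raised from the degree below. Otherwise F E maps each raised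
primitive element of degree g to a nonzero rational multiple of itself, so F E z = F x is solvable
and x - E z is primitive. Since only rational scalars occur, the decomposition respects a rational
structure. -/
theorem mem_closure {g : ℕ} {x : A} (hx : x ∈ D g) :
    x ∈ AddSubgroup.closure (raisedPrim E F D g) := by
  induction g generalizing x with
  | zero => exact AddSubgroup.subset_closure ⟨0, 0, rfl, x, hx, h.lower_zero hx, rfl⟩
  | succ g ih =>
    have hraise : ∀ z ∈ AddSubgroup.closure (raisedPrim E F D g),
        E z ∈ AddSubgroup.closure (raisedPrim E F D (g + 1)) := by
      intro z hz
      induction hz using AddSubgroup.closure_induction with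
      | mem z hz =>
        obtain ⟨ℓ, k, hg, p, hp, hFp, rfl⟩ := hz
        exact AddSubgroup.subset_closure ⟨ℓ, k + 1, by omega, p, hp, hFp,
          (Function.iterate_succ_apply' _ _ _).symm⟩
      | zero => rw [map_zero]; exact AddSubgroup.zero_mem _
      | add y z _ _ hy hz => rw [map_add]; exact AddSubgroup.add_mem _ hy hz
      | neg y _ hy => rw [map_neg]; exact AddSubgroup.neg_mem _ hy
    by_cases hg : n < 2 * (g + 1)
    · obtain ⟨z, hz, rfl⟩ := h.exists_raise_eq hx hg
      exact hraise z (ih hz)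
    · have hsurj : ∀ y ∈ AddSubgroup.closure (raisedPrim E F D g), ∃ z ∈ D g, F (E z) = y := by
        intro y hy
        induction hy using AddSubgroup.closure_induction with
        | mem y hy =>
          obtain ⟨ℓ, k, hlk, p, hp, hFp, rfl⟩ := hy
          set c : ℚ := ((k : ℚ) + 1) * ((n : ℚ) - 2 * ℓ - k) with hc
          have hc0 : c ≠ 0 := by
            refine mul_ne_zero (by positivity) fun h0 => ?_
            have : (n : ℚ) = ((2 * ℓ + k : ℕ) : ℚ) := by push_cast; linear_combination h0
            have : n = 2 * ℓ + k := by exact_mod_cast this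
            omega
          have hcc : ((k : ℂ) + 1) * ((n : ℂ) - 2 * ℓ - k) = (c : ℂ) := by
            rw [hc]; push_cast; ring
          have hc0' : (c : ℂ) ≠ 0 := by exact_mod_cast hc0
          refine ⟨((c⁻¹ : ℚ) : ℂ) • E^[k] p, h.smul_mem _ (hlk ▸ h.iterate_mem hp k), ?_⟩
          rw [map_smul, map_smul, ← Function.iterate_succ_apply' E, h.lower_iterate_prim hp hFp, hcc,
            smul_smul]
          push_cast
          rw [inv_mul_cancel₀ hc0', one_smul]
        | zero => exact ⟨0, (D g).zero_mem, by simp⟩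
        | add y y' _ _ hy hy' =>
          obtain ⟨z, hz, rfl⟩ := hy
          obtain ⟨z', hz', rfl⟩ := hy'
          exact ⟨z + z', (D g).add_mem hz hz', by simp⟩
        | neg y _ hy =>
          obtain ⟨z, hz, rfl⟩ := hy
          exact ⟨-z, (D g).neg_mem hz, by simp⟩
      obtain ⟨z, hz, hzx⟩ := hsurj (F x) (ih (h.lower_mem hx))
      rw [← sub_add_cancel x (E z)]
      refine AddSubgroup.add_mem _ (AddSubgroup.subset_closure ⟨g + 1, 0, rfl, x - E z,
        (D (g + 1)).sub_mem hx (h.raise_mem hz), ?_, rfl⟩) (hraise z (ih hz))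
      rw [map_sub, hzx, sub_self]

theorem iterate_lower_iterate {ℓ : ℕ} {p : A} (hp : p ∈ D ℓ) (hF : F p = 0) (s t : ℕ) :
    F^[s] (E^[s + t] p) =
      (∏ i ∈ Finset.range s, (((t + i : ℕ) : ℂ) + 1) * ((n : ℂ) - 2 * ℓ - ((t + i : ℕ) : ℂ))) • E^[t] p := by
  induction s with
  | zero => simp
  | succ s ih =>
    rw [Function.iterate_succ_apply, show s + 1 + t = (t + s) + 1 by ring, h.lower_iterate_prim hp hF,
      ← Module.End.pow_apply F, map_smul, Module.End.pow_apply, add_comm t s, ih, smul_smul,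
      Finset.prod_range_succ, mul_comm, add_comm s t]

theorem iterate_lower_iterate_of_lt {ℓ : ℕ} {p : A} (hp : p ∈ D ℓ) (hF : F p = 0) {s r : ℕ} (hsr : r < s) :
    F^[s] (E^[r] p) = 0 := by
  obtain ⟨d, rfl⟩ := Nat.exists_eq_add_of_lt hsr
  rw [show r + d + 1 = d + 1 + r by ring, Function.iterate_add_apply]
  have := h.iterate_lower_iterate hp hF r 0
  rw [add_zero] at this
  rw [this, Function.iterate_succ_apply, map_smul, Function.iterate_zero_apply, hF, smul_zero,
    Function.iterate_fixed (map_zero F)]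

/-- A vanishing factor means n = 2ℓ + i for some i < s. Then E^{i+1} p is primitive of degree above
n/2, hence zero. -/
theorem iterate_eq_zero {ℓ : ℕ} {p : A} (hp : p ∈ D ℓ) (hF : F p = 0) {s : ℕ}
    (hs : ∏ i ∈ Finset.range s, (((0 + i : ℕ) : ℂ) + 1) * ((n : ℂ) - 2 * ℓ - ((0 + i : ℕ) : ℂ)) = 0) :
    E^[s] p = 0 := by
  obtain ⟨i, hi, h0⟩ := Finset.prod_eq_zero_iff.mp hs
  rw [zero_add] at h0
  have hin := (mul_eq_zero.mp h0).resolve_left (by exact_mod_cast i.succ_ne_zero)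
  have hin' : n = 2 * ℓ + i := by
    have : (n : ℂ) = ((2 * ℓ + i : ℕ) : ℂ) := by push_cast; linear_combination hin
    exact_mod_cast this
  have h1 : E^[i + 1] p = 0 := by
    refine h.prim_eq_zero (h.iterate_mem hp (i + 1)) ?_ (by omega)
    rw [h.lower_iterate_prim hp hF, h0, zero_smul]
  obtain ⟨d, rfl⟩ := Nat.exists_eq_add_of_le (Finset.mem_range.mp hi : i + 1 ≤ s)
  rw [add_comm, Function.iterate_add_apply, h1, Function.iterate_fixed (map_zero E)]

/-- A formal substitute for the positivity of E F. Applying F to the equation yields one of the same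
shape for F w, one degree lower, with t replaced by t / (1 + t(n - 2m)) > 0, where m is the degree
of F w. The induction ends in degree 0, where F is zero. -/
theorem eq_zero_of_eq_neg {m : ℕ} {w : A} (hw : w ∈ D m) (hm : 2 * m ≤ n) {t : ℝ} (ht : 0 < t)
    (hwt : w = -((t : ℂ) • E (F w))) : w = 0 := by
  induction m generalizing w t with
  | zero => rw [hwt, h.lower_zero hw, map_zero, smul_zero, neg_zero]
  | succ m ih =>
    have hFw := h.lower_mem hw
    have hn : (0 : ℝ) ≤ (n : ℝ) - 2 * m := by
      have : ((2 * (m + 1) : ℕ) : ℝ) ≤ n := by exact_mod_cast hm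
      push_cast at this
      linarith
    set a : ℝ := 1 + t * ((n : ℝ) - 2 * m) with ha
    have ha0 : 0 < a := by positivity
    have hac : (a : ℂ) ≠ 0 := by exact_mod_cast ha0.ne'
    have h1 : F w = -((t : ℂ) • (E (F (F w)) + ((n : ℂ) - 2 * m) • F w)) := by
      conv_lhs => rw [hwt, map_neg, map_smul, h.lower_raise hFw]
    have h2 : (a : ℂ) • F w = -((t : ℂ) • E (F (F w))) := by
      have : (a : ℂ) • F w = F w + (t : ℂ) • ((n : ℂ) - 2 * m) • F w := by
        rw [ha]; push_cast; module
      rw [this]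
      nth_rewrite 1 [h1]
      module
    have h3 : F w = 0 := by
      refine ih hFw (by omega) (t := t / a) (by positivity) ?_
      have h4 := congrArg (fun y => (a : ℂ)⁻¹ • y) h2
      simp only [smul_smul, inv_mul_cancel₀ hac, one_smul, smul_neg] at h4
      conv_lhs => rw [h4]
      congr 2
      push_cast
      field_simp
    rw [hwt, h3, map_zero, smul_zero, neg_zero]

/-- If F E y = 0, the commutator relation gives E F y = -(n - 2m) y. Below the middle this is the
equation of `eq_zero_of_eq_neg` with t = 1/(n - 2m), and above it there are no primitive elements.
-/
theorem prim_raise_eq_zero {m : ℕ} {y : A} (hy : y ∈ D m) (hF : F (E y) = 0) : E y = 0 := by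
  by_cases hm : n < 2 * (m + 1)
  · exact h.prim_eq_zero (h.raise_mem hy) hF hm
  · have hpos : (0 : ℝ) < (n : ℝ) - 2 * m := by
      have : ((2 * (m + 1) : ℕ) : ℝ) ≤ n := by exact_mod_cast not_lt.mp hm
      push_cast at this
      linarith
    have hne : ((n : ℂ) - 2 * m) ≠ 0 := by
      have := hpos.ne'
      exact_mod_cast this
    have h1 := h.lower_raise hy
    rw [hF] at h1
    have h2 := h.eq_zero_of_eq_neg hy (by omega) (inv_pos.mpr hpos) (by
      have h3 := congrArg (fun z => ((n : ℂ) - 2 * m)⁻¹ • z) (eq_neg_of_add_eq_zero_right h1.symm)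
      simp only [smul_smul, inv_mul_cancel₀ hne, one_smul, smul_neg] at h3
      conv_lhs => rw [h3]
      push_cast
      rfl)
    rw [h2, map_zero]

end LefschetzData

end lefschetzDecomposition

/-! ### Independence of the summands through the eigenvalues of L δ. -/

section independence

theorem iSupIndep_of_apply_eq_smul {A ι : Type*} [AddCommGroup A] [Module ℂ A] (T : Module.End ℂ A)
    (N : ι → Submodule ℂ A) {μ : ι → ℂ} (hμ : Function.Injective μ)
    (hN : ∀ i, ∀ x ∈ N i, T x = μ i • x) : iSupIndep N :=
  (T.eigenspaces_iSupIndep.comp hμ).mono fun i x hx => Module.End.mem_eigenspace_iff.mpr (hN i x hx)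

variable {V : Type*} [NormedAddCommGroup V] [InnerProductSpace ℂ V] [FiniteDimensional ℂ V]
  (M : Submodule ℤ V) {q : ℝ} {n : ℕ} (b : OrthonormalBasis (Fin n) ℂ V)

/-- The classes of degree `g`. -/
def pureDegree (g : ℕ) : AddSubgroup (Cohomology M) where
  carrier := {W | ∀ j, j ≠ g → W j = 0}
  add_mem' := fun h h' j hj => by rw [Pi.add_apply, h j hj, h' j hj, add_zero]
  zero_mem' := fun _ _ => rfl
  neg_mem' := fun h j hj =>
    Subtype.ext ((congrArg (fun φ => -Subtype.val φ) (h j hj)).trans neg_zero)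

variable {M}

theorem mem_pureDegree {g : ℕ} {W : Cohomology M} : W ∈ pureDegree M g ↔ ∀ j, j ≠ g → W j = 0 :=
  Iff.rfl

theorem apply_eq_zero {g j : ℕ} {W : Cohomology M} (h : W ∈ pureDegree M g) (hj : j ≠ g) : W j = 0 :=
  mem_pureDegree.mp h j hj

theorem lefTot_succ (q : ℝ) (W : Cohomology M) (g : ℕ) : lefTot M q b W (g + 1) = lef M q b g (W g) := rfl

theorem lefTot_zero (q : ℝ) (W : Cohomology M) : lefTot M q b W 0 = 0 := rfl

theorem adjTot_apply (q : ℝ) (W : Cohomology M) (g : ℕ) : adjTot M q b W g = adj M q b g (W (g + 1)) := rfl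

theorem lefTot_mem (q : ℝ) {g : ℕ} {W : Cohomology M} (hW : W ∈ pureDegree M g) :
    lefTot M q b W ∈ pureDegree M (g + 1) := by
  refine mem_pureDegree.mpr ?_
  rintro (_ | j) hj
  · rfl
  · rw [lefTot_succ, apply_eq_zero hW (by omega), map_zero]

theorem adjTot_mem (q : ℝ) {g : ℕ} {W : Cohomology M} (hW : W ∈ pureDegree M (g + 1)) :
    adjTot M q b W ∈ pureDegree M g := mem_pureDegree.mpr fun j hj => by
  rw [adjTot_apply, apply_eq_zero hW (by omega), map_zero]

theorem adjTot_eq_zero (q : ℝ) {W : Cohomology M} (hW : W ∈ pureDegree M 0) : adjTot M q b W = 0 := by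
  funext j
  rw [adjTot_apply, apply_eq_zero hW (by omega), map_zero]
  rfl

theorem adjTot_lefTot (hq : q ≠ 0) {g : ℕ} {W : Cohomology M} (hW : W ∈ pureDegree M g) :
    adjTot M q b (lefTot M q b W) = lefTot M q b (adjTot M q b W) + ((n : ℂ) - 2 * g) • W := by
  funext j
  rw [Pi.add_apply, Pi.smul_apply, adjTot_apply, lefTot_succ]
  by_cases hj : j = g
  · subst hj
    obtain _ | j := j
    · refine (adj_lef_zero M b hq (W 0)).trans ?_
      simp [lefTot_zero]
    · rw [lefTot_succ, adjTot_apply, adj_lef_succ M b hq]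
  · rw [apply_eq_zero hW hj, map_zero, map_zero, smul_zero, add_zero]
    obtain _ | j := j
    · rfl
    · rw [lefTot_succ, adjTot_apply, apply_eq_zero hW (by omega), map_zero, map_zero]

theorem pureDegree_eq_zero {g : ℕ} {W : Cohomology M} (b : OrthonormalBasis (Fin n) ℂ V) (hg : n < g)
    (hW : W ∈ pureDegree M g) : W = 0 := by
  funext j
  by_cases hj : j = g
  · subst hj
    exact Subtype.ext ((Submodule.mem_bot ℂ).mp (harmonicForms_eq_bot M b hg ▸ (W j).2))
  · exact apply_eq_zero hW hj

variable (M)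

theorem lefschetzData_pureDegree (hq : q ≠ 0) :
    LefschetzData (A := Cohomology M) n (lefTot M q b) (adjTot M q b) (pureDegree M) where
  smul_mem r _ hW := mem_pureDegree.mpr fun j hj => by rw [Pi.smul_apply, apply_eq_zero hW hj, smul_zero]
  raise_mem := lefTot_mem b q
  lower_mem := adjTot_mem b q
  lower_zero := adjTot_eq_zero b q
  lower_raise := adjTot_lefTot b hq
  eq_zero := pureDegree_eq_zero b

/-- The class of degree `g` with a given component. -/
def inDegree (g : ℕ) : harmonicForms M g →ₗ[ℂ] Cohomology M :=
  LinearMap.single ℂ (fun g => harmonicForms M g) g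

variable {M}

theorem inDegree_same (g : ℕ) (φ : harmonicForms M g) : inDegree M g φ g = φ :=
  Pi.single_eq_same (M := fun g => harmonicForms M g) g φ

theorem inDegree_mem (g : ℕ) (φ : harmonicForms M g) : inDegree M g φ ∈ pureDegree M g :=
  mem_pureDegree.mpr fun _ hj => Pi.single_eq_of_ne (M := fun g => harmonicForms M g) hj φ

theorem inDegree_apply_of_mem {g : ℕ} {W : Cohomology M} (hW : W ∈ pureDegree M g) :
    inDegree M g (W g) = W := by
  funext j
  by_cases hj : j = g
  · subst hj; exact inDegree_same j _
  · rw [apply_eq_zero (inDegree_mem g _) hj, apply_eq_zero hW hj]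

theorem lefTot_inDegree (q : ℝ) (g : ℕ) (φ : harmonicForms M g) :
    lefTot M q b (inDegree M g φ) = inDegree M (g + 1) (lef M q b g φ) := by
  rw [← inDegree_apply_of_mem (lefTot_mem b q (inDegree_mem g φ)), lefTot_succ, inDegree_same]

theorem adjTot_inDegree (q : ℝ) (g : ℕ) (φ : harmonicForms M (g + 1)) :
    adjTot M q b (inDegree M (g + 1) φ) = inDegree M g (adj M q b g φ) := by
  rw [← inDegree_apply_of_mem (adjTot_mem b q (inDegree_mem (g + 1) φ)), adjTot_apply, inDegree_same]

variable (M)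

/-- The operator `L δ` in degree `g`, acting on functions with values in `H^{g,g}`. -/
def lefAdjEnd (q : ℝ) (g : ℕ) (I : Type*) : Module.End ℂ (I → harmonicForms M g) :=
  LinearMap.compLeft (LinearMap.proj g ∘ₗ lefTot M q b ∘ₗ adjTot M q b ∘ₗ inDegree M g) I

/-- Pairwise distinct numbers which are the eigenvalues of `L δ` on the nonzero parts of `H^{g,g}`. -/
def lefEigenvalue (n g ℓ : ℕ) : ℂ :=
  -- There are no primitive classes for 2ℓ > n, so any number serves there. The values ℓ i are
  -- non-real and hence distinct from the others.
  if 2 * ℓ ≤ n then (((g : ℝ) - ℓ) * ((n : ℝ) - ℓ - g + 1) : ℝ) else (ℓ : ℂ) * Complex.I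

theorem lefEigenvalue_injective (n g : ℕ) : Function.Injective (lefEigenvalue n g) := by
  intro ℓ m h
  rw [lefEigenvalue, lefEigenvalue] at h
  split_ifs at h with h1 h2 h2
  · have h3 : ((g : ℝ) - ℓ) * ((n : ℝ) - ℓ - g + 1) = ((g : ℝ) - m) * ((n : ℝ) - m - g + 1) := by
      exact_mod_cast h
    -- As a function of ℓ the eigenvalue is a quadratic polynomial symmetric about (n+1)/2, hence
    -- injective on ℓ ≤ n/2.
    have h4 : ((ℓ : ℝ) - m) * ((ℓ : ℝ) + m - n - 1) = 0 := by linear_combination h3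
    have h5 : ((ℓ : ℝ) + m - n - 1) ≠ 0 := by
      have h1' : (2 : ℝ) * ℓ ≤ n := by exact_mod_cast h1
      have h2' : (2 : ℝ) * m ≤ n := by exact_mod_cast h2
      exact (by linarith : ((ℓ : ℝ) + m - n - 1) < 0).ne
    have := (mul_eq_zero.mp h4).resolve_right h5
    exact_mod_cast sub_eq_zero.mp this
  · have := congrArg Complex.im h
    rw [Complex.ofReal_im, Complex.mul_I_im, Complex.natCast_re] at this
    have : m = 0 := by exact_mod_cast this.symm
    omega
  · have := congrArg Complex.im h
    rw [Complex.ofReal_im, Complex.mul_I_im, Complex.natCast_re] at this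
    have : ℓ = 0 := by exact_mod_cast this
    omega
  · exact_mod_cast mul_right_cancel₀ Complex.I_ne_zero h

/-- For W primitive of degree ℓ and k = g - ℓ > 0, δ L^k W = k(n - 2ℓ - k + 1) L^{k-1} W, and
applying L again gives the eigenvalue. For k = 0 both sides vanish. -/
theorem lefAdjEnd_apply (hq : q ≠ 0) {g ℓ : ℕ} (hℓ : ℓ ≤ g)
    {G : Matrix (Fin n) (Fin g) ℂ → harmonicForms M g} (hG : G ∈ lefSummand M q b g ℓ) :
    lefAdjEnd M b q g (Matrix (Fin n) (Fin g) ℂ) G = lefEigenvalue n g ℓ • G := by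
  have hL := lefschetzData_pureDegree M b hq
  rw [lefSummand] at hG
  induction hG using Submodule.span_induction with
  | zero => rw [map_zero, smul_zero]
  | add x y _ _ hx hy => rw [map_add, hx, hy, smul_add]
  | smul c x _ hx => rw [map_smul, hx, smul_comm]
  | mem G h => ?_
  obtain ⟨P, -, W, ⟨hW, hW0, -⟩, rfl⟩ := h
  funext U
  have hW' : W ∈ pureDegree M ℓ := mem_pureDegree.mpr hW
  have hmem : (lefTot M q b)^[g - ℓ] W ∈ pureDegree M g := by
    have := hL.iterate_mem hW' (g - ℓ)
    rwa [Nat.add_sub_cancel' hℓ] at this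
  have key : lefTot M q b (adjTot M q b ((lefTot M q b)^[g - ℓ] W)) =
      lefEigenvalue n g ℓ • (lefTot M q b)^[g - ℓ] W := by
    by_cases hn : 2 * ℓ ≤ n
    · obtain ⟨k, rfl⟩ := Nat.exists_eq_add_of_le hℓ
      rw [Nat.add_sub_cancel_left]
      obtain _ | k := k
      · rw [Function.iterate_zero_apply, hW0, map_zero, lefEigenvalue, if_pos hn]
        simp
      · rw [hL.lower_iterate_prim hW' hW0, map_smul, ← Function.iterate_succ_apply' (lefTot M q b),
          lefEigenvalue, if_pos hn]
        congr 1
        push_cast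
        ring
    · have h0 : W = 0 := hL.prim_eq_zero hW' hW0 (by omega)
      rw [h0, Function.iterate_fixed (map_zero _), map_zero, map_zero, smul_zero]
  change (lefTot M q b (adjTot M q b (inDegree M g (_ • ((lefTot M q b)^[g - ℓ] W) g)))) g =
    lefEigenvalue n g ℓ • ((raiseTot^[g - ℓ] P) g U • ((lefTot M q b)^[g - ℓ] W) g)
  rw [map_smul, inDegree_apply_of_mem hmem, map_smul, map_smul, key, smul_comm]
  rfl

theorem iSupIndep_lefSummand (hq : q ≠ 0) (g : ℕ) :
    iSupIndep (fun ℓ : Fin (g + 1) => lefSummand M q b g ℓ) := by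
  have h := iSupIndep_of_apply_eq_smul (A := Matrix (Fin n) (Fin g) ℂ → harmonicForms M g)
    (lefAdjEnd M b q g (Matrix (Fin n) (Fin g) ℂ)) (fun ℓ : Fin (g + 1) => lefSummand M q b g ℓ)
    ((lefEigenvalue_injective n g).comp Fin.val_injective)
  exact h fun ℓ _ => lefAdjEnd_apply M b hq (Nat.lt_succ_iff.mp ℓ.2)

end independence

/-! ### Traces and √(-d_k) in the imaginary quadratic field. -/

section quadraticField

theorem sqrtD_ne_zero (k : Type*) [Field k] [NumberField k] : sqrtD k ≠ 0 := by
  have : (NumberField.discr k : ℝ) ≠ 0 := by exact_mod_cast NumberField.discr_ne_zero k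
  exact (Real.sqrt_pos.mpr (abs_pos.mpr this)).ne'

variable {k : Type*} [Field k] [NumberField k] [NumberField.IsTotallyComplex k]

/-- The trace is the sum over the two embeddings, which are τ and its conjugate; these differ
because k is totally complex. -/
theorem trace_eq_two_mul_re (hk : Module.finrank ℚ k = 2) (τ : k →+* ℂ) (x : k) :
    (Algebra.trace ℚ k x : ℂ) = ((2 * (τ x).re : ℝ) : ℂ) := by
  classical
  let σ : k →ₐ[ℚ] ℂ := τ.toRatAlgHom
  let σ' : k →ₐ[ℚ] ℂ := ((starRingEnd ℂ).comp τ).toRatAlgHom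
  have hne : σ ≠ σ' := by
    intro h
    have h1 : ∀ y, τ y = conj (τ y) := fun y => DFunLike.congr_fun h y
    exact NumberField.InfinitePlace.isComplex_mk_iff.mp
      (NumberField.IsTotallyComplex.isComplex (NumberField.InfinitePlace.mk τ))
      (RingHom.ext fun y => (h1 y).symm)
  have hcard : Fintype.card (k →ₐ[ℚ] ℂ) = 2 := by
    rw [AlgHom.card ℚ k ℂ, hk]
  have huniv : (Finset.univ : Finset (k →ₐ[ℚ] ℂ)) = {σ, σ'} := by
    symm
    apply Finset.eq_of_subset_of_card_le (Finset.subset_univ _)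
    rw [Finset.card_pair hne, Finset.card_univ, hcard]
  have h := trace_eq_sum_embeddings (K := ℚ) (L := k) ℂ (x := x)
  rw [huniv, Finset.sum_pair hne] at h
  rw [eq_ratCast] at h
  rw [h]
  change τ x + conj (τ x) = _
  rw [Complex.add_conj]

theorem exists_rat_re (hk : Module.finrank ℚ k = 2) (τ : k →+* ℂ) (x : k) :
    ∃ r : ℚ, (τ x).re = r := by
  have h := trace_eq_two_mul_re hk τ x
  refine ⟨Algebra.trace ℚ k x / 2, ?_⟩
  have : (Algebra.trace ℚ k x : ℝ) = 2 * (τ x).re := by exact_mod_cast h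
  push_cast
  rw [this]
  ring

theorem map_trace_sub (hk : Module.finrank ℚ k = 2) (τ : k →+* ℂ) (y : k) :
    τ (algebraMap ℚ k (Algebra.trace ℚ k y) - y) = conj (τ y) := by
  rw [map_sub, eq_ratCast, map_ratCast, trace_eq_two_mul_re hk τ, ← Complex.add_conj]
  ring

/-- `√(-d_k)` lies in the field. -/
theorem exists_eq_I_mul_sqrtD (hk : Module.finrank ℚ k = 2) (τ : k →+* ℂ) :
    ∃ x : k, τ x = Complex.I * (sqrtD k : ℂ) := by
  classical
  have hc : Fintype.card (Module.Free.ChooseBasisIndex ℤ (NumberField.RingOfIntegers k)) =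
      Fintype.card (Fin 2) := by
    rw [← Module.finrank_eq_card_basis (NumberField.integralBasis k), hk, Fintype.card_fin]
  let e := Fintype.equivOfCardEq hc
  let w := (NumberField.integralBasis k).reindex e
  have hd : (NumberField.discr k : ℚ) = Algebra.discr ℚ w := by
    rw [NumberField.coe_discr, ← Algebra.discr_reindex ℚ (NumberField.integralBasis k) e]
    rw [Module.Basis.coe_reindex]
  -- With traces written as 2 Re, the Gram determinant of the integral basis w collapses to minus a
  -- square, so √d_k = |2t|.
  have hd2 : (NumberField.discr k : ℝ) = -(2 * (τ (w 0) * conj (τ (w 1))).im) ^ 2 := by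
    have h : ((NumberField.discr k : ℚ) : ℂ) = ((Algebra.discr ℚ w : ℚ) : ℂ) := by rw [hd]
    rw [Algebra.discr_def, Matrix.det_fin_two] at h
    simp only [Algebra.traceMatrix_apply, Algebra.traceForm_apply] at h
    push_cast at h
    simp only [trace_eq_two_mul_re hk τ, map_mul] at h
    have h2 : (NumberField.discr k : ℝ) = (2 * (τ (w 0) * τ (w 0)).re) * (2 * (τ (w 1) * τ (w 1)).re) -
        (2 * (τ (w 0) * τ (w 1)).re) * (2 * (τ (w 1) * τ (w 0)).re) := by exact_mod_cast h
    rw [h2]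
    simp only [Complex.mul_re, Complex.mul_im, Complex.conj_re, Complex.conj_im]
    ring
  set t := (τ (w 0) * conj (τ (w 1))).im with ht
  have hs : sqrtD k = |2 * t| := by
    rw [sqrtD, hd2, abs_neg, abs_of_nonneg (sq_nonneg _), Real.sqrt_sq_eq_abs]
  -- Trace minus the element is its conjugate, so x is w₀ w̄₁ - w₁ w̄₀, which τ maps to 2it = ± i
  -- √d_k.
  let x : k := w 0 * (algebraMap ℚ k (Algebra.trace ℚ k (w 1)) - w 1) -
    w 1 * (algebraMap ℚ k (Algebra.trace ℚ k (w 0)) - w 0)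
  have hx : τ x = Complex.I * ((2 * t : ℝ) : ℂ) := by
    rw [map_sub, map_mul, map_mul, map_trace_sub hk, map_trace_sub hk, ht]
    have := Complex.sub_conj (τ (w 0) * conj (τ (w 1)))
    rw [map_mul, Complex.conj_conj] at this
    rw [mul_comm Complex.I, ← this]
    ring
  rcases abs_choice (2 * t) with h | h
  · exact ⟨x, by rw [hs, h, hx]⟩
  · exact ⟨-x, by rw [hs, h, map_neg, hx]; push_cast; ring⟩

end quadraticField
-- Forms with rational values on a K-subspace.
section rationalForms

variable {V : Type*} [NormedAddCommGroup V] [InnerProductSpace ℂ V]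

/-- A subspace `W` of `V` over an imaginary quadratic subfield `K` of `ℂ` which spans `V`, and on which
the Hermitian form is `K`-valued; `q` is the absolute value of an imaginary element of `K`. -/
structure IsRationalModel (q : ℝ) (K : Subfield ℂ) (W : Submodule K V) : Prop where
  exists_re : ∀ a ∈ K, ∃ r : ℚ, a.re = r
  I_mul_mem : Complex.I * (q : ℂ) ∈ K
  exists_sq : ∃ r : ℚ, q ^ 2 = r
  ne_zero : q ≠ 0
  inner_mem : ∀ x ∈ W, ∀ y ∈ W, inner ℂ x y ∈ K
  span_top : Submodule.span ℂ (W : Set V) = ⊤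

/-- Forms with rational values on a set of vectors. -/
def RatForm (W : Set V) {p : ℕ} (η : Alt V p) : Prop :=
  ∀ v : Fin p → V, (∀ i, v i ∈ W) → η v ∈ (algebraMap ℚ ℂ).fieldRange

variable {W : Set V} {p : ℕ}

theorem RatForm.zero : RatForm W (0 : Alt V p) := fun _ _ => zero_mem _

theorem RatForm.add {η η' : Alt V p} (h : RatForm W η) (h' : RatForm W η') : RatForm W (η + η') :=
  fun v hv => add_mem (h v hv) (h' v hv)

theorem RatForm.smul {η : Alt V p} (h : RatForm W η) {c : ℂ} (hc : c ∈ (algebraMap ℚ ℂ).fieldRange) :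
    RatForm W (c • η) := fun v hv => mul_mem hc (h v hv)

theorem RatForm.sum {ι : Type*} (S : Finset ι) {η : ι → Alt V p} (h : ∀ i ∈ S, RatForm W (η i)) :
    RatForm W (∑ i ∈ S, η i) :=
  Finset.sum_induction _ _ (fun _ _ => RatForm.add) RatForm.zero h

theorem RatForm.wedgeOne {η : Alt V p} (h : RatForm W η) {θ : V →L[ℝ] ℂ}
    (hθ : ∀ x ∈ W, θ x ∈ (algebraMap ℚ ℂ).fieldRange) : RatForm W (wedgeOne θ p η) := fun v hv => by
  rw [wedgeOne_apply]
  exact sum_mem fun i _ => mul_mem (pow_mem (neg_mem (one_mem _)) _)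
    (mul_mem (hθ _ (hv i)) (h _ fun _ => hv _))

theorem RatForm.contractTwo {η : Alt V (p + 2)} (h : RatForm W η) {x y : V} (hx : x ∈ W) (hy : y ∈ W) :
    RatForm W (contractTwo x y p η) := fun v hv => by
  rw [contractTwo_apply]
  refine h _ fun i => Fin.cases hx (fun i => Fin.cases hy (fun i => hv i) i) i

/-- Expand b in b' and apply Parseval for b to pairs of vectors of b'. This permits computing D and
its dual bivector in an orthogonal basis adapted to the rational structure. -/
theorem sum_sesquilinear {E : Type*} [AddCommGroup E] [Module ℂ E] {n : ℕ}
    (b b' : OrthonormalBasis (Fin n) ℂ V) (B : V →ₗ⋆[ℂ] V →ₗ[ℂ] E) :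
    ∑ s, B (b s) (b s) = ∑ s, B (b' s) (b' s) := by
  have h : ∀ s, B (b s) (b s) = ∑ t, ∑ u, (inner ℂ (b' u) (b s) * inner ℂ (b s) (b' t)) • B (b' t) (b' u) := by
    intro s
    conv_lhs => rw [← b'.sum_repr' (b s)]
    simp only [map_sum, LinearMap.sum_apply, LinearMap.map_smulₛₗ, LinearMap.smul_apply,
      RingHom.id_apply, inner_conj_symm, smul_smul, Finset.smul_sum]
    rw [Finset.sum_comm]
  simp only [h]
  rw [Finset.sum_comm]
  refine Finset.sum_congr rfl fun t _ => ?_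
  rw [Finset.sum_comm, Finset.sum_eq_single t]
  · rw [← Finset.sum_smul, b.sum_inner_mul_inner, b'.inner_eq_one, one_smul]
  · intro u _ hu
    rw [← Finset.sum_smul, b.sum_inner_mul_inner, b'.inner_eq_zero hu, zero_smul]
  · simp

end rationalForms

/-! ### L and δ do not depend on the unitary basis. -/

section basisIndependence

variable {V : Type*} [NormedAddCommGroup V] [InnerProductSpace ℂ V] {n : ℕ}
  (b b' : OrthonormalBasis (Fin n) ℂ V) (q : ℝ)

theorem pullDz_add (x y : V) : pullDz (x + y) = pullDz x + pullDz y := by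
  ext v
  simp [pullDz]

theorem pullDz_conj_smul (c : ℂ) (x : V) : pullDz (c • x) = conj c • pullDz x := by
  ext v
  simp [pullDz]

theorem pullDzBar_add (x y : V) : pullDzBar (x + y) = pullDzBar x + pullDzBar y := by
  ext v
  simp [pullDzBar, pullDz_add]

theorem pullDzBar_smul_left (c : ℂ) (x : V) : pullDzBar (c • x) = c • pullDzBar x := by
  ext v
  simp [pullDzBar, pullDz_conj_smul]

theorem holInt_add (x y : V) : holInt (x + y) = holInt x + holInt y := by
  simp only [holInt, smul_add, map_add]
  module

theorem antiInt_add (x y : V) : antiInt (x + y) = antiInt x + antiInt y := by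
  simp only [antiInt, smul_add, map_add]
  module

theorem intOp_complex_smul (c : ℂ) (x : V) :
    intOp (c • x) = (c.re : ℂ) • intOp x + (c.im : ℂ) • intOp (Complex.I • x) := by
  conv_lhs => rw [← Complex.re_add_im c]
  rw [add_smul, mul_smul, Complex.coe_smul, Complex.coe_smul, map_add, map_smul, map_smul,
    Complex.coe_smul, Complex.coe_smul]

theorem holInt_smul (c : ℂ) (x : V) : holInt (c • x) = c • holInt x := by
  rw [holInt, holInt, smul_smul Complex.I c, intOp_complex_smul, intOp_complex_smul (Complex.I * c),
    Complex.I_mul_re, Complex.I_mul_im]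
  nth_rewrite 5 [← Complex.re_add_im c]
  push_cast
  match_scalars
  · linear_combination 0 * Complex.I_mul_I
  · linear_combination ((c.im : ℂ) / 2) * Complex.I_mul_I

theorem antiInt_smul (c : ℂ) (x : V) : antiInt (c • x) = conj c • antiInt x := by
  rw [antiInt, antiInt, smul_smul Complex.I c, intOp_complex_smul, intOp_complex_smul (Complex.I * c),
    Complex.I_mul_re, Complex.I_mul_im,
    show conj c = (c.re : ℂ) - c.im * Complex.I by apply Complex.ext <;> simp]
  push_cast
  match_scalars
  · linear_combination 0 * Complex.I_mul_I
  · linear_combination ((c.im : ℂ) / 2) * Complex.I_mul_I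

theorem lefOp_eq : lefOp b q = lefOp b' q := by
  let B : V →ₗ⋆[ℂ] V →ₗ[ℂ] Module.End ℂ (Fock V) := LinearMap.mk₂'ₛₗ (starRingEnd ℂ) (RingHom.id ℂ)
    (fun x y => extOp (pullDz x) * extOp (pullDzBar y))
    (fun x x' y => by rw [pullDz_add, map_add, add_mul])
    (fun c x y => by rw [pullDz_conj_smul, map_smul, smul_mul_assoc])
    (fun x y y' => by rw [pullDzBar_add, map_add, mul_add])
    (fun c x y => by rw [pullDzBar_smul_left, map_smul, mul_smul_comm]; rfl)
  exact congrArg (fun T => (Complex.I / (q : ℂ)) • T) (sum_sesquilinear b b' B)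

theorem adjOp_eq : adjOp b q = adjOp b' q := by
  let B : V →ₗ⋆[ℂ] V →ₗ[ℂ] Module.End ℂ (Fock V) := LinearMap.mk₂'ₛₗ (starRingEnd ℂ) (RingHom.id ℂ)
    (fun x y => holInt y * antiInt x)
    (fun x x' y => by rw [antiInt_add, mul_add])
    (fun c x y => by rw [antiInt_smul, mul_smul_comm])
    (fun x y y' => by rw [holInt_add, add_mul])
    (fun c x y => by rw [holInt_smul, smul_mul_assoc]; rfl)
  exact congrArg (fun T => (Complex.I * (q : ℂ)) • T) (sum_sesquilinear b b' B)

theorem lefschetzForm_eq (p : ℕ) (η : Alt V p) : lefschetzForm q b p η = lefschetzForm q b' p η := by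
  obtain ⟨η, rfl⟩ := exists_component_eq p η
  rw [← component_lefOp, ← component_lefOp, lefOp_eq b b']

theorem adjointForm_eq (p : ℕ) (η : Alt V (p + 2)) : adjointForm q b p η = adjointForm q b' p η := by
  obtain ⟨η, rfl⟩ := exists_component_eq (p + 2) η
  rw [← component_adjOp, ← component_adjOp, adjOp_eq b b']

end basisIndependence

/-! ### L and δ preserve rational forms. -/

section rationalOperators

variable {V : Type*} [NormedAddCommGroup V] [InnerProductSpace ℂ V] {n : ℕ} {q : ℝ} {K : Subfield ℂ}
  {W : Submodule K V}

/-- With u_m^* dz = R + iS, (R + iS) ∧ (R - iS) = -2i R ∧ S, so f(m) = R ∧ (2/q)S. Both real factors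
take rational values on W when m lies in W. -/
theorem wedgeF_self (q : ℝ) (m : V) (p : ℕ) (η : Alt V p) :
    wedgeF q m m p η = wedgeOne (Complex.ofRealCLM ∘L Complex.reCLM ∘L pullDz m) (p + 1)
      (wedgeOne (((2 / q : ℝ) : ℂ) • (Complex.ofRealCLM ∘L Complex.imCLM ∘L pullDz m)) p η) := by
  obtain ⟨η, rfl⟩ := exists_component_eq p η
  rw [wedgeF_component, ← extOp_succ, ← extOp_succ]
  set R : V →L[ℝ] ℂ := Complex.ofRealCLM ∘L Complex.reCLM ∘L pullDz m
  set S : V →L[ℝ] ℂ := Complex.ofRealCLM ∘L Complex.imCLM ∘L pullDz m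
  have h1 : pullDz m = R + Complex.I • S := by
    ext v
    simpa [R, S, mul_comm] using (Complex.re_add_im (pullDz m v)).symm
  have h2 : pullDzBar m = R - Complex.I • S := by
    ext v
    apply Complex.ext <;> simp [R, S, pullDzBar]
  rw [h1, h2, map_add, map_sub, map_smul, map_smul, add_mul, mul_sub, mul_sub, extOp_mul_self,
    smul_mul_smul_comm, extOp_mul_self, mul_smul_comm, smul_mul_assoc, extOp_anticommute S R,
    ← Module.End.mul_apply, mul_smul_comm, LinearMap.smul_apply, map_smul]
  have h3 : (0 : Module.End ℂ (Fock V)) - Complex.I • (extOp R * extOp S) +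
      (Complex.I • -(extOp R * extOp S) - (Complex.I * Complex.I) • 0) =
      (-2 * Complex.I) • (extOp R * extOp S) := by module
  rw [h3, LinearMap.smul_apply, map_smul, smul_smul]
  congr 1
  push_cast
  linear_combination (-2 / (q : ℂ)) * Complex.I_mul_I

theorem wedgeF_smul_self (q : ℝ) (c : ℂ) (m : V) (p : ℕ) (η : Alt V p) :
    wedgeF q (c • m) (c • m) p η = ((‖c‖ ^ 2 : ℝ) : ℂ) • wedgeF q m m p η := by
  obtain ⟨η, rfl⟩ := exists_component_eq p η
  rw [wedgeF_component, wedgeF_component, pullDz_conj_smul, pullDzBar_smul_left, map_smul, map_smul,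
    smul_mul_smul_comm, LinearMap.smul_apply, map_smul, smul_comm, mul_comm, Complex.mul_conj,
    Complex.normSq_eq_norm_sq]

namespace IsRationalModel

variable (h : IsRationalModel q K W)

include h

theorem ofReal_re_mem {a : ℂ} (ha : a ∈ K) : ((a.re : ℝ) : ℂ) ∈ (algebraMap ℚ ℂ).fieldRange := by
  obtain ⟨r, hr⟩ := h.exists_re a ha
  exact ⟨r, by rw [hr, eq_ratCast, Complex.ofReal_ratCast]⟩

/-- Re(a · iq) = -q Im a is rational and so is q², hence so is (2/q) Im a. -/
theorem two_div_mul_im_mem {a : ℂ} (ha : a ∈ K) :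
    ((2 / q : ℝ) : ℂ) * ((a.im : ℝ) : ℂ) ∈ (algebraMap ℚ ℂ).fieldRange := by
  obtain ⟨r, hr⟩ := h.exists_re _ (K.mul_mem ha h.I_mul_mem)
  obtain ⟨r', hr'⟩ := h.exists_sq
  refine ⟨-2 * r / r', ?_⟩
  have h1 : -(a.im * q) = r := by rw [← hr]; simp
  have hq := h.ne_zero
  rw [← Complex.ofReal_mul, eq_ratCast, ← Complex.ofReal_ratCast]
  congr 1
  push_cast
  rw [← h1, ← hr']
  field_simp

theorem wedgeF_self {m : V} (hm : m ∈ W) {p : ℕ} {η : Alt V p} (hη : RatForm (W : Set V) η) :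
    RatForm (W : Set V) (wedgeF q m m p η) := by
  rw [HermitianCycles.wedgeF_self]
  refine (hη.wedgeOne fun x hx => ?_).wedgeOne fun x hx => ?_
  · exact h.two_div_mul_im_mem (h.inner_mem m hm x hx)
  · exact h.ofReal_re_mem (h.inner_mem m hm x hx)

theorem prodF_self : ∀ (g : ℕ) (m : Fin g → V), (∀ i, m i ∈ W) → RatForm (W : Set V) (prodF q g m m)
  | 0, _, _ => fun _ _ => one_mem _
  | g + 1, m, hm => h.wedgeF_self (hm 0) (prodF_self g (Fin.tail m) fun i => hm i.succ)

/-- There is an orthonormal basis consisting of real multiples of elements of `W`. -/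
theorem exists_orthonormalBasis (b : OrthonormalBasis (Fin n) ℂ V) :
    ∃ (b' : OrthonormalBasis (Fin n) ℂ V) (c : Fin n → ℂ) (m : Fin n → V), (∀ s, m s ∈ W) ∧
      (∀ s, b' s = c s • m s) ∧ ∀ s, ((‖c s‖ ^ 2 : ℝ) : ℂ) ∈ (algebraMap ℚ ℂ).fieldRange := by
  have := b.toBasis.finiteDimensional_of_finite
  have hn : Module.finrank ℂ V = n := by
    rw [Module.finrank_eq_card_basis b.toBasis, Fintype.card_fin]
  obtain ⟨f, hf, hli⟩ : ∃ f : Fin n → V, (∀ i, f i ∈ W) ∧ LinearIndependent ℂ f := by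
    have key := Submodule.exists_fun_fin_finrank_span_eq ℂ (W : Set V)
    rw [h.span_top, finrank_top, hn] at key
    obtain ⟨f, hf, -, hli⟩ := key
    exact ⟨f, hf, hli⟩
  -- Gram–Schmidt without normalisation divides only by inner products, which lie in K. Normalising
  -- then introduces inverse norms, whose squares are rational.
  have hg : ∀ i, InnerProductSpace.gramSchmidt ℂ f i ∈ W := by
    intro i
    induction i using WellFoundedLT.induction with
    | ind i ih =>
      rw [InnerProductSpace.gramSchmidt_def]
      refine W.sub_mem (hf i) (W.sum_mem fun j hj => ?_)
      rw [Submodule.starProjection_singleton]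
      have hj := ih j (Finset.mem_Iio.mp hj)
      refine W.smul_mem ⟨_, K.div_mem (h.inner_mem _ hj _ (hf i)) ?_⟩ hj
      have := h.inner_mem _ hj _ hj
      rw [inner_self_eq_norm_sq_to_K] at this
      exact_mod_cast this
  refine ⟨InnerProductSpace.gramSchmidtOrthonormalBasis (by rw [hn, Fintype.card_fin]) f, _, _, hg,
    fun s => InnerProductSpace.gramSchmidtOrthonormalBasis_apply _ ?_, fun s => ?_⟩
  · intro h0
    have := InnerProductSpace.gramSchmidtNormed_unit_length s hli
    rw [h0, norm_zero] at this
    exact zero_ne_one this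
  · have := h.ofReal_re_mem (h.inner_mem _ (hg s) _ (hg s))
    rw [inner_self_eq_norm_sq_to_K, ← RCLike.ofReal_pow] at this
    rw [norm_inv, RCLike.norm_ofReal, abs_norm, inv_pow, Complex.ofReal_inv]
    exact inv_mem this

/-- D = ∑ ‖c_s‖² f(m_s) with m_s in W and rational coefficients. -/
theorem lefschetzForm (b : OrthonormalBasis (Fin n) ℂ V) {p : ℕ} {η : Alt V p}
    (hη : RatForm (W : Set V) η) : RatForm (W : Set V) (lefschetzForm q b p η) := by
  obtain ⟨b', c, m, hm, hb, hc⟩ := h.exists_orthonormalBasis b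
  rw [lefschetzForm_eq b b', ← sum_wedgeF_basis]
  refine RatForm.sum _ fun s _ => ?_
  rw [hb, wedgeF_smul_self]
  exact (h.wedgeF_self (hm s) hη).smul (hc s)

theorem adjointForm (b : OrthonormalBasis (Fin n) ℂ V) {p : ℕ} {η : Alt V (p + 2)}
    (hη : RatForm (W : Set V) η) : RatForm (W : Set V) (adjointForm q b p η) := by
  obtain ⟨b', c, m, hm, hb, hc⟩ := h.exists_orthonormalBasis b
  -- The vector i m_s need not lie in W, but iq m_s does. The factor q in the definition of δ is
  -- absorbed there, which leaves rational coefficients.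
  have hs : HermitianCycles.adjointForm q b' p η = ∑ s, ((1 / 2 : ℂ) * ((‖c s‖ ^ 2 : ℝ) : ℂ)) •
      contractTwo (m s) ((Complex.I * (q : ℂ)) • m s) p η := by
    simp only [HermitianCycles.adjointForm, smul_apply, sum_apply, Finset.smul_sum]
    refine Finset.sum_congr rfl fun s _ => ?_
    have hI : (Complex.I * (q : ℂ)) • m s = q • (Complex.I • m s) := by
      rw [mul_comm, mul_smul, Complex.coe_smul]
    have hsm : contractTwo (m s) (q • (Complex.I • m s)) p η =
        (q : ℂ) • contractTwo (m s) (Complex.I • m s) p η := by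
      change (η.curryLeft _).curryLeft _ = (q : ℂ) • (η.curryLeft _).curryLeft _
      rw [map_smul, Complex.coe_smul]
    rw [hb, contractTwo_rotate, hI, hsm, smul_smul, smul_smul]
    congr 1
    push_cast
    ring
  rw [adjointForm_eq b b', hs]
  refine RatForm.sum _ fun s _ => (hη.contractTwo (hm s) ?_).smul (mul_mem ?_ (hc s))
  · exact W.smul_mem ⟨_, h.I_mul_mem⟩ (hm s)
  · exact ⟨1 / 2, by simp⟩

end IsRationalModel

end rationalOperators

/-! ### The rational model attached to a Hermitian lattice. -/

section latticeModel

variable {k : Type*} [Field k] [NumberField k] [NumberField.IsTotallyComplex k]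
  {V : Type*} [NormedAddCommGroup V] [InnerProductSpace ℂ V] {M : Submodule ℤ V}

theorem IsHermitianLattice.isRationalModel (hk : Module.finrank ℚ k = 2) {τ : k →+* ℂ}
    (hM : IsHermitianLattice τ M) :
    IsRationalModel (sqrtD k) τ.fieldRange (Submodule.span τ.fieldRange (M : Set V)) where
  exists_re := by
    rintro _ ⟨x, rfl⟩
    exact exists_rat_re hk τ x
  I_mul_mem := exists_eq_I_mul_sqrtD hk τ
  exists_sq := ⟨|NumberField.discr k|, by
    rw [sqrtD, Real.sq_sqrt (abs_nonneg _)]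
    push_cast
    rfl⟩
  ne_zero := sqrtD_ne_zero k
  inner_mem x hx y hy := by
    induction hx using Submodule.span_induction with
    | zero => rw [inner_zero_left]; exact zero_mem _
    | add x x' _ _ hx hx' => rw [inner_add_left]; exact add_mem hx hx'
    | smul c x _ hx =>
      obtain ⟨_, a, rfl⟩ := c
      change inner ℂ (τ a • x) y ∈ _
      rw [inner_smul_left]
      refine mul_mem ⟨algebraMap ℚ k (Algebra.trace ℚ k a) - a, ?_⟩ hx
      exact map_trace_sub hk τ a
    | mem x hx =>
      induction hy using Submodule.span_induction with
      | zero => rw [inner_zero_right]; exact zero_mem _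
      | add y y' _ _ hy hy' => rw [inner_add_right]; exact add_mem hy hy'
      | smul c y _ hy =>
        obtain ⟨_, a, rfl⟩ := c
        change inner ℂ x (τ a • y) ∈ _
        rw [inner_smul_right]
        exact mul_mem ⟨a, rfl⟩ hy
      | mem y hy =>
        obtain ⟨a, ha⟩ := hM.inner_mem x hx y hy
        exact ⟨a, ha.symm⟩
  span_top := by
    rw [eq_top_iff]
    intro x _
    have hx : x ∈ Submodule.span ℝ (M : Set V) := hM.span_top ▸ Submodule.mem_top
    induction hx using Submodule.span_induction with
    | zero => exact zero_mem _
    | add x y _ _ hx hy => exact add_mem (hx trivial) (hy trivial)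
    | smul c x _ hx =>
      rw [← Complex.coe_smul]
      exact Submodule.smul_mem _ _ (hx trivial)
    | mem x hx => exact Submodule.subset_span (Submodule.subset_span hx)

end latticeModel

/-! ### Rational products span all products over ℂ. -/

section rationalSpan

variable {V : Type*} [NormedAddCommGroup V] [InnerProductSpace ℂ V] {q : ℝ} {K : Subfield ℂ}
  {W : Submodule K V}

/-- The products of forms `f(m)`, with `m ∈ W`. -/
def rationalProducts (q : ℝ) (W : Submodule K V) (g : ℕ) : Set (Alt V (2 * g)) :=
  {η | ∃ m : Fin g → V, (∀ i, m i ∈ W) ∧ η = prodF q g m m}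

theorem wedgeF_add_left (l₁ l₂ l' : V) (p : ℕ) (η : Alt V p) :
    wedgeF q (l₁ + l₂) l' p η = wedgeF q l₁ l' p η + wedgeF q l₂ l' p η := by
  obtain ⟨η, rfl⟩ := exists_component_eq p η
  simp only [wedgeF_component, pullDzBar_add, map_add, mul_add, LinearMap.add_apply, smul_add]

theorem wedgeF_add_right (l l₁ l₂ : V) (p : ℕ) (η : Alt V p) :
    wedgeF q l (l₁ + l₂) p η = wedgeF q l l₁ p η + wedgeF q l l₂ p η := by
  obtain ⟨η, rfl⟩ := exists_component_eq p η
  simp only [wedgeF_component, pullDz_add, map_add, add_mul, LinearMap.add_apply, smul_add]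

theorem wedgeF_smul_left (c : ℂ) (l l' : V) (p : ℕ) (η : Alt V p) :
    wedgeF q (c • l) l' p η = c • wedgeF q l l' p η := by
  obtain ⟨η, rfl⟩ := exists_component_eq p η
  rw [wedgeF_component, wedgeF_component, pullDzBar_smul_left, map_smul, mul_smul_comm,
    LinearMap.smul_apply, map_smul, smul_comm]

theorem wedgeF_smul_right (c : ℂ) (l l' : V) (p : ℕ) (η : Alt V p) :
    wedgeF q l (c • l') p η = conj c • wedgeF q l l' p η := by
  obtain ⟨η, rfl⟩ := exists_component_eq p η
  rw [wedgeF_component, wedgeF_component, pullDz_conj_smul, map_smul, smul_mul_assoc,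
    LinearMap.smul_apply, map_smul, smul_comm]

/-- Polarisation of a sesquilinear map with 1 and iq in place of 1 and i, as i need not lie in K.
Here a, d stand for the values at (x, x), (y, y) and e, e' for those at (x, y), (y, x): the first
hypothesis isolates e + e', the second e - e'. -/
theorem mem_of_polarization {E : Type*} [AddCommGroup E] [Module ℂ E] (S : Submodule ℂ E) (hq : q ≠ 0)
    {a d e e' : E} (ha : a ∈ S) (hd : d ∈ S) (h₁ : a + e' + (e + d) ∈ S)
    (h₂ : a + (Complex.I * (q : ℂ)) • e' +
      (-Complex.I * (q : ℂ)) • (e + (Complex.I * (q : ℂ)) • d) ∈ S) : e ∈ S := by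
  have hq : (q : ℂ) ≠ 0 := by exact_mod_cast hq
  have h3 : e + e' ∈ S := by
    convert S.sub_mem h₁ (S.add_mem ha hd) using 1
    abel
  have h4 : e - e' ∈ S := by
    convert S.smul_mem (Complex.I / (q : ℂ)) (S.sub_mem h₂ (S.add_mem ha (S.smul_mem ((q : ℂ) ^ 2) hd)))
      using 1
    match_scalars <;> field_simp <;> ring_nf <;> simp
  convert S.smul_mem (1 / 2 : ℂ) (S.add_mem h3 h4) using 1
  module

namespace IsRationalModel

variable (h : IsRationalModel q K W)

include h

theorem wedgeF_mem_span {g : ℕ} (l l' : V) {η : Alt V (2 * g)}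
    (hη : η ∈ Submodule.span ℂ (rationalProducts q W g)) :
    wedgeF q l l' (2 * g) η ∈ Submodule.span ℂ (rationalProducts q W (g + 1)) := by
  induction hη using Submodule.span_induction with
  | zero => rw [map_zero]; exact zero_mem _
  | add x y _ _ hx hy => rw [map_add]; exact add_mem hx hy
  | smul c x _ hx => rw [map_smul]; exact Submodule.smul_mem _ _ hx
  | mem η hη =>
    obtain ⟨m, hm, rfl⟩ := hη
    have hdiag : ∀ x ∈ W, wedgeF q x x (2 * g) (prodF q g m m) ∈
        Submodule.span ℂ (rationalProducts q W (g + 1)) := by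
      intro x hx
      exact Submodule.subset_span ⟨Fin.cons x m, fun i => Fin.cases hx hm i, rfl⟩
    have hl : l ∈ Submodule.span ℂ (W : Set V) := h.span_top ▸ Submodule.mem_top
    have hl' : l' ∈ Submodule.span ℂ (W : Set V) := h.span_top ▸ Submodule.mem_top
    induction hl using Submodule.span_induction with
    | zero =>
      have h0 := wedgeF_smul_left (q := q) 0 0 l' (2 * g) (prodF q g m m)
      rw [zero_smul] at h0
      rw [h0.trans (c := 0) (ContinuousAlternatingMap.ext fun v => zero_mul _)]
      exact zero_mem _
    | add x y _ _ hx hy => rw [wedgeF_add_left]; exact add_mem hx hy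
    | smul c x _ hx => rw [wedgeF_smul_left]; exact Submodule.smul_mem _ _ hx
    | mem x hx =>
      induction hl' using Submodule.span_induction with
      | zero =>
        have h0 := wedgeF_smul_right (q := q) 0 x 0 (2 * g) (prodF q g m m)
        rw [zero_smul, map_zero] at h0
        rw [h0.trans (c := 0) (ContinuousAlternatingMap.ext fun v => zero_mul _)]
        exact zero_mem _
      | add y z _ _ hy hz => rw [wedgeF_add_right]; exact add_mem hy hz
      | smul c y _ hy => rw [wedgeF_smul_right]; exact Submodule.smul_mem _ _ hy
      | mem y hy =>
        have hζy : (Complex.I * (q : ℂ)) • y ∈ W := W.smul_mem ⟨_, h.I_mul_mem⟩ hy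
        have h1 := hdiag (x + y) (W.add_mem hx hy)
        have h2 := hdiag (x + (Complex.I * (q : ℂ)) • y) (W.add_mem hx hζy)
        have h3 := hdiag x hx
        have h4 := hdiag y hy
        simp only [wedgeF_add_left, wedgeF_add_right, wedgeF_smul_left, wedgeF_smul_right, map_mul,
          Complex.conj_I, Complex.conj_ofReal] at h1 h2
        exact mem_of_polarization _ h.ne_zero h3 h4 h1 h2

theorem prodF_mem_span : ∀ (g : ℕ) (l l' : Fin g → V),
    prodF q g l l' ∈ Submodule.span ℂ (rationalProducts q W g)
  | 0, _, _ => Submodule.subset_span ⟨0, fun i => i.elim0, rfl⟩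
  | g + 1, l, l' => h.wedgeF_mem_span (l 0) (l' 0) (prodF_mem_span g (Fin.tail l) (Fin.tail l'))

end IsRationalModel

end rationalSpan

/-! ### Rational Hodge classes of constant forms. -/

section rationalClasses

variable {V : Type*} [NormedAddCommGroup V] [InnerProductSpace ℂ V] [FiniteDimensional ℂ V]
  (M : Submodule ℤ V) {q : ℝ} {n : ℕ} (b : OrthonormalBasis (Fin n) ℂ V) {K : Subfield ℂ}
  {W : Submodule K V}

variable {M} in
theorem inDegree_constForm_add {g : ℕ} {η η' : Alt V (2 * g)} (h : IsTypeGG g η) (h' : IsTypeGG g η') :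
    inDegree M g (constForm M (η + η') (h.add h')) =
      inDegree M g (constForm M η h) + inDegree M g (constForm M η' h') :=
  map_add (inDegree M g) (constForm M η h) (constForm M η' h')

variable {M} in
theorem inDegree_constForm_smul {g : ℕ} {η : Alt V (2 * g)} (h : IsTypeGG g η) (c : ℂ) :
    inDegree M g (constForm M (c • η) (h.smul c)) = c • inDegree M g (constForm M η h) :=
  map_smul (inDegree M g) c (constForm M η h)

variable {M} in
theorem inDegree_constForm_zero (g : ℕ) :
    inDegree M g (constForm M (0 : Alt V (2 * g)) IsTypeGG.zero) = 0 :=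
  map_zero (inDegree M g)

/-- The classes of degree `g` given by constant forms with rational values on `W`. -/
def rationalClasses (W : Submodule K V) (g : ℕ) : AddSubgroup (Cohomology M) where
  carrier := {w | ∃ η h, RatForm (W : Set V) η ∧ w = inDegree M g (constForm M η h)}
  add_mem' := by
    rintro _ _ ⟨η, h, hη, rfl⟩ ⟨η', h', hη', rfl⟩
    exact ⟨η + η', h.add h', hη.add hη', (inDegree_constForm_add h h').symm⟩
  zero_mem' := ⟨0, IsTypeGG.zero, RatForm.zero, (inDegree_constForm_zero g).symm⟩
  neg_mem' := by
    rintro _ ⟨η, h, hη, rfl⟩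
    refine ⟨(-1 : ℂ) • η, h.smul _, hη.smul (neg_mem (one_mem _)), ?_⟩
    rw [inDegree_constForm_smul h]
    exact (neg_one_smul ℂ (inDegree M g (constForm M η h))).symm

variable {M} in
theorem rationalClasses_le (g : ℕ) : rationalClasses M W g ≤ pureDegree M g := by
  rintro _ ⟨η, h, -, rfl⟩
  exact inDegree_mem g _

/-- Makes the formal decomposition available inside the rational classes, so that the primitive
components found there are rational. -/
theorem lefschetzData_rationalClasses (h : IsRationalModel q K W) :
    LefschetzData (A := Cohomology M) n (lefTot M q b) (adjTot M q b) (rationalClasses M W) where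
  smul_mem := by
    rintro g r _ ⟨η, hη, hr, rfl⟩
    exact ⟨(r : ℂ) • η, hη.smul _, hr.smul ⟨r, eq_ratCast _ _⟩, (inDegree_constForm_smul hη _).symm⟩
  raise_mem := by
    rintro g _ ⟨η, hη, hr, rfl⟩
    exact ⟨_, hη.lefschetzForm q b, h.lefschetzForm b hr, lefTot_inDegree b q g _⟩
  lower_mem := by
    rintro g _ ⟨η, hη, hr, rfl⟩
    exact ⟨_, IsTypeGG.adjointForm hη q b, h.adjointForm b hr, adjTot_inDegree b q g _⟩
  lower_zero hx := adjTot_eq_zero b q (rationalClasses_le 0 hx)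
  lower_raise hx := adjTot_lefTot b h.ne_zero (rationalClasses_le _ hx)
  eq_zero hg hx := pureDegree_eq_zero b hg (rationalClasses_le _ hx)

theorem isRational_of_mem {ℓ : ℕ} (hW : (M : Set V) ⊆ W) {w : Cohomology M}
    (hw : w ∈ rationalClasses M W ℓ) : IsRational (w ℓ) := by
  obtain ⟨η, h, hr, rfl⟩ := hw
  intro m hm
  obtain ⟨r, hr⟩ := hr m fun i => hW (hm i)
  refine ⟨r, ?_⟩
  rw [inDegree_same]
  change ∫ t in Set.Icc (0 : Fin (2 * ℓ) → ℝ) 1, η m = _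
  rw [MeasureTheory.setIntegral_const, MeasureTheory.measureReal_def, Real.volume_Icc_pi]
  simp [← hr]

/-- For general λ the class Z(λ) is not rational, but polarisation writes it as a complex
combination of classes Z(m) with all m_i in W, which are. -/
theorem inDegree_zClass_mem_span (h : IsRationalModel q K W) {g : ℕ} (l : Fin g → V) :
    inDegree M g (zClass M q l) ∈ Submodule.span ℂ (rationalClasses M W g : Set (Cohomology M)) := by
  have key : ∀ η ∈ Submodule.span ℂ (rationalProducts q W g), ∃ hη : IsTypeGG g η,
      inDegree M g (constForm M η hη) ∈
        Submodule.span ℂ (rationalClasses M W g : Set (Cohomology M)) := by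
    intro η hη
    induction hη using Submodule.span_induction with
    | zero => exact ⟨IsTypeGG.zero, by rw [inDegree_constForm_zero]; exact Submodule.zero_mem _⟩
    | add x y _ _ hx hy =>
      obtain ⟨h1, h2⟩ := hx
      obtain ⟨h3, h4⟩ := hy
      exact ⟨h1.add h3, by rw [inDegree_constForm_add h1 h3]; exact Submodule.add_mem _ h2 h4⟩
    | smul c x _ hx =>
      obtain ⟨h1, h2⟩ := hx
      exact ⟨h1.smul c, by rw [inDegree_constForm_smul h1]; exact Submodule.smul_mem _ c h2⟩
    | mem η hη =>
      obtain ⟨m, hm, rfl⟩ := hη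
      exact ⟨isTypeGG_prodF q g m m, Submodule.subset_span ⟨_, _, h.prodF_self g m hm, rfl⟩⟩
  exact (key _ (h.prodF_mem_span g l l)).2

end rationalClasses

/-! ### Expansion in primitive elements with linear functionals as coefficients. -/

/-- The vectors stay independent modulo R, and their coordinate functionals extend to A / R. With R
the image of L, vanishing on R is what puts the resulting functions in the kernel of Δ. -/
theorem exists_dual_family {A ι : Type*} [AddCommGroup A] [Module ℂ A] {w : ι → A}
    (hw : LinearIndependent ℂ w) (R : Submodule ℂ A)
    (hR : Disjoint (Submodule.span ℂ (Set.range w)) R) :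
    ∃ φ : ι → A →ₗ[ℂ] ℂ, (∀ i, φ i (w i) = 1) ∧ (∀ i j, j ≠ i → φ i (w j) = 0) ∧
      ∀ i, ∀ x ∈ R, φ i x = 0 := by
  have hli : LinearIndependent ℂ (R.mkQ ∘ w) := hw.map (by rwa [Submodule.ker_mkQ])
  have h : ∀ i, ∃ f : A ⧸ R →ₗ[ℂ] ℂ, f ∘ₗ Submodule.subtype _ = (Module.Basis.span hli).coord i :=
    fun i => LinearMap.exists_extend _
  choose f hf using h
  have hval : ∀ i j, f i (R.mkQ (w j)) = Finsupp.single j (1 : ℂ) i := by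
    intro i j
    have h1 := LinearMap.congr_fun (hf i) (Module.Basis.span hli j)
    rw [Module.Basis.coord_apply, Module.Basis.repr_self] at h1
    rw [← h1, LinearMap.comp_apply, Submodule.subtype_apply, Module.Basis.span_apply]
    rfl
  refine ⟨fun i => f i ∘ₗ R.mkQ, fun i => ?_, fun i j hij => ?_, fun i x hx => ?_⟩
  · rw [LinearMap.comp_apply, hval, Finsupp.single_eq_same]
  · rw [LinearMap.comp_apply, hval, Finsupp.single_eq_of_ne hij.symm]
  · rw [LinearMap.comp_apply, Submodule.mkQ_apply, (Submodule.Quotient.mk_eq_zero R).mpr hx, map_zero]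

theorem finite_span_of_subset_range {A B : Type*} [AddCommGroup A] [Module ℂ A] [AddCommGroup B]
    [Module ℂ B] [FiniteDimensional ℂ B] (f : B →ₗ[ℂ] A) {S : Set A} (hS : S ⊆ LinearMap.range f) :
    Module.Finite ℂ (Submodule.span ℂ S) :=
  Submodule.finiteDimensional_of_le (Submodule.span_le.mpr hS)

namespace LefschetzData

variable {A : Type*} [AddCommGroup A] [Module ℂ A] {n : ℕ} {E F : Module.End ℂ A}
  {D : ℕ → AddSubgroup A} (h : LefschetzData n E F D)

include h

/-- Test on E^s w_{ℓ,j} with ℓ + s = g. Applying F^{g-ℓ'} gives 0 for ℓ' < ℓ, an element of the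
image of E, killed by φ, for ℓ' > ℓ, and a scalar times w_{ℓ,j} for ℓ' = ℓ. So c_ℓ is the inverse of
that scalar and does not depend on x. -/
theorem expansion {ι : ℕ → Type*} [∀ ℓ, Fintype (ι ℓ)] {w : (ℓ : ℕ) → ι ℓ → A}
    (hw : ∀ ℓ i, w ℓ i ∈ D ℓ) (hF : ∀ ℓ i, F (w ℓ i) = 0)
    (hspan : ∀ ℓ, ∀ p ∈ D ℓ, F p = 0 → p ∈ Submodule.span ℂ (Set.range (w ℓ)))
    {φ : (ℓ : ℕ) → ι ℓ → A →ₗ[ℂ] ℂ} (hφ : ∀ ℓ i, φ ℓ i (w ℓ i) = 1)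
    (hφ' : ∀ ℓ i j, j ≠ i → φ ℓ i (w ℓ j) = 0) (hφE : ∀ ℓ i x, φ ℓ i (E x) = 0) (g : ℕ) :
    ∃ c : Fin (g + 1) → ℂ, ∀ x ∈ Submodule.span ℂ (D g : Set A),
      x = ∑ ℓ : Fin (g + 1), ∑ i : ι ℓ,
        (c ℓ * φ ℓ i (F^[g - ℓ] x)) • E^[g - ℓ] (w ℓ i) := by
  let C : Fin (g + 1) → ℂ := fun ℓ => ∏ i ∈ Finset.range (g - ℓ),
    (((0 + i : ℕ) : ℂ) + 1) * ((n : ℂ) - 2 * (ℓ : ℕ) - ((0 + i : ℕ) : ℂ))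
  refine ⟨fun ℓ => (C ℓ)⁻¹, fun x hx => ?_⟩
  let T : Module.End ℂ A := ∑ ℓ : Fin (g + 1), ∑ i : ι ℓ,
    ((C ℓ)⁻¹ • (φ ℓ i ∘ₗ F ^ (g - ℓ))).smulRight (E^[g - ℓ] (w ℓ i))
  have hT : ∀ x, T x = ∑ ℓ : Fin (g + 1), ∑ i : ι ℓ,
      ((C ℓ)⁻¹ * φ ℓ i (F^[g - ℓ] x)) • E^[g - ℓ] (w ℓ i) := by
    intro x
    simp only [T, LinearMap.sum_apply]
    simp [Module.End.pow_apply]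
  rw [← hT]
  have hx' : x ∈ Submodule.span ℂ (raisedPrim E F D g) := by
    refine Submodule.span_le.mpr (fun y hy => ?_) hx
    have : AddSubgroup.closure (raisedPrim E F D g) ≤
        (Submodule.span ℂ (raisedPrim E F D g)).toAddSubgroup :=
      (AddSubgroup.closure_le _).mpr Submodule.subset_span
    exact this (h.mem_closure hy)
  have hbasis : ∀ (ℓ s : ℕ), ℓ + s = g → ∀ j, E^[s] (w ℓ j) = T (E^[s] (w ℓ j)) := by
    rintro ℓ s rfl j
    have hℓ : ℓ < ℓ + s + 1 := by omega
    rw [hT, Finset.sum_eq_single (⟨ℓ, hℓ⟩ : Fin (ℓ + s + 1))]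
    · have h1 := h.iterate_lower_iterate (hw ℓ j) (hF ℓ j) s 0
      have hC : C ⟨ℓ, hℓ⟩ = ∏ i ∈ Finset.range s,
          (((0 + i : ℕ) : ℂ) + 1) * ((n : ℂ) - 2 * ℓ - ((0 + i : ℕ) : ℂ)) := by
        simp only [C, Nat.add_sub_cancel_left]
      rw [← hC, add_zero, Function.iterate_zero_apply] at h1
      simp only [Nat.add_sub_cancel_left, h1, map_smul, smul_eq_mul]
      rw [Finset.sum_eq_single j (fun i _ hij => by rw [hφ' ℓ i j hij.symm]; simp) (by simp), hφ,
        mul_one]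
      -- If the scalar is 0, its inverse is 0 by convention; this is harmless because E^s w_{ℓ,j} is
      -- then 0 as well.
      by_cases h0 : C ⟨ℓ, hℓ⟩ = 0
      · rw [h.iterate_eq_zero (hw ℓ j) (hF ℓ j) (hC ▸ h0), smul_zero]
      · rw [inv_mul_cancel₀ h0, one_smul]
    · intro ℓ' _ hne
      refine Finset.sum_eq_zero fun i _ => ?_
      suffices φ ℓ' i (F^[ℓ + s - ℓ'] (E^[s] (w ℓ j))) = 0 by rw [this, mul_zero, zero_smul]
      have hne' : (ℓ' : ℕ) ≠ ℓ := fun h => hne (Fin.ext h)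
      rcases lt_or_gt_of_ne hne' with hlt | hgt
      · rw [h.iterate_lower_iterate_of_lt (hw ℓ j) (hF ℓ j) (by omega), map_zero]
      · obtain ⟨t, ht⟩ := Nat.exists_eq_add_of_lt hgt
        have hs : s = (ℓ + s - ℓ') + (t + 1) := by omega
        have h1 := h.iterate_lower_iterate (hw ℓ j) (hF ℓ j) (ℓ + s - ℓ') (t + 1)
        rw [← hs] at h1
        rw [h1, map_smul, Function.iterate_succ_apply', hφE, smul_zero]
    · simp
  clear hx
  induction hx' using Submodule.span_induction with
  | zero => rw [map_zero]
  | add x y _ _ hx hy => rw [map_add, ← hx, ← hy]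
  | smul c x _ hx => rw [map_smul, ← hx]
  | mem x hx =>
    obtain ⟨ℓ, s, hg, p, hp, hp0, rfl⟩ := hx
    suffices ∀ x ∈ Submodule.span ℂ (Set.range (w ℓ)), (E ^ s) x = T ((E ^ s) x) by
      have h1 := this p (hspan ℓ p hp hp0)
      rwa [Module.End.pow_apply] at h1
    intro x hx
    induction hx using Submodule.span_induction with
    | zero => rw [map_zero, map_zero]
    | add x y _ _ hx hy => rw [map_add, map_add, ← hx, ← hy]
    | smul c x _ hx => rw [map_smul, map_smul, ← hx]
    | mem x hx =>
      obtain ⟨j, rfl⟩ := hx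
      rw [Module.End.pow_apply]
      exact hbasis ℓ s hg j

theorem exists_expansion
    (hfin : ∀ ℓ, Module.Finite ℂ (Submodule.span ℂ {p | p ∈ D ℓ ∧ F p = 0}))
    (hdisj : ∀ ℓ, Disjoint (Submodule.span ℂ {p | p ∈ D ℓ ∧ F p = 0}) (LinearMap.range E)) (g : ℕ) :
    ∃ (N : ℕ → ℕ) (w : (ℓ : ℕ) → Fin (N ℓ) → A) (φ : (ℓ : ℕ) → Fin (N ℓ) → A →ₗ[ℂ] ℂ)
      (c : Fin (g + 1) → ℂ), (∀ ℓ i, w ℓ i ∈ D ℓ ∧ F (w ℓ i) = 0) ∧ (∀ ℓ i x, φ ℓ i (E x) = 0) ∧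
        ∀ x ∈ Submodule.span ℂ (D g : Set A),
          x = ∑ ℓ : Fin (g + 1), ∑ i : Fin (N ℓ),
            (c ℓ * φ ℓ i (F^[g - ℓ] x)) • E^[g - ℓ] (w ℓ i) := by
  choose w hw hspan hli using fun ℓ =>
    Submodule.exists_fun_fin_finrank_span_eq ℂ {p | p ∈ D ℓ ∧ F p = 0}
  choose φ hφ hφ' hφE using fun ℓ => exists_dual_family (hli ℓ) (LinearMap.range E)
    ((hspan ℓ).symm ▸ hdisj ℓ)
  have hφE' : ∀ ℓ i x, φ ℓ i (E x) = 0 := fun ℓ i x => hφE ℓ i _ ⟨x, rfl⟩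
  obtain ⟨c, hc⟩ := h.expansion (fun ℓ i => (hw ℓ i).1) (fun ℓ i => (hw ℓ i).2)
    (fun ℓ p hp hp' => (hspan ℓ).symm ▸ Submodule.subset_span ⟨hp, hp'⟩) hφ hφ' hφE' g
  exact ⟨_, w, φ, c, hw, hφE', hc⟩

end LefschetzData

/-! ### The function Z as an element of the direct sum. -/

section membership

variable {V : Type*} [NormedAddCommGroup V] [InnerProductSpace ℂ V] [FiniteDimensional ℂ V]
  (M : Submodule ℤ V) {q : ℝ} {n : ℕ} (b : OrthonormalBasis (Fin n) ℂ V) {K : Subfield ℂ}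
  {W : Submodule K V}

instance (p : ℕ) : FiniteDimensional ℂ (Alt V p) := by
  have : FiniteDimensional ℝ V := FiniteDimensional.complexToReal V
  let f : Alt V p →ₗ[ℝ] MultilinearMap ℝ (fun _ : Fin p => V) ℂ :=
    { toFun := fun η => η.toMultilinearMap
      map_add' := fun _ _ => rfl
      map_smul' := fun _ _ => rfl }
  have hf : Function.Injective f := fun η η' h => by
    ext v
    exact congrArg (fun T : MultilinearMap ℝ (fun _ : Fin p => V) ℂ => T v) h
  have : Module.Finite ℝ (Alt V p) := Module.Finite.of_injective f hf
  exact Module.Finite.of_restrictScalars_finite ℝ ℂ (Alt V p)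

/-- The forms of type `(g, g)`. -/
def typeGG (V : Type*) [NormedAddCommGroup V] [InnerProductSpace ℂ V] (g : ℕ) :
    Submodule ℂ (Alt V (2 * g)) where
  carrier := {η | IsTypeGG g η}
  add_mem' := IsTypeGG.add
  zero_mem' := IsTypeGG.zero
  smul_mem' c _ h := h.smul c

/-- The class of a constant form. -/
def constClass (g : ℕ) : typeGG V g →ₗ[ℂ] Cohomology M where
  toFun η := inDegree M g (constForm M η.1 η.2)
  map_add' η η' := inDegree_constForm_add η.2 η'.2
  map_smul' c η := inDegree_constForm_smul η.2 c

/-- Primitive elements of the rational classes. -/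
def primClasses (q : ℝ) (W : Submodule K V) (ℓ : ℕ) : Set (Cohomology M) :=
  {w | w ∈ rationalClasses M W ℓ ∧ adjTot M q b w = 0}

theorem finite_span_primClasses (q : ℝ) (ℓ : ℕ) :
    Module.Finite ℂ (Submodule.span ℂ (primClasses M b q W ℓ)) := by
  refine finite_span_of_subset_range (A := Cohomology M) (B := typeGG V ℓ) (constClass M ℓ) ?_
  rintro _ ⟨⟨η, h, -, rfl⟩, -⟩
  exact ⟨⟨η, h⟩, rfl⟩

theorem disjoint_span_primClasses_range (h : IsRationalModel q K W) (ℓ : ℕ) :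
    Disjoint (Submodule.span ℂ (primClasses M b q W ℓ)) (LinearMap.range (lefTot M q b)) := by
  rw [Submodule.disjoint_def]
  intro x hx hxz
  have hL := lefschetzData_pureDegree M b h.ne_zero
  have hx' : x ∈ pureDegree M ℓ ∧ adjTot M q b x = 0 := by
    clear hxz
    induction hx using Submodule.span_induction with
    | zero => exact ⟨zero_mem _, map_zero _⟩
    | add x y _ _ hx hy => exact ⟨add_mem hx.1 hy.1, by rw [map_add, hx.2, hy.2, add_zero]⟩
    | smul c x _ hx =>
      exact ⟨mem_pureDegree.mpr fun j hj => by rw [Pi.smul_apply, apply_eq_zero hx.1 hj, smul_zero],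
        by rw [map_smul, hx.2, smul_zero]⟩
    | mem x hx => exact ⟨rationalClasses_le ℓ hx.1, hx.2⟩
  obtain ⟨z, rfl⟩ := hxz
  obtain ⟨h1, h2⟩ := hx'
  obtain _ | ℓ := ℓ
  · rw [← inDegree_apply_of_mem h1, lefTot_zero, map_zero]
  · have h3 : lefTot M q b z = lefTot M q b (inDegree M ℓ (z ℓ)) := by
      rw [lefTot_inDegree, ← lefTot_succ, inDegree_apply_of_mem h1]
    rw [h3] at h2 ⊢
    exact hL.prim_raise_eq_zero (inDegree_mem ℓ _) h2

/-- The homology class of degree `ℓ` defined by a functional on `⨁ H^{g,g}`. -/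
def homologyClass (ℓ : ℕ) (φ : Cohomology M →ₗ[ℂ] ℂ) : Homology M :=
  Pi.single ℓ (φ ∘ₗ inDegree M ℓ)

theorem homologyClass_same (ℓ : ℕ) (φ : Cohomology M →ₗ[ℂ] ℂ) :
    homologyClass M ℓ φ ℓ = φ ∘ₗ inDegree M ℓ :=
  Pi.single_eq_same (M := fun g => Module.Dual ℂ (harmonicForms M g)) ℓ _

theorem homologyClass_of_ne {ℓ j : ℕ} (hj : j ≠ ℓ) (φ : Cohomology M →ₗ[ℂ] ℂ) :
    homologyClass M ℓ φ j = 0 :=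
  Pi.single_eq_of_ne (M := fun g => Module.Dual ℂ (harmonicForms M g)) hj _

theorem lefDual_homologyClass (ℓ : ℕ) {φ : Cohomology M →ₗ[ℂ] ℂ}
    (hφ : ∀ x, φ (lefTot M q b x) = 0) : lefDual M q b (homologyClass M ℓ φ) = 0 := by
  funext g
  ext1 ψ
  change homologyClass M ℓ φ (g + 1) (lef M q b g ψ) = 0
  by_cases hg : g + 1 = ℓ
  · subst hg
    rw [homologyClass_same, LinearMap.comp_apply, ← lefTot_inDegree, hφ]
  · rw [homologyClass_of_ne M hg]
    rfl

/-- A functional that vanishes on the image of L is killed by L^*, so by equivariance its image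
under u is killed by Δ. -/
theorem cycleFamily_homologyClass_mem (ℓ : ℕ) {φ : Cohomology M →ₗ[ℂ] ℂ}
    (hφ : ∀ x, φ (lefTot M q b x) = 0) :
    cycleFamily M b q (homologyClass M ℓ φ) ∈ primPoly n ℓ := by
  refine ⟨(cycleMap M b q (homologyClass M ℓ φ)).2, fun j hj => ?_, ?_⟩
  · funext U
    change homologyClass M ℓ φ j _ = 0
    rw [homologyClass_of_ne M hj]
    rfl
  · have h1 := congrArg Subtype.val (cycleMap_lefDual M b (q := q) (homologyClass M ℓ φ))
    have h2 : lefDualEnd M b q (homologyClass M ℓ φ) = 0 := lefDual_homologyClass M b ℓ hφ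
    rw [h2, map_zero] at h1
    exact h1.symm

theorem iterate_adjDual_apply (α : Homology M) (ℓ s : ℕ) (ψ : harmonicForms M (ℓ + s)) :
    ((adjDual M q b)^[s] α) (ℓ + s) ψ = α ℓ (((adjTot M q b)^[s] (inDegree M (ℓ + s) ψ)) ℓ) := by
  induction s with
  | zero => exact congrArg (α ℓ) (inDegree_same ℓ ψ).symm
  | succ s ih =>
    rw [Function.iterate_succ_apply', Function.iterate_succ_apply]
    exact (ih (adj M q b (ℓ + s) ψ)).trans
      (congrArg (fun x => α ℓ (((adjTot M q b)^[s] x) ℓ)) (adjTot_inDegree b q (ℓ + s) ψ).symm)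

theorem cycleFamily_iterate_adjDual (hq : q ≠ 0) (α : Homology M) (s : ℕ) :
    cycleFamily M b q ((adjDual M q b)^[s] α) = raiseTot^[s] (cycleFamily M b q α) := by
  induction s with
  | zero => rfl
  | succ s ih =>
    rw [Function.iterate_succ_apply', Function.iterate_succ_apply', ← ih]
    exact congrArg Subtype.val (cycleMap_adjDual M b hq ((adjDual M q b)^[s] α))

/-- By equivariance Λ^{g-ℓ} u(φ) = u((δ^*)^{g-ℓ} φ), whose value is φ(δ^{g-ℓ} Z). This identifies
the coefficients of the expansion with raised primitive polynomials. -/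
theorem iterate_raiseTot_homologyClass (hq : q ≠ 0) (φ : Cohomology M →ₗ[ℂ] ℂ) {ℓ g : ℕ}
    (hℓ : ℓ ≤ g) (U : Matrix (Fin n) (Fin g) ℂ) :
    (raiseTot^[g - ℓ] (cycleFamily M b q (homologyClass M ℓ φ))) g U =
      φ ((adjTot M q b)^[g - ℓ] (inDegree M g (zClass M q (vectors b U)))) := by
  obtain ⟨s, rfl⟩ := Nat.exists_eq_add_of_le hℓ
  rw [Nat.add_sub_cancel_left]
  have hmem : ∀ (s : ℕ) (ψ : harmonicForms M (ℓ + s)),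
      (adjTot M q b)^[s] (inDegree M (ℓ + s) ψ) ∈ pureDegree M ℓ := by
    intro s
    induction s with
    | zero => exact fun ψ => inDegree_mem ℓ ψ
    | succ s ih =>
      intro ψ
      rw [Function.iterate_succ_apply]
      exact (adjTot_inDegree b q (ℓ + s) ψ).symm ▸ ih (adj M q b (ℓ + s) ψ)
  rw [← cycleFamily_iterate_adjDual M b hq, cycleFamily, iterate_adjDual_apply, homologyClass_same,
    LinearMap.comp_apply, inDegree_apply_of_mem (hmem s _)]

theorem zClass_mem_iSup (h : IsRationalModel q K W) (hW : (M : Set V) ⊆ W) (g : ℕ) :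
    (fun U : Matrix (Fin n) (Fin g) ℂ => zClass M q (vectors b U)) ∈
      ⨆ ℓ : Fin (g + 1), lefSummand M q b g ℓ := by
  obtain ⟨N, w, φ, c, hw, hφ, hc⟩ := (lefschetzData_rationalClasses M b h).exists_expansion
    (finite_span_primClasses M b q) (disjoint_span_primClasses_range M b h) g
  have key : (fun U : Matrix (Fin n) (Fin g) ℂ => zClass M q (vectors b U)) =
      ∑ ℓ : Fin (g + 1), ∑ i, c ℓ • fun U =>
        (raiseTot^[g - ℓ] (cycleFamily M b q (homologyClass M ℓ (φ ℓ i)))) g U •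
          ((lefTot M q b)^[g - ℓ] (w ℓ i)) g := by
    funext U
    have h1 := congrFun (hc _ (inDegree_zClass_mem_span M h (vectors b U))) g
    rw [inDegree_same] at h1
    rw [h1]
    simp only [Finset.sum_apply, Pi.smul_apply]
    refine Finset.sum_congr rfl fun ℓ _ => Finset.sum_congr rfl fun i _ => ?_
    rw [iterate_raiseTot_homologyClass M b h.ne_zero (φ ℓ i) (Nat.lt_succ_iff.mp ℓ.2), smul_smul]
  rw [key]
  refine Submodule.sum_mem _ fun ℓ _ => Submodule.sum_mem _ fun i _ => Submodule.smul_mem _ _ ?_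
  refine Submodule.mem_iSup_of_mem ℓ (Submodule.subset_span ⟨_, cycleFamily_homologyClass_mem M b ℓ
    (hφ ℓ i), w ℓ i, ⟨?_, (hw ℓ i).2, isRational_of_mem M hW (hw ℓ i).1⟩, rfl⟩)
  exact mem_pureDegree.mp (rationalClasses_le _ (hw ℓ i).1)

end membership

end HermitianCycles

/-! ### The theorem. -/

open HermitianCycles

theorem mainTheorem8 {k : Type*} [Field k] [NumberField k] [NumberField.IsTotallyComplex k]
    (hk : Module.finrank ℚ k = 2) (τ : k →+* ℂ)
    {V : Type*} [NormedAddCommGroup V] [InnerProductSpace ℂ V] [FiniteDimensional ℂ V]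
    (M : Submodule ℤ V) (hM : HermitianCycles.IsHermitianLattice τ M)
    {n : ℕ} (b : OrthonormalBasis (Fin n) ℂ V) :
    (∃ (ρH : LieAlgebra.SpecialLinear.sl (Fin 2) ℂ →ₗ⁅ℂ⁆
          Module.End ℂ (HermitianCycles.Homology M))
        (ρF : LieAlgebra.SpecialLinear.sl (Fin 2) ℂ →ₗ⁅ℂ⁆
          Module.End ℂ (HermitianCycles.polyTot n))
        (u : HermitianCycles.Homology M →ₗ[ℂ] HermitianCycles.polyTot n),
      (∀ α, ρH HermitianCycles.slE α =
        HermitianCycles.adjDual M (HermitianCycles.sqrtD k) b α) ∧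
      (∀ α, ρH HermitianCycles.slF α =
        HermitianCycles.lefDual M (HermitianCycles.sqrtD k) b α) ∧
      (∀ α, ρH HermitianCycles.slH α = HermitianCycles.weightDual M n α) ∧
      (∀ P, (ρF HermitianCycles.slE P : HermitianCycles.Family n) =
        HermitianCycles.raiseTot (P : HermitianCycles.Family n)) ∧
      (∀ P, (ρF HermitianCycles.slF P : HermitianCycles.Family n) =
        HermitianCycles.laplaceTot (P : HermitianCycles.Family n)) ∧
      (∀ P, (ρF HermitianCycles.slH P : HermitianCycles.Family n) =
        HermitianCycles.degreeTot (P : HermitianCycles.Family n)) ∧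
      (∀ (α : HermitianCycles.Homology M) (g : ℕ) (U : Matrix (Fin n) (Fin g) ℂ),
        (u α : HermitianCycles.Family n) g U =
          α g (HermitianCycles.zClass M (HermitianCycles.sqrtD k)
            (HermitianCycles.vectors b U))) ∧
      ∀ X α, u (ρH X α) = ρF X (u α)) ∧
    (∀ (g : ℕ) (l : Fin (g + 1) → V),
      HermitianCycles.adj M (HermitianCycles.sqrtD k) b g
          (HermitianCycles.zClass M (HermitianCycles.sqrtD k) l) =
        ∑ i, ∑ j, HermitianCycles.herm (l j) (l i) •
          HermitianCycles.vClass M (HermitianCycles.sqrtD k) l i j) ∧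
    (∀ g : ℕ,
      iSupIndep (fun ℓ : Fin (g + 1) =>
        HermitianCycles.lefSummand M (HermitianCycles.sqrtD k) b g ℓ) ∧
      (fun U : Matrix (Fin n) (Fin g) ℂ => HermitianCycles.zClass M (HermitianCycles.sqrtD k)
          (HermitianCycles.vectors b U)) ∈
        ⨆ ℓ : Fin (g + 1), HermitianCycles.lefSummand M (HermitianCycles.sqrtD k) b g ℓ) := by
  have hq := sqrtD_ne_zero k
  refine ⟨⟨homologyRep M b hq, polyRep n, cycleMap M b (sqrtD k), fun α => ?_, fun α => ?_, fun α => ?_,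
    fun P => ?_, fun P => ?_, fun P => ?_, fun _ _ _ => rfl, fun X α => cycleMap_equivariant M b hq X α⟩,
    fun g l => adj_zClass M b hq g l, ?_⟩
  · rw [homologyRep, sl2Rep_slE]; rfl
  · rw [homologyRep, sl2Rep_slF]; rfl
  · rw [homologyRep, sl2Rep_slH]; rfl
  · rw [polyRep, sl2Rep_slE]; rfl
  · rw [polyRep, sl2Rep_slF]; rfl
  · rw [polyRep, sl2Rep_slH]; rfl
  · have hmodel := hM.isRationalModel hk
    exact fun g => ⟨iSupIndep_lefSummand M b hq g, zClass_mem_iSup M b hmodel Submodule.subset_span g⟩
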